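/- **Setting.** Let $h_{12},h_{21}\in\mathbb C$ and $P_1,P_2>0$. The two-user complex Gaussian interference channel (GIC) is $$Y_1=X_1+h_{12}X_2+Z_1,\qquad Y_2=h_{21}X_1+X_2+Z_2,$$ with $Z_1,Z_2\sim\mathcal{CN}(0,1)$ i.i.d. in time and independent of the inputs. A $(2^{nR_1},2^{nR_2})$ code consists of encoders and decoders for independent uniform messages in $[1:2^{nR_1}]$ and $[1:2^{nR_2}]$, with every codeword satisfying $\|X_i^n\|^2\le nP_i$. A pair $(R_1,R_2)$ with $R_1,R_2\ge 0$ is achievable if some sequence of such codes has average error probabilities of both users tending to $0$; the capacity region is the closure of the set of achievable pairs. The interference is weak: $|h_{12}|\le1$ and $|h_{21}|\le 1$. Differential entropies $h(\cdot)$ are in bits. **Parameters.** Let $\kappa=(\sigma_{N_1},\sigma_{N_2},\sigma_{W_1},\sigma_{W_2},\rho_{N_1},\rho_{N_2},\rho_{W_1},\rho_{W_2})$ with $\sigma$'s in $[0,1]$ and $\rho$'s complex of modulus at most $1$. Let all of the following be zero-mean, jointly circularly symmetric complex Gaussian: $X_{iG}\sim\mathcal{CN}(0,P_i)$; $Z_i\sim\mathcal{CN}(0,1)$;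 $N_1\sim\mathcal{CN}(0,\sigma_{N_1}^2)$ with $\mathbb E[Z_1N_1^*]=\rho_{N_1}\sigma_{N_1}$; $W_2\sim\mathcal{CN}(0,\sigma_{W_2}^2)$ with $\mathbb E[Z_2W_2^*]=\rho_{W_2}\sigma_{W_2}$; the variables $X_{1G}$, $X_{2G}$, the pair $(Z_1,N_1)$ and the pair $(Z_2,W_2)$ are independent. Put $$S_{1G}=h_{21}X_{1G}+N_1,\quad U_{2G}=h_{21}X_{1G}+W_2,\quad Y_{1G}=X_{1G}+h_{12}X_{2G}+Z_1,\quad Y_{2G}=h_{21}X_{1G}+X_{2G}+Z_2.$$ Let $\sigma^2_X$ denote the variance of $X$ and $\sigma^2_{X|Y}$ the conditional variance of $X$ given $Y$. Let $V_{N_1}\sim\mathcal{CN}(0,\sigma^2_{V_{N_1}})$ and $V_{W_2}\sim\mathcal{CN}(0,\sigma^2_{V_{W_2}})$ be independent of everything else, where $\sigma^2_{V_{N_1}}=\sigma^2_{Z_1|N_1}$ and $\sigma^2_{V_{W_2}}=\sigma^2_{W_2|Z_2-W_2}$, and let $$\tilde V'_{N_1}=\sqrt{1-\sigma_{V_{N_1}}^{-2}|h_{12}|^2\sigma^2_{Z_2-W_2}}\;V_{N_1}.$$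 **Theorem.** For every $\kappa$ as above such that $$\sigma^2_{V_{W_2}}\ge\min(\sigma^2_{N_1},\sigma^2_{W_2}),\qquad \sigma^2_{V_{N_1}}\ge|h_{12}|^2\sigma^2_{Z_2-W_2},$$ and for which the entropies below are finite, that is, $\sigma_{N_1}\ne0$, $(\sigma_{W_2},\rho_{W_2})\ne(1,1)$, $\sigma_{W_2}\neq 0$ if $h_{21}=0$, and $|\rho_{N_1}|\ne1$ if $h_{12}=0$, every rate pair $(R_1,R_2)$ in the capacity region of the two-user GIC in the weak interference regime satisfies $$\begin{aligned}R_1+2R_2\le{}& h(S_{1G})-h(h_{21}X_{1G}+V_{W_2})+h(U_{2G})-h(Y_{2G}|X_{2G})\\&+h(Y_{2G}|U_{2G})-h(h_{12}Y_{2G}+\tilde V'_{N_1}|U_{2G})\\&+h(Y_{1G}|S_{1G})-h(N_1)+h(Y_{2G})-h(Z_2-W_2).\end{aligned}$$ Interchanging the user indices $1$ and $2$ everywhere (in the hypotheses on $\kappa$ and in the bound), every such rate pair also satisfies the resulting bound on $2R_1+R_2$. -/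

import Mathlib

open MeasureTheory ProbabilityTheory Filter Topology
open scoped ComplexConjugate

namespace GaussIC

/-! ### Complex Gaussian noise, differential entropy, conditional variance -/

/-- The law `CN(0,1)`: real and imaginary parts are independent, centred, of variance `1/2`. -/
noncomputable def stdCN : Measure ℂ :=
  ((gaussianReal 0 (1 / 2)).prod (gaussianReal 0 (1 / 2))).map
    (fun p : ℝ × ℝ => Complex.equivRealProd.symm p)

theorem measurable_equivRealProd_symm :
    Measurable (fun p : ℝ × ℝ => Complex.equivRealProd.symm p) :=
  Complex.measurableEquivRealProd.symm.measurable

instance instIsProbabilityMeasureStdCN : IsProbabilityMeasure stdCN :=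
  Measure.isProbabilityMeasure_map measurable_equivRealProd_symm.aemeasurable

/-- The law of `k` independent `CN(0,1)` variables. -/
noncomputable def iidCN (k : ℕ) : Measure (Fin k → ℂ) :=
  Measure.pi (fun _ => stdCN)

instance instIsProbabilityMeasureIidCN (k : ℕ) : IsProbabilityMeasure (iidCN k) := by
  unfold iidCN
  infer_instance

/-- Differential entropy, in bits, of a law on `ℂ` that has a density `p` with respect to
Lebesgue measure: `-∫ p log₂ p`. It is used only for laws with a density. -/
noncomputable def lawEntropy (μ : Measure ℂ) : ℝ :=
  -∫ z, (μ.rnDeriv volume z).toReal * Real.logb 2 (μ.rnDeriv volume z).toReal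

section Entropy

variable {Ω : Type} [MeasurableSpace Ω]

/-- Differential entropy `h(X)`. -/
noncomputable def entropy (P : Measure Ω) (X : Ω → ℂ) : ℝ :=
  lawEntropy (P.map X)

/-- Conditional differential entropy `h(X | Y)`: the entropy of the conditional law of `X`
given `Y = y`, averaged over the law of `Y`. -/
noncomputable def condEntropy (P : Measure Ω) [IsFiniteMeasure P] (X Y : Ω → ℂ) : ℝ :=
  ∫ y, lawEntropy (condDistrib X Y P y) ∂(P.map Y)

/-- The variance `σ²_X = E|X - E X|²`. -/
noncomputable def cVar (P : Measure Ω) (X : Ω → ℂ) : ℝ :=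
  ∫ ω, ‖X ω - ∫ ω', X ω' ∂P‖ ^ 2 ∂P

/-- The conditional variance `σ²_{X|Y} = E|X - E[X|Y]|²` (for jointly Gaussian `X`, `Y` the
variance of the conditional law of `X` given `Y = y` is the same for almost all `y`). -/
noncomputable def cCondVar (P : Measure Ω) (X Y : Ω → ℂ) : ℝ :=
  ∫ ω, ‖X ω - (P[X | MeasurableSpace.comap Y inferInstance]) ω‖ ^ 2 ∂P

end Entropy

/-! ### The channel and its capacity region -/

/-- The complex two-user Gaussian interference channel
`Y₁ = X₁ + h₁₂ X₂ + Z₁`, `Y₂ = h₂₁ X₁ + X₂ + Z₂` with power constraints `P₁`, `P₂`. -/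
structure Channel where
  h12 : ℂ
  h21 : ℂ
  P1 : ℝ
  P2 : ℝ
  P1_pos : 0 < P1
  P2_pos : 0 < P2

/-- Interchange of the two users. -/
def Channel.swap (c : Channel) : Channel :=
  ⟨c.h21, c.h12, c.P2, c.P1, c.P2_pos, c.P1_pos⟩

/-- The weak interference regime. -/
def Channel.WeakInterference (c : Channel) : Prop :=
  ‖c.h12‖ ≤ 1 ∧ ‖c.h21‖ ≤ 1

/-- A code of block length `n` with `M₁` and `M₂` messages; every codeword obeys the power
constraint. -/
structure Code (c : Channel) (n M1 M2 : ℕ) where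
  enc1 : Fin M1 → Fin n → ℂ
  enc2 : Fin M2 → Fin n → ℂ
  dec1 : (Fin n → ℂ) → Fin M1
  dec2 : (Fin n → ℂ) → Fin M2
  power1 : ∀ m, ∑ t, ‖enc1 m t‖ ^ 2 ≤ n * c.P1
  power2 : ∀ m, ∑ t, ‖enc2 m t‖ ^ 2 ≤ n * c.P2
  measurable_dec1 : Measurable dec1
  measurable_dec2 : Measurable dec2

/-- Average error probability of user 1: both messages are uniform and independent, and the
noise sequence `Z₁ⁿ` is i.i.d. `CN(0,1)`. -/
noncomputable def Code.err1 {c : Channel} {n M1 M2 : ℕ} (C : Code c n M1 M2) : ℝ :=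
  (∑ m1, ∑ m2, (iidCN n).real
    {z | C.dec1 (fun t => C.enc1 m1 t + c.h12 * C.enc2 m2 t + z t) ≠ m1}) / (M1 * M2)

/-- Average error probability of user 2. -/
noncomputable def Code.err2 {c : Channel} {n M1 M2 : ℕ} (C : Code c n M1 M2) : ℝ :=
  (∑ m1, ∑ m2, (iidCN n).real
    {z | C.dec2 (fun t => c.h21 * C.enc1 m1 t + C.enc2 m2 t + z t) ≠ m2}) / (M1 * M2)

/-- The size `⌈2^{nR}⌉` of the message set `[1 : 2^{nR}]`. -/
noncomputable def numMsg (n : ℕ) (R : ℝ) : ℕ := ⌈(2 : ℝ) ^ ((n : ℝ) * R)⌉₊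

/-- `(R₁, R₂)` is achievable: some sequence of `(2^{nR₁}, 2^{nR₂})` codes has vanishing average
error probabilities. -/
def Channel.Achievable (c : Channel) (R : ℝ × ℝ) : Prop :=
  0 ≤ R.1 ∧ 0 ≤ R.2 ∧
    ∃ C : ∀ n : ℕ, Code c n (numMsg n R.1) (numMsg n R.2),
      Tendsto (fun n => (C n).err1) atTop (𝓝 0) ∧ Tendsto (fun n => (C n).err2) atTop (𝓝 0)

/-- The capacity region: the closure of the set of achievable rate pairs. -/
def Channel.capacityRegion (c : Channel) : Set (ℝ × ℝ) :=
  closure {R | c.Achievable R}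

/-! ### Genie parameters and the single-letter Gaussian variables -/

/-- The genie parameters `κ`: standard deviations and (complex) correlation coefficients. -/
structure Params where
  σN1 : ℝ
  σN2 : ℝ
  σW1 : ℝ
  σW2 : ℝ
  ρN1 : ℂ
  ρN2 : ℂ
  ρW1 : ℂ
  ρW2 : ℂ

/-- Interchange of the two users. -/
def Params.swap (κ : Params) : Params :=
  ⟨κ.σN2, κ.σN1, κ.σW2, κ.σW1, κ.ρN2, κ.ρN1, κ.ρW2, κ.ρW1⟩

/-- The range of the parameters. -/
def Params.InRange (κ : Params) : Prop :=
  (0 ≤ κ.σN1 ∧ κ.σN1 ≤ 1) ∧ (0 ≤ κ.σN2 ∧ κ.σN2 ≤ 1) ∧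
  (0 ≤ κ.σW1 ∧ κ.σW1 ≤ 1) ∧ (0 ≤ κ.σW2 ∧ κ.σW2 ≤ 1) ∧
  ‖κ.ρN1‖ ≤ 1 ∧ ‖κ.ρN2‖ ≤ 1 ∧ ‖κ.ρW1‖ ≤ 1 ∧ ‖κ.ρW2‖ ≤ 1

/-- The sample space: eight independent `CN(0,1)` variables. All Gaussian variables below are
linear combinations of them, hence jointly circularly symmetric Gaussian. -/
abbrev Sample : Type := Fin 8 → ℂ

/-- The probability measure on the sample space. -/
noncomputable abbrev prob : Measure Sample := iidCN 8

/-- `X₁G ∼ CN(0, P₁)`. -/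
noncomputable def X1G (c : Channel) (ω : Sample) : ℂ := (√c.P1 : ℝ) * ω 0

/-- `X₂G ∼ CN(0, P₂)`. -/
noncomputable def X2G (c : Channel) (ω : Sample) : ℂ := (√c.P2 : ℝ) * ω 1

/-- `Z₁ ∼ CN(0, 1)`. -/
def Z1 (ω : Sample) : ℂ := ω 2

/-- `Z₂ ∼ CN(0, 1)`. -/
def Z2 (ω : Sample) : ℂ := ω 3

/-- `N₁ ∼ CN(0, σ²_{N₁})` with `E[Z₁ N₁*] = ρ_{N₁} σ_{N₁}`. -/
noncomputable def N1 (κ : Params) (ω : Sample) : ℂ :=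
  κ.σN1 * (conj κ.ρN1 * Z1 ω + (√(1 - ‖κ.ρN1‖ ^ 2) : ℝ) * ω 4)

/-- `W₂ ∼ CN(0, σ²_{W₂})` with `E[Z₂ W₂*] = ρ_{W₂} σ_{W₂}`. -/
noncomputable def W2 (κ : Params) (ω : Sample) : ℂ :=
  κ.σW2 * (conj κ.ρW2 * Z2 ω + (√(1 - ‖κ.ρW2‖ ^ 2) : ℝ) * ω 5)

/-- `S₁G = h₂₁ X₁G + N₁`. -/
noncomputable def S1G (c : Channel) (κ : Params) (ω : Sample) : ℂ := c.h21 * X1G c ω + N1 κ ω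

/-- `U₂G = h₂₁ X₁G + W₂`. -/
noncomputable def U2G (c : Channel) (κ : Params) (ω : Sample) : ℂ := c.h21 * X1G c ω + W2 κ ω

/-- The output of receiver 1 under Gaussian inputs. -/
noncomputable def Y1G (c : Channel) (ω : Sample) : ℂ := X1G c ω + c.h12 * X2G c ω + Z1 ω

/-- The output of receiver 2 under Gaussian inputs. -/
noncomputable def Y2G (c : Channel) (ω : Sample) : ℂ := c.h21 * X1G c ω + X2G c ω + Z2 ω

/-- `σ²_{Z₂ - W₂}`. -/
noncomputable def varZ2W2 (κ : Params) : ℝ := cVar prob (fun ω => Z2 ω - W2 κ ω)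

/-- `σ²_{V_{N₁}} = σ²_{Z₁ | N₁}`. -/
noncomputable def varVN1 (κ : Params) : ℝ := cCondVar prob Z1 (N1 κ)

/-- `σ²_{V_{W₂}} = σ²_{W₂ | Z₂ - W₂}`. -/
noncomputable def varVW2 (κ : Params) : ℝ := cCondVar prob (W2 κ) (fun ω => Z2 ω - W2 κ ω)

/-- `V_{N₁} ∼ CN(0, σ²_{V_{N₁}})`, independent of all other variables. -/
noncomputable def VN1 (κ : Params) (ω : Sample) : ℂ := (√(varVN1 κ) : ℝ) * ω 6

/-- `V_{W₂} ∼ CN(0, σ²_{V_{W₂}})`, independent of all other variables. -/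
noncomputable def VW2 (κ : Params) (ω : Sample) : ℂ := (√(varVW2 κ) : ℝ) * ω 7

/-- `Ṽ'_{N₁} = √(1 - σ_{V_{N₁}}⁻² |h₁₂|² σ²_{Z₂ - W₂}) V_{N₁}`. -/
noncomputable def VN1' (c : Channel) (κ : Params) (ω : Sample) : ℂ :=
  (√(1 - (varVN1 κ)⁻¹ * (‖c.h12‖ ^ 2 * varZ2W2 κ)) : ℝ) * VN1 κ ω

/-- The set of parameters to which the bound on `R₁ + 2 R₂` applies. -/
def Admissible (c : Channel) (κ : Params) : Prop :=
  min (κ.σN1 ^ 2) (κ.σW2 ^ 2) ≤ varVW2 κ ∧ ‖c.h12‖ ^ 2 * varZ2W2 κ ≤ varVN1 κ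

/-- For admissible parameters in range this says that all differential entropies in the bound are
finite: `N₁ ≠ 0`, `W₂ ≠ Z₂`, `U₂G ≠ 0`, and `h₁₂ Y₂G + Ṽ'_{N₁} ≠ 0` (the latter two can only fail
if a cross-channel coefficient vanishes). -/
def Nondegenerate (c : Channel) (κ : Params) : Prop :=
  κ.σN1 ≠ 0 ∧ ¬ (κ.σW2 = 1 ∧ κ.ρW2 = 1) ∧ (c.h21 = 0 → κ.σW2 ≠ 0) ∧
    (c.h12 = 0 → ‖κ.ρN1‖ ≠ 1)

/-- The Gaussian single-letter bound on `R₁ + 2 R₂`. -/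
noncomputable def bound (c : Channel) (κ : Params) : ℝ :=
  entropy prob (S1G c κ) - entropy prob (fun ω => c.h21 * X1G c ω + VW2 κ ω)
    + entropy prob (U2G c κ) - condEntropy prob (Y2G c) (X2G c)
    + condEntropy prob (Y2G c) (U2G c κ)
    - condEntropy prob (fun ω => c.h12 * Y2G c ω + VN1' c κ ω) (U2G c κ)
    + condEntropy prob (Y1G c) (S1G c κ) - entropy prob (N1 κ)
    + entropy prob (Y2G c) - entropy prob (fun ω => Z2 ω - W2 κ ω)

end GaussIC

/-! Write a = h₂₁X₁ⁿ, D = Z₂ - W₂, and split the noises into innovations: Z₁ = γN₁ + V and W₂ = βD +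
E, with V independent of N₁ and E independent of D. Let vN, d, e be the variances of V, D, E. Fano's
inequality is used three times: for user 1 with side information S₁ = a + N₁, for user 2 without
side information, and for user 2 with U₂ = a + W₂. With T = Y₂ - U₂ = X₂ + D and up to o(n) this
gives nR₁ ≤ h(S₁) - h(N₁) + h(Y₁|S₁) - h(h₁₂X₂ + V), nR₂ ≤ h(Y₂) - h(a + Z₂), nR₂ ≤ h(U₂) - h(a + E)
+ h(T|U₂) - h(D).

In the sum, h(Y₁|S₁) and h(Y₂) are at most their Gaussian values. Two groups of entropy differences
remain, one for each admissibility condition.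

The first group is h(a + N₁) - h(a + E) + h(a + W₂) - h(a + Z₂). Since e is at least the smaller of
the variances of N₁ and W₂, and the larger is at most 1, the terms pair up into differences "little
noise minus more noise". Each is largest for Gaussian a, the worst additive noise property
(`mixEntropy_sub_le`, `mixEntropy_sub_add_sub_le`).

The second group is h(T|U₂) - h(h₁₂X₂ + V). Since vN ≥ |h₁₂|²d, the vector h₁₂X₂ + V has the law of
h₁₂T plus independent noise of variance vN - |h₁₂|²d. Conditioning that entropy on U₂ and applying
the same extremal property conditionally gives the Gaussian value (`rate_le_of_genie`).

No multi-letter conditional entropy is ever formed. Each rate bound is a single instance of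
`fano_gibbs`: for a given message the noise, of density f, is carried to the outputs by a map
preserving Lebesgue measure, and is compared there with a chosen density q. Factors of q that are
mixture densities produce the entropies to be kept (`mixEntropy`); Gaussian factors centred at a
linear estimate produce the terms to be bounded, and see the code only through second moments.
Centring the codewords of user 2 removes the cross terms from these moments. `exists_bound_eq`
evaluates the single-letter bound in the same parameters, and letting the block length grow finishes
the proof. -/

namespace GaussIC

/-! ### The law `CN(0, v)` -/

/-- The law `CN(0, v)`. -/
noncomputable def CN (v : ℝ) : Measure ℂ :=
  ((gaussianReal 0 (v / 2).toNNReal).prod (gaussianReal 0 (v / 2).toNNReal)).map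
    (fun p : ℝ × ℝ => Complex.equivRealProd.symm p)

instance instIsProbabilityMeasureCN (v : ℝ) : IsProbabilityMeasure (CN v) :=
  Measure.isProbabilityMeasure_map measurable_equivRealProd_symm.aemeasurable

theorem stdCN_eq_CN_one : stdCN = CN 1 := by
  have : ((1 : ℝ) / 2).toNNReal = 1 / 2 := by
    rw [Real.toNNReal_div zero_le_one]; norm_num
  rw [stdCN, CN, this]

/-- The real and imaginary parts carry variance v/2 each, whence the 4 in place of the usual 2.
Equality of laws is checked below by comparing with this formula. -/
theorem charFun_CN {v : ℝ} (hv : 0 ≤ v) (t : ℂ) :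
    charFun (CN v) t = Complex.exp (-(v * ‖t‖ ^ 2 / 4 : ℝ)) := by
  have h1 : ∀ p : ℝ × ℝ, Complex.exp ((inner ℝ (Complex.equivRealProd.symm p) t : ℝ) * Complex.I)
      = Complex.exp (t.re * p.1 * Complex.I) * Complex.exp (t.im * p.2 * Complex.I) := by
    intro p
    rw [← Complex.exp_add]
    congr 1
    simp [Complex.inner, Complex.equivRealProd]
    ring
  rw [charFun_apply, CN, integral_map measurable_equivRealProd_symm.aemeasurable
    (by fun_prop)]
  simp_rw [h1]
  rw [integral_prod_mul (fun x : ℝ => Complex.exp (t.re * x * Complex.I))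
    (fun x : ℝ => Complex.exp (t.im * x * Complex.I)), ← charFun_apply_real, ← charFun_apply_real,
    charFun_gaussianReal, charFun_gaussianReal, ← Complex.exp_add]
  congr 1
  have : (((v / 2).toNNReal : ℝ) : ℂ) = v / 2 := by
    rw [Real.coe_toNNReal _ (by positivity)]; push_cast; ring
  rw [this, Complex.sq_norm, Complex.normSq_apply]
  push_cast
  ring

theorem CN_map_mul {v : ℝ} (hv : 0 ≤ v) (c : ℂ) :
    (CN v).map (fun z => c * z) = CN (‖c‖ ^ 2 * v) := by
  have : IsProbabilityMeasure ((CN v).map (fun z => c * z)) :=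
    Measure.isProbabilityMeasure_map (by fun_prop)
  refine Measure.ext_of_charFun (funext fun t => ?_)
  rw [charFun_CN (by positivity), charFun_apply, integral_map (by fun_prop) (by fun_prop)]
  have : ∀ z : ℂ, (inner ℝ (c * z) t : ℝ) = inner ℝ z (conj c * t) := by
    intro z; simp [Complex.inner]; ring
  simp_rw [this]
  rw [← charFun_apply, charFun_CN hv, norm_mul, RCLike.norm_conj]
  congr 2; push_cast; ring

/-- A linear combination of two independent circular Gaussians is a circular Gaussian. -/
theorem CN_prod_map_add {a b : ℝ} (ha : 0 ≤ a) (hb : 0 ≤ b) (α β : ℂ) :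
    ((CN a).prod (CN b)).map (fun p => α * p.1 + β * p.2) =
      CN (‖α‖ ^ 2 * a + ‖β‖ ^ 2 * b) := by
  have : IsProbabilityMeasure (((CN a).prod (CN b)).map (fun p => α * p.1 + β * p.2)) :=
    Measure.isProbabilityMeasure_map (by fun_prop)
  refine Measure.ext_of_charFun (funext fun t => ?_)
  rw [charFun_CN (by positivity), charFun_apply, integral_map (by fun_prop) (by fun_prop)]
  have : ∀ p : ℂ × ℂ, Complex.exp ((inner ℝ (α * p.1 + β * p.2) t : ℝ) * Complex.I) =
      Complex.exp ((inner ℝ p.1 (conj α * t) : ℝ) * Complex.I) *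
      Complex.exp ((inner ℝ p.2 (conj β * t) : ℝ) * Complex.I) := by
    intro z
    rw [← Complex.exp_add]
    congr 1
    simp [Complex.inner]; ring
  simp_rw [this]
  rw [integral_prod_mul (fun x : ℂ => Complex.exp ((inner ℝ x (conj α * t) : ℝ) * Complex.I))
    (fun x : ℂ => Complex.exp ((inner ℝ x (conj β * t) : ℝ) * Complex.I)),
    ← charFun_apply, ← charFun_apply, charFun_CN ha, charFun_CN hb, norm_mul, RCLike.norm_conj,
    norm_mul, RCLike.norm_conj, ← Complex.exp_add]
  congr 1; push_cast; ring

/-- The density of `CN(0, v)`. -/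
noncomputable def cnDensity (v : ℝ) (z : ℂ) : ℝ := (Real.pi * v)⁻¹ * Real.exp (-(‖z‖ ^ 2 / v))

theorem cnDensity_pos {v : ℝ} (hv : 0 < v) (z : ℂ) : 0 < cnDensity v z := by
  unfold cnDensity; positivity

@[fun_prop]
theorem measurable_cnDensity (v : ℝ) : Measurable (cnDensity v) := by
  unfold cnDensity; fun_prop

theorem log_cnDensity {v : ℝ} (hv : 0 < v) (z : ℂ) :
    Real.log (cnDensity v z) = -Real.log (Real.pi * v) - ‖z‖ ^ 2 / v := by
  unfold cnDensity
  rw [Real.log_mul (by positivity) (by positivity), Real.log_inv, Real.log_exp]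
  ring

theorem CN_eq_withDensity {v : ℝ} (hv : 0 < v) :
    CN v = volume.withDensity (fun z => ENNReal.ofReal (cnDensity v z)) := by
  have hv2 : (v / 2).toNNReal ≠ 0 := by simpa using hv
  have hmp := Complex.volume_preserving_equiv_real_prod.symm
  rw [CN, gaussianReal_of_var_ne_zero _ hv2, prod_withDensity (by fun_prop) (by fun_prop)]
  ext s hs
  rw [Measure.map_apply measurable_equivRealProd_symm hs, withDensity_apply _
    (measurable_equivRealProd_symm hs), withDensity_apply _ hs,
    ← hmp.setLIntegral_comp_preimage hs (by fun_prop)]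
  refine setLIntegral_congr_fun (measurable_equivRealProd_symm hs) fun p _ => ?_
  simp only [gaussianPDF, gaussianPDFReal]
  rw [← ENNReal.ofReal_mul (by positivity)]
  congr 1
  have e1 : (((v / 2).toNNReal : NNReal) : ℝ) = v / 2 := Real.coe_toNNReal _ (by positivity)
  have e2 : ‖Complex.measurableEquivRealProd.symm p‖ ^ 2 = p.1 ^ 2 + p.2 ^ 2 := by
    change ‖Complex.equivRealProd.symm p‖ ^ 2 = _
    rw [Complex.sq_norm, Complex.normSq_apply]
    simp [Complex.equivRealProd]; ring
  rw [e1, cnDensity, e2]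
  have e3 : √(2 * Real.pi * (v / 2)) = √(Real.pi * v) := by congr 1; ring
  rw [e3, mul_mul_mul_comm, ← mul_inv, Real.mul_self_sqrt (by positivity), ← Real.exp_add]
  congr 2
  field_simp
  ring

theorem memLp_id_CN (v : ℝ) : MemLp id 2 (CN v) := by
  rw [CN, memLp_map_measure_iff (by fun_prop) measurable_equivRealProd_symm.aemeasurable]
  have h1 : MemLp (fun p : ℝ × ℝ => p.1) 2
      ((gaussianReal 0 (v / 2).toNNReal).prod (gaussianReal 0 (v / 2).toNNReal)) :=
    (memLp_id_gaussianReal' 2 (by simp)).comp_measurePreserving measurePreserving_fst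
  have h2 : MemLp (fun p : ℝ × ℝ => p.2) 2
      ((gaussianReal 0 (v / 2).toNNReal).prod (gaussianReal 0 (v / 2).toNNReal)) :=
    (memLp_id_gaussianReal' 2 (by simp)).comp_measurePreserving measurePreserving_snd
  have h3 := (h1.ofReal (K := ℂ)).add ((h2.ofReal (K := ℂ)).mul_const Complex.I)
  convert h3 using 1
  ext p
  simp [Complex.equivRealProd, Complex.ext_iff]

theorem integrable_id_CN (v : ℝ) : Integrable (fun z : ℂ => z) (CN v) :=
  (memLp_id_CN v).integrable (by norm_num)

theorem integrable_sq_CN (v : ℝ) : Integrable (fun z : ℂ => ‖z‖ ^ 2) (CN v) :=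
  (memLp_id_CN v).integrable_norm_pow (by norm_num)

/-- The law is invariant under z ↦ -z. -/
theorem integral_id_CN {v : ℝ} (hv : 0 ≤ v) : ∫ z, z ∂(CN v) = 0 := by
  have h := CN_map_mul hv (-1)
  have h2 : ∫ z, z ∂((CN v).map (fun z => -1 * z)) = ∫ z, z ∂(CN v) := by
    rw [h]; simp
  rw [integral_map (by fun_prop) (by fun_prop), integral_const_mul] at h2
  linear_combination (-1 / 2 : ℂ) * h2

theorem integral_sq_gaussianReal (v : NNReal) : ∫ x, x ^ 2 ∂(gaussianReal 0 v) = v := by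
  have := variance_fun_id_gaussianReal (μ := 0) (v := v)
  rwa [variance_of_integral_eq_zero (by fun_prop) (by simp)] at this

theorem integral_sq_CN {v : ℝ} (hv : 0 ≤ v) : ∫ z, ‖z‖ ^ 2 ∂(CN v) = v := by
  have hi : Integrable (fun x : ℝ => x ^ 2) (gaussianReal 0 (v / 2).toNNReal) :=
    (memLp_id_gaussianReal' 2 (by simp)).integrable_sq
  rw [CN, integral_map measurable_equivRealProd_symm.aemeasurable (by fun_prop)]
  have : ∀ p : ℝ × ℝ, ‖Complex.equivRealProd.symm p‖ ^ 2 = p.1 ^ 2 + p.2 ^ 2 := by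
    intro p
    rw [Complex.sq_norm, Complex.normSq_apply]
    simp [Complex.equivRealProd]; ring
  simp_rw [this]
  rw [integral_add (hi.comp_fst _) (hi.comp_snd _),
    integral_fun_fst (fun x : ℝ => x ^ 2), integral_fun_snd (fun x : ℝ => x ^ 2),
    integral_sq_gaussianReal, Real.coe_toNNReal _ (by positivity)]
  simp

theorem integral_sq_add_CN {v : ℝ} (hv : 0 ≤ v) (p c : ℂ) :
    ∫ z, ‖p + c * z‖ ^ 2 ∂(CN v) = ‖p‖ ^ 2 + ‖c‖ ^ 2 * v := by
  have h : ∀ z : ℂ, ‖p + c * z‖ ^ 2 = ‖p‖ ^ 2 + 2 * (conj p * c * z).re + ‖c‖ ^ 2 * ‖z‖ ^ 2 := by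
    intro z
    simp only [Complex.sq_norm, Complex.normSq_apply]
    simp
    ring
  have i1 : Integrable (fun z : ℂ => (conj p * c * z).re) (CN v) :=
    ((integrable_id_CN v).const_mul (conj p * c)).re
  have i0 : ∫ z, (conj p * c * z).re ∂(CN v) = 0 := by
    have := integral_re ((integrable_id_CN v).const_mul (conj p * c))
    simp only [RCLike.re_to_complex] at this
    rw [this, integral_const_mul, integral_id_CN hv]; simp
  have i2 : Integrable (fun z : ℂ => ‖p‖ ^ 2 + 2 * (conj p * c * z).re) (CN v) :=
    (integrable_const _).add (i1.const_mul 2)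
  simp_rw [h]
  rw [integral_add i2 ((integrable_sq_CN v).const_mul _), integral_add (integrable_const _) (i1.const_mul 2), integral_const_mul, integral_const_mul,
    integral_sq_CN hv, i0]
  simp

/-! ### Linear functionals of independent circular Gaussians -/

/-- The linear combination with coefficients `l`. -/
def lin {k : ℕ} (l : Fin k → ℂ) (ω : Fin k → ℂ) : ℂ := ∑ i, l i * ω i

/-- The squared Euclidean norm of a coefficient vector. -/
noncomputable def nsq {k : ℕ} (l : Fin k → ℂ) : ℝ := ∑ i, ‖l i‖ ^ 2

theorem nsq_nonneg {k : ℕ} (l : Fin k → ℂ) : 0 ≤ nsq l := Finset.sum_nonneg fun _ _ => by positivity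

@[fun_prop]
theorem measurable_lin {k : ℕ} (l : Fin k → ℂ) : Measurable (lin l) := by
  unfold lin; fun_prop

theorem lin_add {k : ℕ} (l m : Fin k → ℂ) (ω : Fin k → ℂ) :
    lin (l + m) ω = lin l ω + lin m ω := by
  simp [lin, add_mul, Finset.sum_add_distrib]

theorem lin_smul {k : ℕ} (a : ℂ) (l : Fin k → ℂ) (ω : Fin k → ℂ) :
    lin (a • l) ω = a * lin l ω := by
  simp [lin, Finset.mul_sum, mul_assoc]

/-- The joint characteristic function of two linear functionals. It yields the law of one of them
(`map_lin`) and the independence of orthogonal ones (`indepFun_lin`). -/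
theorem integral_exp_lin {k : ℕ} (l m : Fin k → ℂ) (s t : ℂ) :
    ∫ ω, Complex.exp (((inner ℝ (lin l ω) s : ℝ) + (inner ℝ (lin m ω) t : ℝ)) * Complex.I)
      ∂(iidCN k) = Complex.exp (-((∑ i, ‖conj (l i) * s + conj (m i) * t‖ ^ 2) / 4 : ℝ)) := by
  have h : ∀ ω : Fin k → ℂ,
      Complex.exp (((inner ℝ (lin l ω) s : ℝ) + (inner ℝ (lin m ω) t : ℝ)) * Complex.I)
      = ∏ i, Complex.exp ((inner ℝ (ω i) (conj (l i) * s + conj (m i) * t) : ℝ) * Complex.I) := by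
    intro ω
    rw [← Complex.exp_sum, ← Finset.sum_mul]
    congr 2
    rw [lin, lin, sum_inner, sum_inner]
    push_cast
    rw [← Finset.sum_add_distrib]
    refine Finset.sum_congr rfl fun i _ => ?_
    simp [Complex.inner]; ring
  simp_rw [h]
  rw [iidCN, integral_fintype_prod_eq_prod (fun i (z : ℂ) =>
    Complex.exp ((inner ℝ z (conj (l i) * s + conj (m i) * t) : ℝ) * Complex.I))]
  simp_rw [← charFun_apply, stdCN_eq_CN_one, charFun_CN zero_le_one]
  rw [← Complex.exp_sum]
  congr 1
  push_cast
  rw [Finset.sum_neg_distrib, Finset.sum_div]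
  simp

theorem map_lin {k : ℕ} (l : Fin k → ℂ) : (iidCN k).map (lin l) = CN (nsq l) := by
  have : IsProbabilityMeasure ((iidCN k).map (lin l)) :=
    Measure.isProbabilityMeasure_map (by fun_prop)
  refine Measure.ext_of_charFun (funext fun t => ?_)
  rw [charFun_CN (nsq_nonneg l), charFun_apply, integral_map (by fun_prop) (by fun_prop)]
  have := integral_exp_lin l l t 0
  simp only [inner_zero_right, Complex.ofReal_zero, add_zero, mul_zero] at this
  rw [this, nsq, Finset.sum_mul]
  simp [mul_pow]

/-- The cross term of the joint characteristic function is the real part of a multiple of the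
Hermitian product. Thus Hermitian orthogonality alone suffices: by circularity there is no
pseudo-covariance to control. -/
theorem indepFun_lin {k : ℕ} (l m : Fin k → ℂ) (h : ∑ i, l i * conj (m i) = 0) :
    IndepFun (lin l) (lin m) (iidCN k) := by
  rw [indepFun_iff_charFun_prod (by fun_prop) (by fun_prop)]
  intro t
  rw [map_lin, map_lin, charFun_CN (nsq_nonneg l), charFun_CN (nsq_nonneg m), ← Complex.exp_add,
    charFun_apply, integral_map (by fun_prop) (by fun_prop)]
  simp only [WithLp.prod_inner_apply]
  push_cast
  rw [integral_exp_lin]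
  congr 1
  have key : ∑ i, ‖conj (l i) * t.ofLp.1 + conj (m i) * t.ofLp.2‖ ^ 2 =
      nsq l * ‖t.ofLp.1‖ ^ 2 + nsq m * ‖t.ofLp.2‖ ^ 2 +
        2 * ((∑ i, l i * conj (m i)) * (conj t.ofLp.1 * t.ofLp.2)).re := by
    rw [nsq, nsq, Finset.sum_mul, Finset.sum_mul, Finset.sum_mul, Complex.re_sum, Finset.mul_sum,
      ← Finset.sum_add_distrib, ← Finset.sum_add_distrib]
    refine Finset.sum_congr rfl fun i _ => ?_
    simp only [Complex.sq_norm, Complex.normSq_apply]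
    simp
    ring
  rw [key, h]
  push_cast
  simp
  ring

/-! ### Entropies and variances of Gaussian variables -/

theorem lawEntropy_withDensity {f : ℂ → ℝ} (hf : Measurable f) (h0 : ∀ z, 0 ≤ f z) :
    lawEntropy (volume.withDensity fun z => ENNReal.ofReal (f z)) =
      -∫ z, f z * Real.logb 2 (f z) := by
  unfold lawEntropy
  congr 1
  refine integral_congr_ae ?_
  filter_upwards [Measure.rnDeriv_withDensity (volume : Measure ℂ)
    (f := fun z => ENNReal.ofReal (f z)) (by fun_prop)] with z hz
  rw [hz, ENNReal.toReal_ofReal (h0 z)]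

theorem map_add_withDensity {G : Type*} [AddCommGroup G] [MeasurableSpace G] [MeasurableAdd₂ G]
    [MeasurableNeg G] (μ : Measure G) [μ.IsAddLeftInvariant] {f : G → ENNReal} (hf : Measurable f)
    (p : G) :
    (μ.withDensity f).map (fun z => p + z) = μ.withDensity (fun z => f (z - p)) := by
  ext s hs
  rw [Measure.map_apply (by fun_prop) hs, withDensity_apply _ (measurable_const_add p hs),
    withDensity_apply _ hs, ← (measurePreserving_add_left μ p).setLIntegral_comp_preimage hs]
  · simp
  · simp_rw [sub_eq_add_neg]; fun_prop

/-- The translation by p is included because conditional laws of jointly Gaussian variables are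
translates of the law of the residual. -/
theorem lawEntropy_CN_add {v : ℝ} (hv : 0 < v) (p : ℂ) :
    lawEntropy ((CN v).map (fun z => p + z)) = Real.logb 2 (Real.pi * Real.exp 1 * v) := by
  rw [CN_eq_withDensity hv, map_add_withDensity _ (by fun_prop),
    lawEntropy_withDensity (f := fun z => cnDensity v (z - p)) (by fun_prop)
      fun z => (cnDensity_pos hv _).le,
    integral_sub_right_eq_self (fun z => cnDensity v z * Real.logb 2 (cnDensity v z)) p]
  have h := CN_eq_withDensity hv
  have h2 : ∫ z, cnDensity v z * Real.logb 2 (cnDensity v z) =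
      ∫ z, Real.logb 2 (cnDensity v z) ∂(CN v) := by
    rw [h, integral_withDensity_eq_integral_toReal_smul (by fun_prop) (by simp)]
    refine integral_congr_ae (Eventually.of_forall fun z => ?_)
    simp [ENNReal.toReal_ofReal (cnDensity_pos hv z).le]
  rw [h2]
  simp_rw [Real.logb, log_cnDensity hv]
  rw [integral_div, integral_sub (integrable_const _) ((integrable_sq_CN v).div_const _),
    integral_div, integral_sq_CN hv.le, integral_const]
  have e : Real.log (Real.pi * Real.exp 1 * v) = Real.log (Real.pi * v) + 1 := by
    rw [mul_right_comm, Real.log_mul (by positivity) (by positivity), Real.log_exp]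
  rw [e, div_self hv.ne']
  simp
  ring

theorem lawEntropy_CN {v : ℝ} (hv : 0 < v) :
    lawEntropy (CN v) = Real.logb 2 (Real.pi * Real.exp 1 * v) := by
  simpa using lawEntropy_CN_add hv 0

theorem entropy_lin {k : ℕ} {l : Fin k → ℂ} (h : 0 < nsq l) :
    entropy (iidCN k) (lin l) = Real.logb 2 (Real.pi * Real.exp 1 * nsq l) := by
  rw [entropy, map_lin, lawEntropy_CN h]

/-- The kernel `y ↦ law of (α y + noise)` with noise of law `ν`. -/
noncomputable def shiftKernel (α : ℂ) (ν : Measure ℂ) [IsProbabilityMeasure ν] : Kernel ℂ ℂ where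
  toFun y := ν.map (fun z => α * y + z)
  measurable' := by
    refine Measure.measurable_of_measurable_coe _ fun s hs => ?_
    have : (fun y => (ν.map (fun z => α * y + z)) s) =
        fun y => ν (Prod.mk y ⁻¹' ((fun p : ℂ × ℂ => α * p.1 + p.2) ⁻¹' s)) := by
      ext y
      rw [Measure.map_apply (by fun_prop) hs]; rfl
    rw [this]
    exact measurable_measure_prodMk_left ((by fun_prop : Measurable
      (fun p : ℂ × ℂ => α * p.1 + p.2)) hs)

instance (α : ℂ) (ν : Measure ℂ) [IsProbabilityMeasure ν] : IsMarkovKernel (shiftKernel α ν) :=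
  ⟨fun _ => Measure.isProbabilityMeasure_map (by fun_prop)⟩

/-- The joint law is the image of a product law under (y, r) ↦ (y, αy + r), and this is a
disintegration along y; conditional distributions are unique almost everywhere. -/
theorem condDistrib_of_indep {Ω : Type} [MeasurableSpace Ω] {P : Measure Ω}
    [IsProbabilityMeasure P] {R Y : Ω → ℂ} (hR : Measurable R) (hY : Measurable Y)
    (h : IndepFun Y R P) (α : ℂ) [IsProbabilityMeasure (P.map R)] :
    condDistrib (fun ω => α * Y ω + R ω) Y P =ᵐ[P.map Y] shiftKernel α (P.map R) := by
  have : IsProbabilityMeasure (P.map Y) := Measure.isProbabilityMeasure_map hY.aemeasurable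
  refine condDistrib_ae_eq_of_measure_eq_compProd _ (by fun_prop) ?_
  refine Measure.ext_of_lintegral _ fun f hf => ?_
  have hj := (indepFun_iff_map_prod_eq_prod_map_map hY.aemeasurable hR.aemeasurable).1 h
  have e : P.map (fun ω => (Y ω, α * Y ω + R ω)) =
      ((P.map Y).prod (P.map R)).map (fun p => (p.1, α * p.1 + p.2)) := by
    rw [← hj, Measure.map_map (by fun_prop) (by fun_prop)]; rfl
  rw [e, lintegral_map hf (by fun_prop), Measure.lintegral_compProd hf,
    lintegral_prod _ (by fun_prop)]
  refine lintegral_congr fun y => ?_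
  change _ = ∫⁻ b, f (y, b) ∂((P.map R).map (fun z => α * y + z))
  exact (lintegral_map (μ := P.map R) (f := fun b => f (y, b)) (by fun_prop) (by fun_prop)).symm

theorem condEntropy_lin {k : ℕ} (r m : Fin k → ℂ) (α : ℂ) (horth : ∑ i, m i * conj (r i) = 0)
    (hr : 0 < nsq r) :
    condEntropy (iidCN k) (lin (α • m + r)) (lin m) =
      Real.logb 2 (Real.pi * Real.exp 1 * nsq r) := by
  have hR : IsProbabilityMeasure ((iidCN k).map (lin r)) :=
    Measure.isProbabilityMeasure_map (by fun_prop)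
  have hM : IsProbabilityMeasure ((iidCN k).map (lin m)) :=
    Measure.isProbabilityMeasure_map (by fun_prop)
  have e : lin (α • m + r) = fun ω => α * lin m ω + lin r ω := by
    ext ω; rw [lin_add, lin_smul]
  have h := condDistrib_of_indep (P := iidCN k) (measurable_lin r) (measurable_lin m)
    (indepFun_lin m r horth) α
  rw [condEntropy, e]
  have h2 : (fun y => lawEntropy (condDistrib (fun ω => α * lin m ω + lin r ω) (lin m) (iidCN k) y))
      =ᵐ[(iidCN k).map (lin m)] fun _ => Real.logb 2 (Real.pi * Real.exp 1 * nsq r) := by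
    filter_upwards [h] with y hy
    rw [hy]
    change lawEntropy (((iidCN k).map (lin r)).map (fun z => α * y + z)) = _
    rw [map_lin, lawEntropy_CN_add hr]
  rw [integral_congr_ae h2, integral_const]
  simp

theorem integrable_lin {k : ℕ} (l : Fin k → ℂ) : Integrable (lin l) (iidCN k) := by
  have h := integrable_id_CN (nsq l)
  rw [← map_lin, integrable_map_measure (by fun_prop) (by fun_prop)] at h
  exact h

theorem integral_lin {k : ℕ} (l : Fin k → ℂ) : ∫ ω, lin l ω ∂(iidCN k) = 0 := by
  have h := integral_id_CN (nsq_nonneg l)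
  rw [← map_lin, integral_map (by fun_prop) (by fun_prop)] at h
  exact h

theorem integral_sq_lin {k : ℕ} (l : Fin k → ℂ) : ∫ ω, ‖lin l ω‖ ^ 2 ∂(iidCN k) = nsq l := by
  have h := integral_sq_CN (nsq_nonneg l)
  rwa [← map_lin, integral_map (by fun_prop) (by fun_prop)] at h

theorem cVar_lin {k : ℕ} (l : Fin k → ℂ) : cVar (iidCN k) (lin l) = nsq l := by
  simp [cVar, integral_lin, integral_sq_lin]

/-- The part α·`lin m` is measurable for the conditioning σ-algebra, while the residual `lin r` is
independent of it and centred, so the residual is exactly the estimation error. -/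
theorem cCondVar_lin {k : ℕ} (r m : Fin k → ℂ) (α : ℂ) (horth : ∑ i, m i * conj (r i) = 0) :
    cCondVar (iidCN k) (lin (α • m + r)) (lin m) = nsq r := by
  have e : lin (α • m + r) = fun ω => α * lin m ω + lin r ω := by
    ext ω; rw [lin_add, lin_smul]
  have hle : MeasurableSpace.comap (lin m) inferInstance ≤ (inferInstance : MeasurableSpace
    (Fin k → ℂ)) := (measurable_lin m).comap_le
  have hle2 : MeasurableSpace.comap (lin r) inferInstance ≤ (inferInstance : MeasurableSpace
    (Fin k → ℂ)) := (measurable_lin r).comap_le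
  have hce : (iidCN k)[lin r | MeasurableSpace.comap (lin m) inferInstance] =ᵐ[iidCN k]
      fun _ => ∫ ω, lin r ω ∂(iidCN k) := by
    refine condExp_indep_eq hle2 hle ?_ ?_
    · exact (comap_measurable (lin r)).stronglyMeasurable
    · exact (indepFun_lin m r horth).symm
  have hcm : (iidCN k)[fun ω => α * lin m ω | MeasurableSpace.comap (lin m) inferInstance] =
      fun ω => α * lin m ω := by
    refine condExp_of_stronglyMeasurable hle ?_ ((integrable_lin m).const_mul α)
    exact ((comap_measurable (lin m)).const_mul α).stronglyMeasurable
  have h := condExp_add ((integrable_lin m).const_mul α) (integrable_lin r)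
    (MeasurableSpace.comap (lin m) inferInstance)
  rw [cCondVar, e, ← integral_sq_lin r]
  refine integral_congr_ae ?_
  filter_upwards [h, hce] with ω h1 h2
  have h3 : ((iidCN k)[fun ω => α * lin m ω + lin r ω |
      MeasurableSpace.comap (lin m) inferInstance]) ω = α * lin m ω := by
    have h1' := h1
    rw [Pi.add_apply, h2, integral_lin, hcm, add_zero] at h1'
    exact h1'
  rw [h3]
  simp

/-! ### The single-letter bound in closed form -/

/-- The Hermitian product of coefficient vectors. -/
noncomputable def ip {k : ℕ} (l m : Fin k → ℂ) : ℂ := ∑ i, l i * conj (m i)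

section InnerProduct

variable {k : ℕ} (l m p : Fin k → ℂ) (a : ℂ)

theorem ip_add_left : ip (l + m) p = ip l p + ip m p := by
  simp [ip, add_mul, Finset.sum_add_distrib]

theorem ip_add_right : ip p (l + m) = ip p l + ip p m := by
  simp [ip, mul_add, Finset.sum_add_distrib]

theorem ip_smul_left : ip (a • l) p = a * ip l p := by
  simp [ip, Finset.mul_sum, mul_assoc]

theorem ip_smul_right : ip p (a • l) = conj a * ip p l := by
  simp [ip, Finset.mul_sum, mul_left_comm]

theorem ip_self : ip l l = nsq l := by
  simp [ip, nsq, Complex.mul_conj, Complex.normSq_eq_norm_sq]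

theorem ip_conj_symm : conj (ip l m) = ip m l := by
  simp [ip, mul_comm]

variable {l m}

theorem ip_eq_zero_symm (h : ip l m = 0) : ip m l = 0 := by
  rw [← ip_conj_symm, h, map_zero]

theorem nsq_smul : nsq (a • l) = ‖a‖ ^ 2 * nsq l := by
  simp [nsq, Finset.mul_sum, mul_pow]

theorem nsq_add_of_orth (h : ip l m = 0) : nsq (l + m) = nsq l + nsq m := by
  have : ((nsq (l + m) : ℝ) : ℂ) = (nsq l + nsq m : ℝ) := by
    rw [← ip_self, ip_add_left, ip_add_right, ip_add_right, h, ip_eq_zero_symm h, ip_self, ip_self]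
    simp
  exact_mod_cast this

/-- Orthogonal projection onto the line spanned by `m`. -/
theorem exists_orth_residual (l : Fin k → ℂ) (hm : 0 < nsq m) :
    ∃ (α : ℂ) (r : Fin k → ℂ), l = α • m + r ∧ ip m r = 0 := by
  refine ⟨ip l m / nsq m, l - (ip l m / nsq m) • m, by simp, ?_⟩
  apply ip_eq_zero_symm
  have hm' : (nsq m : ℂ) ≠ 0 := by exact_mod_cast hm.ne'
  rw [sub_eq_add_neg, ← neg_smul, ip_add_left, ip_smul_left, ip_self]
  field_simp
  ring

end InnerProduct

theorem entropy_of_lin {X : Sample → ℂ} {l : Fin 8 → ℂ} {v : ℝ} (hX : X = lin l) (hv : nsq l = v)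
    (h : 0 < v) : entropy prob X = Real.logb 2 (Real.pi * Real.exp 1 * v) := by
  subst hX hv
  exact entropy_lin h

theorem condEntropy_of_lin {X Y : Sample → ℂ} {l m r : Fin 8 → ℂ} {α : ℂ} {v : ℝ} (hX : X = lin l)
    (hY : Y = lin m) (hl : l = α • m + r) (ho : ip m r = 0) (hv : nsq r = v) (h : 0 < v) :
    condEntropy prob X Y = Real.logb 2 (Real.pi * Real.exp 1 * v) := by
  subst hX hY hl hv
  exact condEntropy_lin r m α ho h

/-- The natural logarithm form of the single-letter bound, as a function of the variances. -/
noncomputable def boundNat (H S P2 sN sW e s s1 d vN : ℝ) : ℝ :=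
  Real.log (S + sN) - Real.log (S + e) + Real.log (S + sW) - Real.log (S + 1) + Real.log s
    - Real.log (H * s + (vN - H * d)) + Real.log s1 - Real.log sN + Real.log (S + P2 + 1)
    - Real.log d

theorem logb_eq (v : ℝ) (h : 0 < v) : Real.logb 2 (Real.pi * Real.exp 1 * v) =
    (Real.log (Real.pi * Real.exp 1) + Real.log v) / Real.log 2 := by
  rw [Real.logb, Real.log_mul (by positivity) h.ne']

set_option maxHeartbeats 1000000 in
/-- Closed form of the bound in terms of the innovations decompositions `W₂ = β (Z₂ - W₂) + E`,
`Z₁ = γ N₁ + V`, and of the linear estimates of `Y₂G` from `U₂G` and of `Y₁G` from `S₁G`. -/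
theorem exists_bound_eq (c : Channel) (κ : Params) (hr : κ.InRange) (ha : Admissible c κ)
    (hn : Nondegenerate c κ) :
    ∃ (β γ τ η : ℂ) (d e vN : ℝ), 0 < d ∧ 0 ≤ e ∧ 0 < vN ∧ d * ‖1 + β‖ ^ 2 + e = 1 ∧
      ‖β‖ ^ 2 * d + e = κ.σW2 ^ 2 ∧ ‖γ‖ ^ 2 * κ.σN1 ^ 2 + vN = 1 ∧
      min (κ.σN1 ^ 2) (κ.σW2 ^ 2) ≤ e ∧ ‖c.h12‖ ^ 2 * d ≤ vN ∧
      bound c κ = boundNat (‖c.h12‖ ^ 2) (‖c.h21‖ ^ 2 * c.P1) c.P2 (κ.σN1 ^ 2) (κ.σW2 ^ 2) e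
        (‖τ * c.h21‖ ^ 2 * c.P1 + c.P2 + ‖1 - τ * β‖ ^ 2 * d + ‖τ‖ ^ 2 * e)
        (‖1 - η * c.h21‖ ^ 2 * c.P1 + ‖c.h12‖ ^ 2 * c.P2 + ‖γ - η‖ ^ 2 * κ.σN1 ^ 2 + vN)
        d vN / Real.log 2 := by
  obtain ⟨⟨hN0, hN1⟩, -, -, ⟨hW0, hW1⟩, hρN, -, -, hρW⟩ := hr
  obtain ⟨ha1, ha2⟩ := ha
  obtain ⟨hn1, hn2, hn3, hn4⟩ := hn
  have hP1 := c.P1_pos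
  have hP2 := c.P2_pos
  -- the coefficient vectors
  set vX1 : Fin 8 → ℂ := ![(√c.P1 : ℝ), 0, 0, 0, 0, 0, 0, 0] with hvX1
  set vX2 : Fin 8 → ℂ := ![0, (√c.P2 : ℝ), 0, 0, 0, 0, 0, 0] with hvX2
  set vZ1 : Fin 8 → ℂ := ![0, 0, 1, 0, 0, 0, 0, 0] with hvZ1
  set vZ2 : Fin 8 → ℂ := ![0, 0, 0, 1, 0, 0, 0, 0] with hvZ2
  set vN1 : Fin 8 → ℂ := ![0, 0, κ.σN1 * conj κ.ρN1, 0, κ.σN1 * (√(1 - ‖κ.ρN1‖ ^ 2) : ℝ),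
    0, 0, 0] with hvN1
  set vW2 : Fin 8 → ℂ := ![0, 0, 0, κ.σW2 * conj κ.ρW2, 0,
    κ.σW2 * (√(1 - ‖κ.ρW2‖ ^ 2) : ℝ), 0, 0] with hvW2
  set vD : Fin 8 → ℂ := vZ2 + (-1 : ℂ) • vW2 with hvD
  set v6 : Fin 8 → ℂ := ![0, 0, 0, 0, 0, 0, 1, 0] with hv6
  set v7 : Fin 8 → ℂ := ![0, 0, 0, 0, 0, 0, 0, 1] with hv7
  have lX1 : X1G c = lin vX1 := by ext ω; simp [X1G, lin, Fin.sum_univ_eight, vX1]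
  have lX2 : X2G c = lin vX2 := by ext ω; simp [X2G, lin, Fin.sum_univ_eight, vX2]
  have lZ1 : Z1 = lin vZ1 := by ext ω; simp [Z1, lin, Fin.sum_univ_eight, vZ1]
  have lZ2 : Z2 = lin vZ2 := by ext ω; simp [Z2, lin, Fin.sum_univ_eight, vZ2]
  have lN1 : N1 κ = lin vN1 := by
    ext ω; simp [N1, Z1, lin, Fin.sum_univ_eight, vN1]; ring
  have lW2 : W2 κ = lin vW2 := by
    ext ω; simp [W2, Z2, lin, Fin.sum_univ_eight, vW2]; ring
  have lD : (fun ω => Z2 ω - W2 κ ω) = lin vD := by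
    ext ω; rw [hvD, lin_add, lin_smul, lZ2, lW2]; ring
  have lv6 : ∀ ω, lin v6 ω = ω 6 := by intro ω; simp [lin, Fin.sum_univ_eight, v6]
  have lv7 : ∀ ω, lin v7 ω = ω 7 := by intro ω; simp [lin, Fin.sum_univ_eight, v7]
  -- norms
  have nX1 : nsq vX1 = c.P1 := by
    simp [nsq, Fin.sum_univ_eight, vX1, Real.sq_sqrt hP1.le]
  have nX2 : nsq vX2 = c.P2 := by
    simp [nsq, Fin.sum_univ_eight, vX2, Real.sq_sqrt hP2.le]
  have nZ1 : nsq vZ1 = 1 := by simp [nsq, Fin.sum_univ_eight, vZ1]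
  have nZ2 : nsq vZ2 = 1 := by simp [nsq, Fin.sum_univ_eight, vZ2]
  have n6 : nsq v6 = 1 := by simp [nsq, Fin.sum_univ_eight, v6]
  have n7 : nsq v7 = 1 := by simp [nsq, Fin.sum_univ_eight, v7]
  have hρN' : 0 ≤ 1 - ‖κ.ρN1‖ ^ 2 := by nlinarith [norm_nonneg κ.ρN1]
  have hρW' : 0 ≤ 1 - ‖κ.ρW2‖ ^ 2 := by nlinarith [norm_nonneg κ.ρW2]
  have nN1 : nsq vN1 = κ.σN1 ^ 2 := by
    simp [nsq, Fin.sum_univ_eight, vN1, mul_pow, Real.sq_sqrt hρN']; ring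
  have nW2 : nsq vW2 = κ.σW2 ^ 2 := by
    simp [nsq, Fin.sum_univ_eight, vW2, mul_pow, Real.sq_sqrt hρW']; ring
  have hsN : 0 < κ.σN1 ^ 2 := by positivity
  have nD : nsq vD = ‖1 - κ.σW2 * conj κ.ρW2‖ ^ 2 + κ.σW2 ^ 2 * (1 - ‖κ.ρW2‖ ^ 2) := by
    simp [nsq, Fin.sum_univ_eight, vD, vW2, vZ2, mul_pow, Real.sq_sqrt hρW', ← sub_eq_add_neg]
  -- The variance of Z₂ - W₂ vanishes only if σ and ρ are both 1, which nondegeneracy rules out.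
  have hd : 0 < nsq vD := by
    rw [nD]
    by_contra hcon
    have h1 : ‖1 - κ.σW2 * conj κ.ρW2‖ ^ 2 = 0 := by
      nlinarith [sq_nonneg ‖1 - κ.σW2 * conj κ.ρW2‖, mul_nonneg (sq_nonneg κ.σW2) hρW']
    have h2 : (1 : ℂ) = κ.σW2 * conj κ.ρW2 := by simpa [sub_eq_zero] using h1
    have h3 : 1 = κ.σW2 * ‖κ.ρW2‖ := by
      have := congrArg norm h2
      simpa [abs_of_nonneg hW0] using this
    have h4 : κ.σW2 = 1 := by nlinarith [norm_nonneg κ.ρW2]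
    refine hn2 ⟨h4, ?_⟩
    rw [h4] at h2
    have := congrArg conj h2
    simpa using this.symm
  obtain ⟨β, vE, hWE, hDE⟩ := exists_orth_residual vW2 hd
  obtain ⟨γ, vV, hZV, hNV⟩ := exists_orth_residual vZ1 (m := vN1) (by rw [nN1]; exact hsN)
  have eD : varZ2W2 κ = nsq vD := by rw [varZ2W2, lD, cVar_lin]
  have eE : varVW2 κ = nsq vE := by
    rw [varVW2, lD, lW2, hWE]; exact cCondVar_lin vE vD β hDE
  have eV : varVN1 κ = nsq vV := by
    rw [varVN1, lN1, lZ1, hZV]; exact cCondVar_lin vV vN1 γ hNV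
  rw [eD, eV] at ha2
  rw [eE] at ha1
  have he0 := nsq_nonneg vE
  have hvN : nsq vV = 1 - ‖κ.ρN1‖ ^ 2 := by
    have h1 : ip vZ1 vN1 = κ.σN1 * κ.ρN1 := by
      simp [ip, Fin.sum_univ_eight, vZ1, vN1]
    have h2 : ip vZ1 vN1 = γ * κ.σN1 ^ 2 := by
      rw [hZV, ip_add_left, ip_smul_left, ip_self, nN1, ip_eq_zero_symm hNV]; simp
    have h3 : nsq vZ1 = ‖γ‖ ^ 2 * κ.σN1 ^ 2 + nsq vV := by
      rw [hZV, nsq_add_of_orth (by rw [ip_smul_left, hNV, mul_zero]), nsq_smul, nN1]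
    have h4 : κ.ρN1 = γ * κ.σN1 := by
      have : (κ.σN1 : ℂ) ≠ 0 := by exact_mod_cast hn1
      apply mul_left_cancel₀ this
      rw [← h1, h2]; ring
    rw [h4, norm_mul, mul_pow]
    simp only [Complex.norm_real, Real.norm_eq_abs, sq_abs]
    rw [nZ1] at h3
    linarith
  -- If V vanished, the second admissibility condition together with d > 0 would force h₁₂ = 0, and
  -- then nondegeneracy excludes |ρ_{N₁}| = 1.
  have hvN0 : 0 < nsq vV := by
    rcases (nsq_nonneg vV).lt_or_eq with h | h
    · exact h
    · exfalso
      have hρ : ‖κ.ρN1‖ = 1 := by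
        have : ‖κ.ρN1‖ ^ 2 = 1 := by linarith
        nlinarith [norm_nonneg κ.ρN1]
      have h12 : c.h12 ≠ 0 := fun h0 => hn4 h0 hρ
      have : 0 < ‖c.h12‖ ^ 2 * nsq vD := by positivity
      linarith
  -- orthogonality
  have o12 : ip vX1 vX2 = 0 := by simp [ip, Fin.sum_univ_eight, vX1, vX2]
  have o1W : ip vX1 vW2 = 0 := by simp [ip, Fin.sum_univ_eight, vX1, vW2]
  have o1D : ip vX1 vD = 0 := by simp [ip, Fin.sum_univ_eight, vX1, vD, vZ2, vW2]
  have o2W : ip vX2 vW2 = 0 := by simp [ip, Fin.sum_univ_eight, vX2, vW2]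
  have o2D : ip vX2 vD = 0 := by simp [ip, Fin.sum_univ_eight, vX2, vD, vZ2, vW2]
  have o1N : ip vX1 vN1 = 0 := by simp [ip, Fin.sum_univ_eight, vX1, vN1]
  have o2N : ip vX2 vN1 = 0 := by simp [ip, Fin.sum_univ_eight, vX2, vN1]
  have o1Z1 : ip vX1 vZ1 = 0 := by simp [ip, Fin.sum_univ_eight, vX1, vZ1]
  have o2Z1 : ip vX2 vZ1 = 0 := by simp [ip, Fin.sum_univ_eight, vX2, vZ1]
  have o1Z2 : ip vX1 vZ2 = 0 := by simp [ip, Fin.sum_univ_eight, vX1, vZ2]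
  have o2Z2 : ip vX2 vZ2 = 0 := by simp [ip, Fin.sum_univ_eight, vX2, vZ2]
  have o17 : ip vX1 v7 = 0 := by simp [ip, Fin.sum_univ_eight, vX1, v7]
  have o16 : ip vX1 v6 = 0 := by simp [ip, Fin.sum_univ_eight, vX1, v6]
  have o26 : ip vX2 v6 = 0 := by simp [ip, Fin.sum_univ_eight, vX2, v6]
  have oD6 : ip vD v6 = 0 := by simp [ip, Fin.sum_univ_eight, vD, vZ2, vW2, v6]
  have oW6 : ip vW2 v6 = 0 := by simp [ip, Fin.sum_univ_eight, vW2, v6]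
  -- The coordinates are no longer needed: norms and orthogonality relations determine everything
  -- that follows.
  clear_value vD
  clear_value vX1 vX2 vZ1 vZ2 vN1 vW2 v6 v7
  have hE : vE = vW2 + (-β) • vD := by rw [hWE]; simp
  have hV : vV = vZ1 + (-γ) • vN1 := by rw [hZV]; simp
  have o1E : ip vX1 vE = 0 := by rw [hE, ip_add_right, ip_smul_right, o1W, o1D]; simp
  have o2E : ip vX2 vE = 0 := by rw [hE, ip_add_right, ip_smul_right, o2W, o2D]; simp
  have o1V : ip vX1 vV = 0 := by rw [hV, ip_add_right, ip_smul_right, o1Z1, o1N]; simp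
  have o2V : ip vX2 vV = 0 := by rw [hV, ip_add_right, ip_smul_right, o2Z1, o2N]; simp
  have id1 : nsq vD * ‖1 + β‖ ^ 2 + nsq vE = 1 := by
    have : vZ2 = (1 + β) • vD + vE := by rw [hE, hvD]; module
    rw [← nZ2, this, nsq_add_of_orth (by rw [ip_smul_left, hDE, mul_zero]), nsq_smul]; ring
  have id2 : ‖β‖ ^ 2 * nsq vD + nsq vE = κ.σW2 ^ 2 := by
    rw [← nW2, hWE, nsq_add_of_orth (by rw [ip_smul_left, hDE, mul_zero]), nsq_smul]
  have id3 : ‖γ‖ ^ 2 * κ.σN1 ^ 2 + nsq vV = 1 := by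
    rw [← nZ1, hZV, nsq_add_of_orth (by rw [ip_smul_left, hNV, mul_zero]), nsq_smul, nN1]
  -- the signal `U₂G`
  set vU : Fin 8 → ℂ := c.h21 • vX1 + vW2 with hvU
  clear_value vU
  have lU : U2G c κ = lin vU := by
    ext ω; rw [hvU, lin_add, lin_smul, U2G, lX1, lW2]
  have nU : nsq vU = ‖c.h21‖ ^ 2 * c.P1 + κ.σW2 ^ 2 := by
    rw [hvU, nsq_add_of_orth (by rw [ip_smul_left, o1W, mul_zero]), nsq_smul, nX1, nW2]
  have hU : 0 < ‖c.h21‖ ^ 2 * c.P1 + κ.σW2 ^ 2 := by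
    by_cases h : c.h21 = 0
    · have := hn3 h
      positivity
    · positivity
  have hSe : 0 < ‖c.h21‖ ^ 2 * c.P1 + nsq vE := by
    by_cases h : c.h21 = 0
    · have h3 := hn3 h
      have : 0 < min (κ.σN1 ^ 2) (κ.σW2 ^ 2) := by positivity
      have h5 : 0 ≤ ‖c.h21‖ ^ 2 * c.P1 := by positivity
      linarith
    · positivity
  -- As Y₂G = U₂G + (X₂G + D), estimating Y₂G from U₂G leaves the same residual as estimating T =
  -- X₂G + D from it; τ is the regression coefficient of T.
  obtain ⟨τ, vR, hTR, hUR⟩ := exists_orth_residual (vX2 + vD) (m := vU) (by rw [nU]; exact hU)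
  have nR : nsq vR = ‖τ * c.h21‖ ^ 2 * c.P1 + c.P2 + ‖1 - τ * β‖ ^ 2 * nsq vD
      + ‖τ‖ ^ 2 * nsq vE := by
    have : vR = (((-(τ * c.h21)) • vX1 + vX2) + (1 - τ * β) • vD) + (-τ) • vE := by
      have : vR = (vX2 + vD) - τ • vU := by rw [hTR]; simp
      rw [this, hvU, hWE]; module
    rw [this, nsq_add_of_orth, nsq_add_of_orth, nsq_add_of_orth, nsq_smul, nsq_smul, nsq_smul,
      nX1, nX2, norm_neg, norm_neg]
    · rw [ip_smul_left, o12, mul_zero]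
    · rw [ip_add_left, ip_smul_left, ip_smul_right, ip_smul_right, o1D, o2D]; simp
    · simp only [ip_add_left, ip_smul_left, ip_smul_right, o1E, o2E, hDE]; simp
  have hs : 0 < ‖τ * c.h21‖ ^ 2 * c.P1 + c.P2 + ‖1 - τ * β‖ ^ 2 * nsq vD
      + ‖τ‖ ^ 2 * nsq vE := by positivity
  -- the signal `S₁G`
  set vS : Fin 8 → ℂ := c.h21 • vX1 + vN1 with hvS
  clear_value vS
  have lS : S1G c κ = lin vS := by
    ext ω; rw [hvS, lin_add, lin_smul, S1G, lX1, lN1]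
  have nS : nsq vS = ‖c.h21‖ ^ 2 * c.P1 + κ.σN1 ^ 2 := by
    rw [hvS, nsq_add_of_orth (by rw [ip_smul_left, o1N, mul_zero]), nsq_smul, nX1, nN1]
  have hS : 0 < ‖c.h21‖ ^ 2 * c.P1 + κ.σN1 ^ 2 := by positivity
  obtain ⟨η, vQ, hYQ, hSQ⟩ := exists_orth_residual (vX1 + c.h12 • vX2 + vZ1) (m := vS)
    (by rw [nS]; exact hS)
  have nQ : nsq vQ = ‖1 - η * c.h21‖ ^ 2 * c.P1 + ‖c.h12‖ ^ 2 * c.P2 + ‖γ - η‖ ^ 2 * κ.σN1 ^ 2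
      + nsq vV := by
    have : vQ = (((1 - η * c.h21) • vX1 + c.h12 • vX2) + (γ - η) • vN1) + vV := by
      have : vQ = (vX1 + c.h12 • vX2 + vZ1) - η • vS := by rw [hYQ]; simp
      rw [this, hvS, hZV]; module
    rw [this, nsq_add_of_orth, nsq_add_of_orth, nsq_add_of_orth, nsq_smul, nsq_smul, nsq_smul,
      nX1, nX2, nN1]
    · rw [ip_smul_left, ip_smul_right, o12]; simp
    · simp [ip_add_left, ip_smul_left, ip_smul_right, o1N, o2N]
    · simp [ip_add_left, ip_smul_left, o1V, o2V, hNV]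
  have hs1 : 0 < ‖1 - η * c.h21‖ ^ 2 * c.P1 + ‖c.h12‖ ^ 2 * c.P2 + ‖γ - η‖ ^ 2 * κ.σN1 ^ 2
      + nsq vV := by positivity
  -- the entropies
  have hlY2 : Y2G c = lin (c.h21 • vX1 + vX2 + vZ2) := by
    ext ω; rw [Y2G, lin_add, lin_add, lin_smul, lX1, lX2, lZ2]
  have hY2U : c.h21 • vX1 + vX2 + vZ2 = (1 + τ) • vU + vR := by
    have h1 : c.h21 • vX1 + vX2 + vZ2 = vU + (vX2 + vD) := by rw [hvU, hvD]; module
    rw [h1, hTR]; module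
  have t1 := entropy_of_lin lS nS hS
  have t2 : entropy prob (fun ω => c.h21 * X1G c ω + VW2 κ ω) =
      Real.logb 2 (Real.pi * Real.exp 1 * (‖c.h21‖ ^ 2 * c.P1 + nsq vE)) := by
    refine entropy_of_lin (l := c.h21 • vX1 + ((√(nsq vE) : ℝ) : ℂ) • v7) ?_ ?_ hSe
    · ext ω; rw [lin_add, lin_smul, lin_smul, lX1, VW2, eE, lv7]
    · rw [nsq_add_of_orth (by rw [ip_smul_left, ip_smul_right, o17]; simp), nsq_smul, nsq_smul, nX1, n7]
      simp [Real.sq_sqrt he0]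
  have t3 := entropy_of_lin lU nU hU
  have t4 : condEntropy prob (Y2G c) (X2G c) =
      Real.logb 2 (Real.pi * Real.exp 1 * (‖c.h21‖ ^ 2 * c.P1 + 1)) := by
    refine condEntropy_of_lin (α := 1) (r := c.h21 • vX1 + vZ2) hlY2 lX2 (by module) ?_ ?_
      (by positivity)
    · rw [ip_add_right, ip_smul_right, ip_eq_zero_symm o12, o2Z2]; simp
    · rw [nsq_add_of_orth (by simp [ip_smul_left, o1Z2]), nsq_smul, nX1, nZ2]
  have t5 := condEntropy_of_lin hlY2 lU hY2U hUR nR hs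
  have oR6 : ip vR v6 = 0 := by
    have : vR = (vX2 + vD) + (-τ) • vU := by rw [hTR]; module
    rw [this, hvU]
    simp only [ip_add_left, ip_smul_left, o26, oD6, o16, oW6]; simp
  have oU6 : ip vU v6 = 0 := by
    rw [hvU]; simp [ip_add_left, ip_smul_left, o16, oW6]
  have t6 : condEntropy prob (fun ω => c.h12 * Y2G c ω + VN1' c κ ω) (U2G c κ) =
      Real.logb 2 (Real.pi * Real.exp 1 * (‖c.h12‖ ^ 2 * (‖τ * c.h21‖ ^ 2 * c.P1 + c.P2
        + ‖1 - τ * β‖ ^ 2 * nsq vD + ‖τ‖ ^ 2 * nsq vE) + (nsq vV - ‖c.h12‖ ^ 2 * nsq vD))) := by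
    -- The amplitude of the noise Ṽ'; its square is the variance left over when |h₁₂|²d is removed
    -- from that of V.
    set q : ℝ := √(1 - (nsq vV)⁻¹ * (‖c.h12‖ ^ 2 * nsq vD)) * √(nsq vV) with hq
    have hq2 : q ^ 2 = nsq vV - ‖c.h12‖ ^ 2 * nsq vD := by
      have : 0 ≤ 1 - (nsq vV)⁻¹ * (‖c.h12‖ ^ 2 * nsq vD) := by
        rw [sub_nonneg, inv_mul_le_iff₀ hvN0]; linarith
      rw [hq, mul_pow, Real.sq_sqrt this, Real.sq_sqrt hvN0.le]
      field_simp
    refine condEntropy_of_lin (l := c.h12 • (c.h21 • vX1 + vX2 + vZ2) + (q : ℂ) • v6)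
      (α := c.h12 * (1 + τ)) (r := c.h12 • vR + (q : ℂ) • v6) ?_ lU ?_ ?_ ?_ ?_
    · ext ω
      rw [lin_add, lin_smul, lin_smul, hlY2, VN1', VN1, eV, eD, lv6, hq]
      push_cast; ring
    · rw [hY2U]; module
    · rw [ip_add_right, ip_smul_right, ip_smul_right, hUR, oU6]; simp
    · rw [nsq_add_of_orth (by rw [ip_smul_left, ip_smul_right, oR6]; simp), nsq_smul, nsq_smul, n6,
        nR, ← hq2]
      simp
    · by_cases h : c.h12 = 0
      · simp [h, hvN0]
      · have : 0 ≤ nsq vV - ‖c.h12‖ ^ 2 * nsq vD := by linarith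
        positivity
  have hlY1 : Y1G c = lin (vX1 + c.h12 • vX2 + vZ1) := by
    ext ω; rw [Y1G, lin_add, lin_add, lin_smul, lX1, lX2, lZ1]
  have t7 := condEntropy_of_lin hlY1 lS hYQ hSQ nQ hs1
  have t8 := entropy_of_lin lN1 nN1 hsN
  have t9 : entropy prob (Y2G c) =
      Real.logb 2 (Real.pi * Real.exp 1 * (‖c.h21‖ ^ 2 * c.P1 + c.P2 + 1)) := by
    refine entropy_of_lin hlY2 ?_ (by positivity)
    rw [nsq_add_of_orth, nsq_add_of_orth, nsq_smul, nX1, nX2, nZ2]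
    · simp [ip_smul_left, o12]
    · simp [ip_add_left, ip_smul_left, o1Z2, o2Z2]
  have t10 := entropy_of_lin lD rfl hd
  have hpos6 : 0 < ‖c.h12‖ ^ 2 * (‖τ * c.h21‖ ^ 2 * c.P1 + c.P2
        + ‖1 - τ * β‖ ^ 2 * nsq vD + ‖τ‖ ^ 2 * nsq vE) + (nsq vV - ‖c.h12‖ ^ 2 * nsq vD) := by
    by_cases h : c.h12 = 0
    · simp [h, hvN0]
    · have : 0 ≤ nsq vV - ‖c.h12‖ ^ 2 * nsq vD := by linarith
      positivity
  refine ⟨β, γ, τ, η, nsq vD, nsq vE, nsq vV, hd, he0, hvN0, id1, id2, id3, ha1, ha2, ?_⟩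
  -- Five entropies enter with each sign, so the terms log(πe) cancel.
  rw [bound, t1, t2, t3, t4, t5, t6, t7, t8, t9, t10, logb_eq _ hS, logb_eq _ hSe, logb_eq _ hU,
    logb_eq _ (by positivity), logb_eq _ hs, logb_eq _ hpos6, logb_eq _ hs1, logb_eq _ hsN,
    logb_eq _ (by positivity), logb_eq _ hd, boundNat]
  ring

/-! ### Gaussian vectors -/

/-- The law of `n` independent `CN(0, v)` variables. -/
noncomputable def CNv (n : ℕ) (v : ℝ) : Measure (Fin n → ℂ) := Measure.pi fun _ => CN v

instance instIsProbabilityMeasureCNv (n : ℕ) (v : ℝ) : IsProbabilityMeasure (CNv n v) := by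
  unfold CNv; infer_instance

theorem iidCN_eq_CNv (n : ℕ) : iidCN n = CNv n 1 := by
  rw [iidCN, CNv, stdCN_eq_CN_one]

variable {n : ℕ}

theorem CNv_map_smul {v : ℝ} (hv : 0 ≤ v) (c : ℂ) :
    (CNv n v).map (fun z => c • z) = CNv n (‖c‖ ^ 2 * v) := by
  have h := Measure.pi_map_pi (ι := Fin n) (μ := fun _ => CN v) (f := fun _ (z : ℂ) => c * z)
    (fun _ => by fun_prop)
  rw [CN_map_mul hv] at h
  exact h

theorem CNv_prod_map_add {a b : ℝ} (ha : 0 ≤ a) (hb : 0 ≤ b) (α β : ℂ) :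
    ((CNv n a).prod (CNv n b)).map (fun p => α • p.1 + β • p.2) =
      CNv n (‖α‖ ^ 2 * a + ‖β‖ ^ 2 * b) := by
  have h := Measure.pi_map_pi (ι := Fin n) (μ := fun _ => (CN a).prod (CN b))
    (f := fun _ (p : ℂ × ℂ) => α * p.1 + β * p.2) (fun _ => by fun_prop)
  rw [CN_prod_map_add ha hb] at h
  have h2 := measurePreserving_arrowProdEquivProdArrow ℂ ℂ (Fin n) (fun _ => CN a) (fun _ => CN b)
  rw [CNv, CNv, CNv, ← h, ← h2.map_eq, Measure.map_map (by fun_prop) (by fun_prop)]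
  rfl

theorem pi_withDensity {ι : Type*} [Fintype ι] {α : Type*} [MeasurableSpace α] (μ : Measure α)
    [SigmaFinite μ] {f : α → ℝ} (hf : Integrable f μ) (h0 : ∀ x, 0 ≤ f x)
    [SigmaFinite (μ.withDensity fun x => ENNReal.ofReal (f x))] :
    Measure.pi (fun _ : ι => μ.withDensity fun x => ENNReal.ofReal (f x)) =
      (Measure.pi fun _ : ι => μ).withDensity (fun y => ENNReal.ofReal (∏ i, f (y i))) := by
  refine (Measure.pi_eq fun s hs => ?_)
  -- On a box the indicator is a product of one-variable indicators, so the integral of the product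
  -- density over the box factorizes.
  have h : (Set.univ.pi s).indicator (fun y : ι → α => ENNReal.ofReal (∏ i, f (y i))) =
      fun y => ENNReal.ofReal (∏ i, (s i).indicator f (y i)) := by
    ext y
    by_cases hy : y ∈ Set.univ.pi s
    · rw [Set.indicator_of_mem hy]
      congr 1
      exact Finset.prod_congr rfl fun i _ => (Set.indicator_of_mem (hy i trivial) f).symm
    · rw [Set.indicator_of_notMem hy]
      simp only [Set.mem_pi, Set.mem_univ, true_implies, not_forall] at hy
      obtain ⟨i, hi⟩ := hy
      rw [Finset.prod_eq_zero (Finset.mem_univ i) (Set.indicator_of_notMem hi f),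
        ENNReal.ofReal_zero]
  have hi : ∀ i, Integrable ((s i).indicator f) μ := fun i => hf.indicator (hs i)
  have h0' : ∀ i x, 0 ≤ (s i).indicator f x := fun i => Set.indicator_nonneg fun x _ => h0 x
  rw [withDensity_apply _ (MeasurableSet.univ_pi hs), ← lintegral_indicator
    (MeasurableSet.univ_pi hs), h, ← ofReal_integral_eq_lintegral_ofReal
    (Integrable.fintype_prod hi) (Eventually.of_forall fun y => Finset.prod_nonneg fun i _ =>
      h0' i _), integral_fintype_prod_eq_prod (fun i => (s i).indicator f),
    ENNReal.ofReal_prod_of_nonneg fun i _ => integral_nonneg (h0' i)]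
  refine Finset.prod_congr rfl fun i _ => ?_
  rw [integral_indicator (hs i), withDensity_apply _ (hs i),
    ofReal_integral_eq_lintegral_ofReal hf.restrict (Eventually.of_forall h0)]

/-- The density of `CNv n v`. -/
noncomputable def cnvDensity (n : ℕ) (v : ℝ) (y : Fin n → ℂ) : ℝ := ∏ t, cnDensity v (y t)

theorem cnvDensity_pos {v : ℝ} (hv : 0 < v) (y : Fin n → ℂ) : 0 < cnvDensity n v y :=
  Finset.prod_pos fun _ _ => cnDensity_pos hv _

@[fun_prop]
theorem measurable_cnvDensity (v : ℝ) : Measurable (cnvDensity n v) := by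
  unfold cnvDensity; fun_prop

theorem CNv_eq_withDensity {v : ℝ} (hv : 0 < v) :
    CNv n v = volume.withDensity (fun y => ENNReal.ofReal (cnvDensity n v y)) := by
  have h := CN_eq_withDensity hv
  have : SigmaFinite (volume.withDensity fun z => ENNReal.ofReal (cnDensity v z)) := by
    rw [← h]; infer_instance
  have hi : Integrable (cnDensity v) volume := by
    refine ⟨by fun_prop, ?_⟩
    rw [hasFiniteIntegral_iff_ofReal (Eventually.of_forall fun z => (cnDensity_pos hv z).le),
      ← setLIntegral_univ, ← withDensity_apply _ MeasurableSet.univ, ← h, measure_univ]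
    exact ENNReal.one_lt_top
  rw [CNv, h, pi_withDensity _ hi fun z => (cnDensity_pos hv z).le, volume_pi]
  rfl

theorem log_cnvDensity {v : ℝ} (hv : 0 < v) (y : Fin n → ℂ) :
    Real.log (cnvDensity n v y) = -(n * Real.log (Real.pi * v)) - nsq y / v := by
  rw [cnvDensity, Real.log_prod fun t _ => (cnDensity_pos hv _).ne']
  simp_rw [log_cnDensity hv]
  rw [Finset.sum_sub_distrib, ← Finset.sum_div, nsq]
  simp

theorem integrable_sq_add_CNv (v : ℝ) (p c : ℂ) (t : Fin n) :
    Integrable (fun z : Fin n → ℂ => ‖p + c * z t‖ ^ 2) (CNv n v) := by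
  have h : MemLp (fun z : ℂ => p + c * z) 2 (CN v) :=
    (memLp_const p).add ((memLp_id_CN v).const_mul c)
  have := h.comp_measurePreserving (measurePreserving_eval (fun _ : Fin n => CN v) t)
  exact this.integrable_norm_pow (by norm_num)

theorem integral_sq_add_CNv {v : ℝ} (hv : 0 ≤ v) (p c : ℂ) (t : Fin n) :
    ∫ z, ‖p + c * z t‖ ^ 2 ∂(CNv n v) = ‖p‖ ^ 2 + ‖c‖ ^ 2 * v := by
  rw [← integral_sq_add_CN hv, ← (measurePreserving_eval (fun _ : Fin n => CN v) t).map_eq,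
    integral_map (measurable_pi_apply t).aemeasurable (by fun_prop)]
  rfl

theorem integral_nsq_add_CNv {v : ℝ} (hv : 0 ≤ v) (p : Fin n → ℂ) (c : ℂ) :
    ∫ z, nsq (p + c • z) ∂(CNv n v) = nsq p + n * (‖c‖ ^ 2 * v) := by
  simp only [nsq, Pi.add_apply, Pi.smul_apply, smul_eq_mul]
  rw [integral_finsetSum _ fun t _ => integrable_sq_add_CNv v (p t) c t]
  simp_rw [integral_sq_add_CNv hv]
  rw [Finset.sum_add_distrib]
  simp

/-! ### Functions of quadratic growth -/

section Growth

variable {E F G : Type*} [NormedAddCommGroup E] [MeasurableSpace E]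
  [NormedAddCommGroup F] [MeasurableSpace F] [NormedAddCommGroup G] [MeasurableSpace G]

/-- A measurable map of at most linear growth. -/
def LinGrowth (ψ : E → F) : Prop := Measurable ψ ∧ ∃ B, 0 ≤ B ∧ ∀ y, ‖ψ y‖ ≤ B * (1 + ‖y‖)

/-- A measurable function of at most quadratic growth. -/
def QuadGrowth (φ : E → ℝ) : Prop := Measurable φ ∧ ∃ A, 0 ≤ A ∧ ∀ y, |φ y| ≤ A * (1 + ‖y‖ ^ 2)

theorem LinGrowth.const (x : F) : LinGrowth (fun _ : E => x) :=
  ⟨measurable_const, ‖x‖, norm_nonneg _, fun y => by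
    nlinarith [norm_nonneg x, norm_nonneg y]⟩

theorem LinGrowth.id : LinGrowth (fun y : E => y) :=
  ⟨measurable_id, 1, zero_le_one, fun y => by linarith⟩

theorem LinGrowth.fst {ψ : E → F × G} (h : LinGrowth ψ) : LinGrowth (fun y => (ψ y).1) := by
  obtain ⟨hm, B, hB, hb⟩ := h
  exact ⟨hm.fst, B, hB, fun y => (norm_fst_le _).trans (hb y)⟩

theorem LinGrowth.snd {ψ : E → F × G} (h : LinGrowth ψ) : LinGrowth (fun y => (ψ y).2) := by
  obtain ⟨hm, B, hB, hb⟩ := h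
  exact ⟨hm.snd, B, hB, fun y => (norm_snd_le _).trans (hb y)⟩

theorem LinGrowth.prodMk {ψ : E → F} {χ : E → G} (h : LinGrowth ψ) (h' : LinGrowth χ) :
    LinGrowth (fun y => (ψ y, χ y)) := by
  obtain ⟨hm, B, hB, hb⟩ := h
  obtain ⟨hm', B', hB', hb'⟩ := h'
  refine ⟨hm.prodMk hm', B + B', by positivity, fun y => ?_⟩
  rw [Prod.norm_mk, max_le_iff]
  have := norm_nonneg y
  constructor
  · nlinarith [hb y]
  · nlinarith [hb' y]

theorem LinGrowth.add [MeasurableAdd₂ F] {ψ χ : E → F} (h : LinGrowth ψ) (h' : LinGrowth χ) :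
    LinGrowth (fun y => ψ y + χ y) := by
  obtain ⟨hm, B, hB, hb⟩ := h
  obtain ⟨hm', B', hB', hb'⟩ := h'
  exact ⟨hm.add hm', B + B', by positivity, fun y => by
    linarith [norm_add_le (ψ y) (χ y), hb y, hb' y]⟩

theorem LinGrowth.smul [NormedSpace ℂ F] [MeasurableConstSMul ℂ F] {ψ : E → F}
    (h : LinGrowth ψ) (c : ℂ) : LinGrowth (fun y => c • ψ y) := by
  obtain ⟨hm, B, hB, hb⟩ := h
  refine ⟨hm.const_smul c, ‖c‖ * B, by positivity, fun y => ?_⟩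
  rw [norm_smul, mul_assoc]
  exact mul_le_mul_of_nonneg_left (hb y) (norm_nonneg c)

theorem LinGrowth.comp {χ : F → G} {ψ : E → F} (h : LinGrowth χ) (h' : LinGrowth ψ) :
    LinGrowth (fun y => χ (ψ y)) := by
  obtain ⟨hm, B, hB, hb⟩ := h
  obtain ⟨hm', B', hB', hb'⟩ := h'
  refine ⟨hm.comp hm', B * (1 + B'), by positivity, fun y => (hb _).trans ?_⟩
  rw [mul_assoc]
  refine mul_le_mul_of_nonneg_left ?_ hB
  nlinarith [hb' y, norm_nonneg y]

theorem LinGrowth.sub [NormedSpace ℂ F] [MeasurableConstSMul ℂ F] [MeasurableAdd₂ F] {ψ χ : E → F}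
    (h : LinGrowth ψ) (h' : LinGrowth χ) : LinGrowth (fun y => ψ y - χ y) := by
  have := h.add (h'.smul (-1))
  simpa [sub_eq_add_neg] using this

theorem QuadGrowth.comp {φ : F → ℝ} {ψ : E → F} (h : QuadGrowth φ) (h' : LinGrowth ψ) :
    QuadGrowth (fun y => φ (ψ y)) := by
  obtain ⟨hm, A, hA, ha⟩ := h
  obtain ⟨hm', B, hB, hb⟩ := h'
  refine ⟨hm.comp hm', A * (1 + 2 * B ^ 2), by positivity, fun y => (ha _).trans ?_⟩
  rw [mul_assoc]
  refine mul_le_mul_of_nonneg_left ?_ hA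
  have h1 : ‖ψ y‖ ^ 2 ≤ (B * (1 + ‖y‖)) ^ 2 := pow_le_pow_left₀ (norm_nonneg _) (hb y) 2
  have h2 : (1 + ‖y‖) ^ 2 ≤ 2 * (1 + ‖y‖ ^ 2) := by nlinarith [sq_nonneg (1 - ‖y‖)]
  nlinarith [mul_le_mul_of_nonneg_left h2 (sq_nonneg B), sq_nonneg ‖y‖]

theorem QuadGrowth.const (x : ℝ) : QuadGrowth (fun _ : E => x) :=
  ⟨measurable_const, |x|, abs_nonneg _, fun y => by nlinarith [abs_nonneg x, sq_nonneg ‖y‖]⟩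

theorem QuadGrowth.add {φ χ : E → ℝ} (h : QuadGrowth φ) (h' : QuadGrowth χ) :
    QuadGrowth (fun y => φ y + χ y) := by
  obtain ⟨hm, A, hA, ha⟩ := h
  obtain ⟨hm', A', hA', ha'⟩ := h'
  exact ⟨hm.add hm', A + A', by positivity, fun y => by
    linarith [abs_add_le (φ y) (χ y), ha y, ha' y]⟩

theorem QuadGrowth.const_mul {φ : E → ℝ} (h : QuadGrowth φ) (c : ℝ) :
    QuadGrowth (fun y => c * φ y) := by
  obtain ⟨hm, A, hA, ha⟩ := h
  refine ⟨hm.const_mul c, |c| * A, by positivity, fun y => ?_⟩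
  rw [abs_mul, mul_assoc]
  exact mul_le_mul_of_nonneg_left (ha y) (abs_nonneg c)

/-- All log-densities in the proof grow at most quadratically and all laws have finite second
moments, so integrability reduces to this criterion and the closure rules above. -/
theorem QuadGrowth.integrable {φ : E → ℝ} (h : QuadGrowth φ) {μ : Measure E} [IsFiniteMeasure μ]
    (hμ : Integrable (fun y => ‖y‖ ^ 2) μ) : Integrable φ μ := by
  obtain ⟨hm, A, hA, ha⟩ := h
  exact (((integrable_const 1).add hμ).const_mul A).mono' hm.aestronglyMeasurable
    (Eventually.of_forall ha)

theorem integrable_sq_prod [OpensMeasurableSpace E] [OpensMeasurableSpace F] {μ : Measure E}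
    {ν : Measure F} [IsFiniteMeasure μ] [IsFiniteMeasure ν]
    (hμ : Integrable (fun y => ‖y‖ ^ 2) μ) (hν : Integrable (fun y => ‖y‖ ^ 2) ν) :
    Integrable (fun p : E × F => ‖p‖ ^ 2) (μ.prod ν) := by
  refine ((hμ.comp_fst ν).add (hν.comp_snd μ)).mono' ?_ (Eventually.of_forall fun p => ?_)
  · have : Measurable fun p : E × F => ‖p.1‖ ⊔ ‖p.2‖ := by fun_prop
    exact (this.pow_const 2).aestronglyMeasurable
  · rw [Real.norm_of_nonneg (by positivity), Prod.norm_def]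
    simp only [Pi.add_apply]
    rcases max_choice ‖p.1‖ ‖p.2‖ with h | h <;> rw [h]
    · linarith [sq_nonneg ‖p.2‖]
    · linarith [sq_nonneg ‖p.1‖]

end Growth

theorem norm_sq_le_nsq (y : Fin n → ℂ) : ‖y‖ ^ 2 ≤ nsq y := by
  have h : ‖y‖ ≤ √(nsq y) := by
    rw [pi_norm_le_iff_of_nonneg (Real.sqrt_nonneg _)]
    intro t
    refine Real.le_sqrt_of_sq_le ?_
    exact Finset.single_le_sum (f := fun t => ‖y t‖ ^ 2) (fun _ _ => by positivity)
      (Finset.mem_univ t)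
  calc ‖y‖ ^ 2 ≤ √(nsq y) ^ 2 := pow_le_pow_left₀ (norm_nonneg _) h 2
    _ = nsq y := Real.sq_sqrt (nsq_nonneg y)

@[fun_prop]
theorem measurable_nsq : Measurable (nsq : (Fin n → ℂ) → ℝ) := by
  unfold nsq; fun_prop

theorem quadGrowth_nsq : QuadGrowth (nsq : (Fin n → ℂ) → ℝ) := by
  refine ⟨measurable_nsq, n, Nat.cast_nonneg n, fun y => ?_⟩
  rw [abs_of_nonneg (nsq_nonneg y)]
  calc nsq y ≤ ∑ _t : Fin n, ‖y‖ ^ 2 :=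
        Finset.sum_le_sum fun t _ => pow_le_pow_left₀ (norm_nonneg _) (norm_le_pi_norm y t) 2
    _ = n * ‖y‖ ^ 2 := by simp
    _ ≤ n * (1 + ‖y‖ ^ 2) := by gcongr; linarith

theorem integrable_sq_CNv (v : ℝ) : Integrable (fun y : Fin n → ℂ => ‖y‖ ^ 2) (CNv n v) := by
  have h : Integrable (nsq : (Fin n → ℂ) → ℝ) (CNv n v) := by
    unfold nsq
    refine integrable_finsetSum _ fun t _ => ?_
    simpa using integrable_sq_add_CNv v 0 1 t
  refine h.mono' (by fun_prop) (Eventually.of_forall fun y => ?_)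
  rw [Real.norm_of_nonneg (by positivity)]
  exact norm_sq_le_nsq y

theorem quadGrowth_log_cnvDensity {v : ℝ} (hv : 0 < v) :
    QuadGrowth (fun y => Real.log (cnvDensity n v y)) := by
  simp_rw [log_cnvDensity hv]
  have := (QuadGrowth.const (E := Fin n → ℂ) (-(n * Real.log (Real.pi * v)))).add
    (quadGrowth_nsq.const_mul (-v⁻¹))
  convert this using 2 with y
  ring

/-! ### Gaussian mixtures -/

variable {M : ℕ}

/-- The law of a uniformly chosen codeword plus `CN(0, v)` noise. -/
noncomputable def mixLaw (a : Fin M → Fin n → ℂ) (v : ℝ) : Measure (Fin n → ℂ) :=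
  ∑ m, (M : ENNReal)⁻¹ • (CNv n v).map (fun z => a m + z)

/-- The density of `mixLaw a v`. -/
noncomputable def mixDensity (a : Fin M → Fin n → ℂ) (v : ℝ) (y : Fin n → ℂ) : ℝ :=
  ∑ m, (M : ℝ)⁻¹ * cnvDensity n v (y - a m)

section Mixture

variable (a : Fin M → Fin n → ℂ)

@[fun_prop]
theorem measurable_mixDensity (v : ℝ) : Measurable (mixDensity a v) := by
  unfold mixDensity; fun_prop

theorem lintegral_mixLaw (v : ℝ) {φ : (Fin n → ℂ) → ENNReal} (hφ : Measurable φ) :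
    ∫⁻ y, φ y ∂(mixLaw a v) = ∑ m, (M : ENNReal)⁻¹ * ∫⁻ z, φ (a m + z) ∂(CNv n v) := by
  rw [mixLaw, lintegral_finsetSum_measure]
  refine Finset.sum_congr rfl fun m _ => ?_
  rw [lintegral_smul_measure, lintegral_map hφ (by fun_prop), smul_eq_mul]

theorem mixLaw_map_smul {v : ℝ} (hv : 0 ≤ v) (c : ℂ) :
    (mixLaw a v).map (fun z => c • z) = mixLaw (fun m => c • a m) (‖c‖ ^ 2 * v) := by
  refine Measure.ext_of_lintegral _ fun φ hφ => ?_
  rw [lintegral_map hφ (by fun_prop), lintegral_mixLaw _ _ (by fun_prop),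
    lintegral_mixLaw _ _ (by fun_prop)]
  refine Finset.sum_congr rfl fun m _ => ?_
  rw [← CNv_map_smul hv, lintegral_map (by fun_prop) (by fun_prop)]
  simp_rw [smul_add]

variable [NeZero M]

instance instIsProbabilityMeasureMixLaw (v : ℝ) : IsProbabilityMeasure (mixLaw a v) := by
  constructor
  have (m : Fin M) : IsProbabilityMeasure ((CNv n v).map (fun z => a m + z)) :=
    Measure.isProbabilityMeasure_map (by fun_prop)
  simp only [mixLaw, Measure.finsetSum_apply, Measure.smul_apply, measure_univ]
  simp [ENNReal.mul_inv_cancel (NeZero.ne (M : ENNReal)) (ENNReal.natCast_ne_top M)]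

/-- Independent Gaussian noise only changes the variance of a mixture. This recognizes the law of an
output whose noise has been split into several independent pieces. -/
theorem mixLaw_conv {b v : ℝ} (hb : 0 ≤ b) (hv : 0 ≤ v) (β γ : ℂ) :
    ((CNv n b).prod (mixLaw a v)).map (fun p => β • p.1 + γ • p.2) =
      mixLaw (fun m => γ • a m) (‖β‖ ^ 2 * b + ‖γ‖ ^ 2 * v) := by
  refine Measure.ext_of_lintegral _ fun φ hφ => ?_
  rw [lintegral_map hφ (by fun_prop), lintegral_mixLaw _ _ hφ, ← CNv_prod_map_add hb hv β γ,
    lintegral_prod _ (by fun_prop)]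
  have h2 (x : Fin n → ℂ) := lintegral_mixLaw a v (φ := fun y => φ (β • x + γ • y)) (by fun_prop)
  simp_rw [h2]
  rw [lintegral_finsetSum _ (fun m _ => by fun_prop)]
  refine Finset.sum_congr rfl fun m _ => ?_
  rw [lintegral_const_mul _ (by fun_prop), lintegral_map (by fun_prop) (by fun_prop),
    lintegral_prod _ (by fun_prop)]
  simp_rw [smul_add, add_left_comm]

theorem mixDensity_pos {v : ℝ} (hv : 0 < v) (y : Fin n → ℂ) : 0 < mixDensity a v y := by
  have : 0 < (M : ℝ) := by exact_mod_cast Nat.pos_of_neZero M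
  exact Finset.sum_pos (fun m _ => mul_pos (by positivity) (cnvDensity_pos hv _))
    Finset.univ_nonempty

theorem mixLaw_eq_withDensity {v : ℝ} (hv : 0 < v) :
    mixLaw a v = volume.withDensity (fun y => ENNReal.ofReal (mixDensity a v y)) := by
  have hM : 0 < (M : ℝ) := by exact_mod_cast Nat.pos_of_neZero M
  have h : (fun y => ENNReal.ofReal (mixDensity a v y)) = fun y => ∑ m,
      (M : ENNReal)⁻¹ * ENNReal.ofReal (cnvDensity n v (y - a m)) := by
    ext y
    rw [mixDensity, ENNReal.ofReal_sum_of_nonneg fun m _ => by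
      have := cnvDensity_pos hv (y - a m); positivity]
    refine Finset.sum_congr rfl fun m _ => ?_
    rw [ENNReal.ofReal_mul (by positivity), ENNReal.ofReal_inv_of_pos hM, ENNReal.ofReal_natCast]
  ext s hs
  rw [h, withDensity_apply _ hs, lintegral_finsetSum _ (fun m _ => by fun_prop), mixLaw,
    Measure.finsetSum_apply]
  refine Finset.sum_congr rfl fun m _ => ?_
  rw [lintegral_const_mul _ (by fun_prop), CNv_eq_withDensity hv,
    map_add_withDensity _ (by fun_prop), Measure.smul_apply, withDensity_apply _ hs, smul_eq_mul]

theorem integrable_map_add_CNv {v : ℝ} {φ : (Fin n → ℂ) → ℝ} (h : QuadGrowth φ)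
    (p : Fin n → ℂ) : Integrable φ ((CNv n v).map (fun z => p + z)) := by
  rw [integrable_map_measure h.1.aestronglyMeasurable (by fun_prop)]
  exact (h.comp ((LinGrowth.const p).add LinGrowth.id)).integrable (integrable_sq_CNv v)

theorem quadGrowth_norm_sq : QuadGrowth (fun y : Fin n → ℂ => ‖y‖ ^ 2) :=
  ⟨by fun_prop, 1, zero_le_one, fun y => by rw [abs_of_nonneg (by positivity)]; linarith⟩

theorem integrable_mixLaw {v : ℝ} {φ : (Fin n → ℂ) → ℝ} (h : QuadGrowth φ) :
    Integrable φ (mixLaw a v) := by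
  rw [mixLaw, integrable_finsetSum_measure]
  exact fun m _ => (integrable_map_add_CNv h (a m)).smul_measure (by simp [NeZero.ne M])

theorem integral_mixLaw {v : ℝ} {φ : (Fin n → ℂ) → ℝ} (h : QuadGrowth φ) :
    ∫ y, φ y ∂(mixLaw a v) = (∑ m, ∫ z, φ (a m + z) ∂(CNv n v)) / M := by
  rw [mixLaw, integral_finsetSum_measure fun m _ =>
    (integrable_map_add_CNv h (a m)).smul_measure (by simp [NeZero.ne M]), Finset.sum_div]
  refine Finset.sum_congr rfl fun m _ => ?_
  rw [integral_smul_measure, integral_map (by fun_prop) h.1.aestronglyMeasurable]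
  simp
  ring

theorem integrable_sq_mixLaw (v : ℝ) :
    Integrable (fun y : Fin n → ℂ => ‖y‖ ^ 2) (mixLaw a v) :=
  integrable_mixLaw a quadGrowth_norm_sq

theorem quadGrowth_log_mixDensity {v : ℝ} (hv : 0 < v) :
    QuadGrowth (fun y => Real.log (mixDensity a v y)) := by
  have hM : 0 < (M : ℝ) := by exact_mod_cast Nat.pos_of_neZero M
  refine ⟨by fun_prop, ?_⟩
  have h0 : QuadGrowth (fun y => Real.log (cnvDensity n v (y - a 0))) :=
    (quadGrowth_log_cnvDensity hv).comp (LinGrowth.id.sub (LinGrowth.const _))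
  obtain ⟨-, A, hA, ha⟩ := h0
  set K : ℝ := |n * Real.log (Real.pi * v)| + |Real.log M| with hK
  refine ⟨A + K, by positivity, fun y => ?_⟩
  -- Above: no component exceeds the maximum (πv)⁻ⁿ of the Gaussian density.
  have hup : Real.log (mixDensity a v y) ≤ |n * Real.log (Real.pi * v)| := by
    have h1 : ∀ m, cnvDensity n v (y - a m) ≤ Real.exp (-(n * Real.log (Real.pi * v))) := by
      intro m
      rw [← Real.log_le_iff_le_exp (cnvDensity_pos hv _), log_cnvDensity hv]
      have : 0 ≤ nsq (y - a m) / v := div_nonneg (nsq_nonneg _) hv.le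
      linarith
    have h2 : mixDensity a v y ≤ Real.exp (-(n * Real.log (Real.pi * v))) := by
      calc mixDensity a v y ≤ ∑ _m : Fin M, (M : ℝ)⁻¹ * Real.exp (-(n * Real.log (Real.pi * v))) :=
            Finset.sum_le_sum fun m _ => mul_le_mul_of_nonneg_left (h1 m) (by positivity)
        _ = Real.exp (-(n * Real.log (Real.pi * v))) := by
            simp; field_simp
    rw [← Real.log_le_iff_le_exp (mixDensity_pos a hv y)] at h2
    exact h2.trans (neg_le_abs _)
  -- Below: one component of the mixture is kept, at the cost of log M.
  have hlow : -|Real.log M| - A * (1 + ‖y‖ ^ 2) ≤ Real.log (mixDensity a v y) := by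
    have h1 : (M : ℝ)⁻¹ * cnvDensity n v (y - a 0) ≤ mixDensity a v y :=
      Finset.single_le_sum (f := fun m => (M : ℝ)⁻¹ * cnvDensity n v (y - a m)) (fun m _ => by
        have := cnvDensity_pos hv (y - a m); positivity) (Finset.mem_univ 0)
    have h2 := Real.log_le_log (mul_pos (by positivity) (cnvDensity_pos hv _)) h1
    rw [Real.log_mul (by positivity) (cnvDensity_pos hv _).ne', Real.log_inv] at h2
    have h3 := neg_le_of_abs_le (ha y)
    linarith [le_abs_self (Real.log M)]
  have h4 : K ≤ K * (1 + ‖y‖ ^ 2) := by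
    have : 0 ≤ K := by positivity
    nlinarith [sq_nonneg ‖y‖]
  have h5 : 0 ≤ A * (1 + ‖y‖ ^ 2) := by positivity
  rw [abs_le, add_mul]
  constructor <;> [skip; skip] <;> linarith [abs_nonneg (n * Real.log (Real.pi * v)),
    abs_nonneg (Real.log M)]

theorem integral_nsq_add_mixLaw {v : ℝ} (hv : 0 ≤ v) (p : Fin n → ℂ) (c : ℂ) :
    ∫ y, nsq (p + c • y) ∂(mixLaw a v) =
      (∑ m, nsq (p + c • a m)) / M + n * (‖c‖ ^ 2 * v) := by
  have hM : (M : ℝ) ≠ 0 := NeZero.ne _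
  rw [integral_mixLaw a (φ := fun y => nsq (p + c • y))
    (quadGrowth_nsq.comp ((LinGrowth.const p).add (LinGrowth.id.smul c)))]
  simp_rw [smul_add, ← add_assoc, integral_nsq_add_CNv hv]
  rw [Finset.sum_add_distrib]
  simp
  field_simp

/-- The differential entropy (in nats) of the mixture `mixLaw a v`. -/
noncomputable def mixEntropy (a : Fin M → Fin n → ℂ) (v : ℝ) : ℝ :=
  -∫ y, Real.log (mixDensity a v y) ∂(mixLaw a v)

end Mixture

/-! ### Gibbs' inequality and Fano's inequality -/

section Gibbs

variable {E : Type*} [MeasurableSpace E] {μ ν : Measure E}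

/-- This is log F ≤ F - 1 integrated. Allowing any g below log F lets Fano's inequality replace the
logarithm of the decoding weight by a lower bound. -/
theorem integral_le_of_le_log [IsProbabilityMeasure μ] {F g : E → ℝ} (hFm : Measurable F)
    (hF : ∀ e, 0 < F e) (hfin : ∫⁻ e, ENNReal.ofReal (F e) ∂μ ≠ ⊤) (hg : Integrable g μ)
    (h : ∀ e, g e ≤ Real.log (F e)) :
    ∫ e, g e ∂μ ≤ (∫⁻ e, ENNReal.ofReal (F e) ∂μ).toReal - 1 := by
  have hFi : Integrable F μ := by
    refine ⟨hFm.aestronglyMeasurable, ?_⟩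
    rw [hasFiniteIntegral_iff_ofReal (Eventually.of_forall fun z => (hF z).le)]
    exact hfin.lt_top
  have h1 : ∫ e, g e ∂μ ≤ ∫ e, (F e - 1) ∂μ :=
    integral_mono hg (hFi.sub (integrable_const 1)) fun e =>
      (h e).trans (Real.log_le_sub_one_of_pos (hF e))
  rw [integral_sub hFi (integrable_const 1), integral_eq_lintegral_of_nonneg_ae
    (Eventually.of_forall fun z => (hF z).le) hFm.aestronglyMeasurable] at h1
  simpa using h1

/-- The change of measure from the density `f` to the density `q`, along a measure-preserving
map `φ`. -/
theorem lintegral_ratio {f q : E → ℝ} (hfm : Measurable f) (hf : ∀ e, 0 < f e)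
    (hμ : μ = ν.withDensity fun e => ENNReal.ofReal (f e)) (hqm : Measurable q)
    {φ : E → E} (hφ : MeasurePreserving φ ν ν) :
    ∫⁻ e, ENNReal.ofReal (q (φ e) / f e) ∂μ = ∫⁻ e, ENNReal.ofReal (q e) ∂ν := by
  rw [hμ, lintegral_withDensity_eq_lintegral_mul _ (by fun_prop)
    (by have := hφ.measurable; fun_prop), ← hφ.lintegral_comp (f := fun e => ENNReal.ofReal (q e)) (by fun_prop)]
  refine lintegral_congr fun e => ?_
  rw [Pi.mul_apply, ← ENNReal.ofReal_mul (hf e).le, mul_div_cancel₀ _ (hf e).ne']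

/-- The ratio q∘φ / f has μ-integral at most 1 because φ preserves ν, so its logarithm has
nonpositive mean. -/
theorem gibbs [IsProbabilityMeasure μ] {f q : E → ℝ} (hfm : Measurable f) (hf : ∀ e, 0 < f e)
    (hμ : μ = ν.withDensity fun e => ENNReal.ofReal (f e)) (hqm : Measurable q)
    (hq : ∀ e, 0 < q e) (hq1 : ∫⁻ e, ENNReal.ofReal (q e) ∂ν ≤ 1)
    {φ : E → E} (hφ : MeasurePreserving φ ν ν) (hfi : Integrable (fun e => Real.log (f e)) μ)
    (hqi : Integrable (fun e => Real.log (q (φ e))) μ) :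
    ∫ e, Real.log (q (φ e)) ∂μ ≤ ∫ e, Real.log (f e) ∂μ := by
  have hr := lintegral_ratio hfm hf hμ hqm hφ
  have h := integral_le_of_le_log (μ := μ) (F := fun e => q (φ e) / f e)
    (g := fun e => Real.log (q (φ e)) - Real.log (f e))
    (by have := hφ.measurable; fun_prop) (fun e => div_pos (hq _) (hf e))
    (by rw [hr]; exact (hq1.trans_lt ENNReal.one_lt_top).ne) (hqi.sub hfi)
    (fun e => by rw [Real.log_div (hq _).ne' (hf e).ne'])
  rw [hr, integral_sub hqi hfi] at h
  have : (∫⁻ e, ENNReal.ofReal (q e) ∂ν).toReal ≤ 1 := by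
    simpa using ENNReal.toReal_mono ENNReal.one_ne_top hq1
  linarith

/-- Fano's inequality combined with Gibbs' inequality: if message `m` is sent, the output is
`φ m e`, where `e` has density `f`; then the rate is bounded by the divergence of the output from
any law of density `q`, up to the error probability of the decoder. -/
theorem fano_gibbs [IsProbabilityMeasure μ] {M : ℕ} [NeZero M] {f q : E → ℝ} (hfm : Measurable f)
    (hf : ∀ e, 0 < f e) (hμ : μ = ν.withDensity fun e => ENNReal.ofReal (f e))
    (hqm : Measurable q) (hq : ∀ e, 0 < q e) (hq1 : ∫⁻ e, ENNReal.ofReal (q e) ∂ν ≤ 1)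
    {φ : Fin M → E → E} (hφ : ∀ m, MeasurePreserving (φ m) ν ν)
    (hfi : Integrable (fun e => Real.log (f e)) μ)
    (hqi : ∀ m, Integrable (fun e => Real.log (q (φ m e))) μ)
    {dec : E → Fin M} (hdec : Measurable dec) :
    Real.log M * (1 - (∑ m, μ.real {e | dec (φ m e) ≠ m}) / M) - Real.log 2 ≤
      ∫ e, Real.log (f e) ∂μ - (∑ m, ∫ e, Real.log (q (φ m e)) ∂μ) / M := by
  have hM : 0 < (M : ℝ) := by exact_mod_cast Nat.pos_of_neZero M
  -- A softened decoder: an even mixture of the decision of `dec` and a uniform guess. It is a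
  -- probability vector in m that never vanishes, with log k ≥ -log 2 on correct decoding and log k
  -- = -log 2 - log M on error. This produces both the error term and the constant log 2 in Fano's
  -- inequality.
  set k : Fin M → E → ℝ := fun m e => (if dec e = m then 1 / 2 else 0) + (2 * M : ℝ)⁻¹ with hk
  have hkm : ∀ m, Measurable (k m) := fun m =>
    (Measurable.ite (hdec (measurableSet_singleton m)) measurable_const
      measurable_const).add measurable_const
  have hk0 : ∀ m e, 0 < k m e := by
    intro m e
    simp only [hk]
    split_ifs <;> positivity
  have hk1 : ∀ e, ∑ m, k m e = 1 := by
    intro e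
    simp only [hk]
    rw [Finset.sum_add_distrib]
    simp
    field_simp
    norm_num
  have hr : ∀ m, ∫⁻ e, ENNReal.ofReal (M * (q (φ m e) * k m (φ m e)) / f e) ∂μ =
      ∫⁻ e, ENNReal.ofReal (M * (q e * k m e)) ∂ν := fun m => by
    have := hkm m
    exact lintegral_ratio (q := fun e => M * (q e * k m e)) hfm hf hμ (by fun_prop) (hφ m)
  have hsum : ∑ m, ∫⁻ e, ENNReal.ofReal (M * (q e * k m e)) ∂ν ≤ M := by
    rw [← lintegral_finsetSum _ (fun m _ => by have := hkm m; fun_prop)]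
    have : ∀ e, ∑ m, ENNReal.ofReal (M * (q e * k m e)) = M * ENNReal.ofReal (q e) := by
      intro e
      rw [← ENNReal.ofReal_sum_of_nonneg fun m _ => by
        have := hq e; have := hk0 m e; positivity, ← Finset.mul_sum, ← Finset.mul_sum, hk1,
        mul_one, ENNReal.ofReal_mul hM.le, ENNReal.ofReal_natCast]
    simp_rw [this]
    rw [lintegral_const_mul _ (by fun_prop)]
    calc (M : ENNReal) * ∫⁻ e, ENNReal.ofReal (q e) ∂ν ≤ M * 1 := by gcongr
      _ = M := mul_one _
  have hfin : ∀ m, ∫⁻ e, ENNReal.ofReal (M * (q e * k m e)) ∂ν ≠ ⊤ := fun m =>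
    ((Finset.single_le_sum (f := fun m => ∫⁻ e, ENNReal.ofReal (M * (q e * k m e)) ∂ν)
      (fun _ _ => zero_le) (Finset.mem_univ m)).trans hsum).trans_lt
      (ENNReal.natCast_lt_top M) |>.ne
  have herr : ∀ m, MeasurableSet {e | dec (φ m e) ≠ m} := fun m =>
    (hdec.comp (hφ m).measurable) (measurableSet_singleton m).compl
  -- The ratio to which log F ≤ F - 1 is applied is M·q·k_m / f. Its integrals sum to at most M over
  -- the messages, because the weights k_m sum to 1.
  have hm : ∀ m, Real.log M - Real.log 2 - Real.log M * μ.real {e | dec (φ m e) ≠ m}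
      + ∫ e, Real.log (q (φ m e)) ∂μ - ∫ e, Real.log (f e) ∂μ ≤
      (∫⁻ e, ENNReal.ofReal (M * (q e * k m e)) ∂ν).toReal - 1 := by
    intro m
    have hind : Integrable (fun e => Real.log M * {e | dec (φ m e) ≠ m}.indicator 1 e) μ :=
      ((integrable_const (1 : ℝ)).indicator (herr m)).const_mul _
    have i1 : Integrable (fun e => Real.log M - Real.log 2
        - Real.log M * {e | dec (φ m e) ≠ m}.indicator 1 e) μ := (integrable_const _).sub hind
    have i2 : Integrable (fun e => Real.log M - Real.log 2
        - Real.log M * {e | dec (φ m e) ≠ m}.indicator 1 e + Real.log (q (φ m e))) μ :=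
      i1.add (hqi m)
    have h := integral_le_of_le_log (μ := μ)
      (F := fun e => M * (q (φ m e) * k m (φ m e)) / f e)
      (g := fun e => Real.log M - Real.log 2
        - Real.log M * {e | dec (φ m e) ≠ m}.indicator 1 e + Real.log (q (φ m e))
        - Real.log (f e))
      (by have := (hφ m).measurable; have := hkm m; fun_prop)
      (fun e => by have := hq (φ m e); have := hk0 m (φ m e); have := hf e; positivity)
      (by rw [hr]; exact hfin m) (i2.sub hfi) ?_
    · rw [hr, integral_sub i2 hfi, integral_add i1 (hqi m), integral_sub (integrable_const _) hind,
        integral_const_mul, integral_indicator_one (herr m)] at h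
      simpa using h
    · intro e
      have hlog : -Real.log 2 - Real.log M * {e | dec (φ m e) ≠ m}.indicator 1 e ≤
          Real.log (k m (φ m e)) := by
        by_cases hd : dec (φ m e) = m
        · rw [Set.indicator_of_notMem (by simpa using hd), mul_zero, sub_zero, ← Real.log_inv]
          refine Real.log_le_log (by norm_num) ?_
          simp only [hk, if_pos hd]
          have : 0 < (2 * M : ℝ)⁻¹ := by positivity
          linarith
        · rw [Set.indicator_of_mem (by simpa using hd)]
          simp only [hk, if_neg hd, zero_add, Pi.one_apply]
          rw [Real.log_inv, Real.log_mul two_ne_zero hM.ne']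
          linarith
      rw [Real.log_div (by have := hq (φ m e); have := hk0 m (φ m e); positivity) (hf e).ne',
        Real.log_mul hM.ne' (by have := hq (φ m e); have := hk0 m (φ m e); positivity),
        Real.log_mul (hq _).ne' (hk0 m _).ne']
      linarith
  -- Summed over m, the M terms -1 on the right compensate the total mass M.
  have htot := Finset.sum_le_sum fun m (_ : m ∈ Finset.univ) => hm m
  have hsum' : ∑ m, (∫⁻ e, ENNReal.ofReal (M * (q e * k m e)) ∂ν).toReal ≤ M := by
    rw [← ENNReal.toReal_sum fun m _ => hfin m]
    simpa using ENNReal.toReal_mono (ENNReal.natCast_ne_top M) hsum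
  simp only [Finset.sum_sub_distrib, Finset.sum_add_distrib, ← Finset.mul_sum, Finset.sum_const,
    Finset.card_univ, Fintype.card_fin, nsmul_eq_mul] at htot
  have key : (M : ℝ) * (Real.log M * (1 - (∑ m, μ.real {e | dec (φ m e) ≠ m}) / M) - Real.log 2) ≤
      M * (∫ e, Real.log (f e) ∂μ - (∑ m, ∫ e, Real.log (q (φ m e)) ∂μ) / M) := by
    have e1 : (M : ℝ) * ((∑ m, μ.real {e | dec (φ m e) ≠ m}) / M) =
      ∑ m, μ.real {e | dec (φ m e) ≠ m} := mul_div_cancel₀ _ hM.ne'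
    have e2 : (M : ℝ) * ((∑ m, ∫ e, Real.log (q (φ m e)) ∂μ) / M) =
      ∑ m, ∫ e, Real.log (q (φ m e)) ∂μ := mul_div_cancel₀ _ hM.ne'
    have e3 : (M : ℝ) * (Real.log M * (1 - (∑ m, μ.real {e | dec (φ m e) ≠ m}) / M) - Real.log 2)
      = M * Real.log M - Real.log M * (M * ((∑ m, μ.real {e | dec (φ m e) ≠ m}) / M))
        - M * Real.log 2 := by ring
    rw [e3, mul_sub, e1, e2]
    linarith
  exact le_of_mul_le_mul_left key hM

end Gibbs

section GibbsGrowth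

variable {E : Type*} [NormedAddCommGroup E] [MeasurableSpace E] {μ ν : Measure E}

/-- `gibbs` for log-densities of quadratic growth. -/
theorem gibbs_quadGrowth [IsProbabilityMeasure μ] (hμ2 : Integrable (fun y => ‖y‖ ^ 2) μ)
    {f q lf lq : E → ℝ} (hfm : Measurable f) (hf : ∀ e, 0 < f e)
    (hμ : μ = ν.withDensity fun e => ENNReal.ofReal (f e)) (hqm : Measurable q)
    (hq : ∀ e, 0 < q e) (hq1 : ∫⁻ e, ENNReal.ofReal (q e) ∂ν ≤ 1)
    {φ : E → E} (hφ : MeasurePreserving φ ν ν) (hφL : LinGrowth φ)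
    (hlf : ∀ e, Real.log (f e) = lf e) (hlq : ∀ e, Real.log (q e) = lq e)
    (hlfQ : QuadGrowth lf) (hlqQ : QuadGrowth lq) :
    ∫ e, lq (φ e) ∂μ ≤ ∫ e, lf e ∂μ := by
  obtain rfl : (fun e => Real.log (f e)) = lf := funext hlf
  obtain rfl : (fun e => Real.log (q e)) = lq := funext hlq
  exact gibbs hfm hf hμ hqm hq hq1 hφ (hlfQ.integrable hμ2) ((hlqQ.comp hφL).integrable hμ2)

/-- `fano_gibbs` for log-densities of quadratic growth. -/
theorem fano_quadGrowth [IsProbabilityMeasure μ] (hμ2 : Integrable (fun y => ‖y‖ ^ 2) μ)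
    {M : ℕ} [NeZero M] {f q lf lq : E → ℝ} (hfm : Measurable f) (hf : ∀ e, 0 < f e)
    (hμ : μ = ν.withDensity fun e => ENNReal.ofReal (f e)) (hqm : Measurable q)
    (hq : ∀ e, 0 < q e) (hq1 : ∫⁻ e, ENNReal.ofReal (q e) ∂ν ≤ 1)
    {φ : Fin M → E → E} (hφ : ∀ m, MeasurePreserving (φ m) ν ν) (hφL : ∀ m, LinGrowth (φ m))
    (hlf : ∀ e, Real.log (f e) = lf e) (hlq : ∀ e, Real.log (q e) = lq e)
    (hlfQ : QuadGrowth lf) (hlqQ : QuadGrowth lq) {dec : E → Fin M} (hdec : Measurable dec) :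
    Real.log M * (1 - (∑ m, μ.real {e | dec (φ m e) ≠ m}) / M) - Real.log 2 ≤
      ∫ e, lf e ∂μ - (∑ m, ∫ e, lq (φ m e) ∂μ) / M := by
  obtain rfl : (fun e => Real.log (f e)) = lf := funext hlf
  obtain rfl : (fun e => Real.log (q e)) = lq := funext hlq
  exact fano_gibbs hfm hf hμ hqm hq hq1 hφ (hlfQ.integrable hμ2)
    (fun m => (hlqQ.comp (hφL m)).integrable hμ2) hdec

end GibbsGrowth

/-! ### Shears and product densities -/

section Shear

variable {E F : Type*} [MeasurableSpace E] [MeasurableSpace F]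

/-- Once the message is fixed, noise is carried to the channel and genie outputs by maps of this
shape, so no Jacobian appears. -/
theorem measurePreserving_shear [AddGroup E] [MeasurableAdd E] [AddGroup F] [MeasurableAdd₂ F]
    (μ : Measure E) [SFinite μ] [μ.IsAddLeftInvariant] (ν : Measure F) [SFinite ν]
    [ν.IsAddLeftInvariant] (a : E) {L : E → F} (hL : Measurable L) :
    MeasurePreserving (fun p : E × F => (a + p.1, L p.1 + p.2)) (μ.prod ν) (μ.prod ν) :=
  (measurePreserving_add_left μ a).skew_product (g := fun x y => L x + y) (by fun_prop)
    (Eventually.of_forall fun x => map_add_left_eq_self ν (L x))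

theorem prod_withDensity_ofReal {μ : Measure E} {ν : Measure F} [SFinite μ] [SFinite ν]
    {f : E → ℝ} {g : F → ℝ} (hf : Measurable f) (hg : Measurable g) (hf0 : ∀ x, 0 ≤ f x)
    [SFinite (μ.withDensity fun x => ENNReal.ofReal (f x))]
    [SFinite (ν.withDensity fun x => ENNReal.ofReal (g x))] :
    (μ.withDensity fun x => ENNReal.ofReal (f x)).prod
      (ν.withDensity fun x => ENNReal.ofReal (g x)) =
      (μ.prod ν).withDensity fun p => ENNReal.ofReal (f p.1 * g p.2) := by
  rw [prod_withDensity (by fun_prop) (by fun_prop)]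
  simp_rw [ENNReal.ofReal_mul (hf0 _)]

/-- A density times a shifted conditional density is a density. -/
theorem lintegral_mul_shift_le_one [AddGroup E] [MeasurableAdd E] [MeasurableSub₂ E]
    {μ : Measure E} [SFinite μ] [μ.IsAddRightInvariant] {ν : Measure F} [SFinite ν] {f : E → ℝ}
    {g : F → ℝ} (hf : Measurable f) (hg : Measurable g) (hg0 : ∀ x, 0 ≤ g x)
    (hf1 : ∫⁻ x, ENNReal.ofReal (f x) ∂μ ≤ 1) (hg1 : ∫⁻ x, ENNReal.ofReal (g x) ∂ν ≤ 1)
    {L : F → E} (hL : Measurable L) :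
    ∫⁻ p, ENNReal.ofReal (g p.2 * f (p.1 - L p.2)) ∂(μ.prod ν) ≤ 1 := by
  rw [lintegral_prod_symm' _ (by fun_prop)]
  simp_rw [ENNReal.ofReal_mul (hg0 _)]
  have h (y : F) : ∫⁻ x, ENNReal.ofReal (g y) * ENNReal.ofReal (f (x - L y)) ∂μ ≤
      ENNReal.ofReal (g y) := by
    rw [lintegral_const_mul _ (by fun_prop),
      lintegral_sub_right_eq_self (fun x => ENNReal.ofReal (f x)) (L y)]
    calc _ ≤ ENNReal.ofReal (g y) * 1 := by gcongr
      _ = _ := mul_one _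
  exact (lintegral_mono h).trans hg1

theorem lintegral_mul_shift_le_one' [AddGroup E] [MeasurableAdd E] [MeasurableSub₂ E]
    {μ : Measure E} [SFinite μ] [μ.IsAddRightInvariant] {ν : Measure F} [SFinite ν] {f : E → ℝ}
    {g : F → ℝ} (hf : Measurable f) (hg : Measurable g) (hg0 : ∀ x, 0 ≤ g x)
    (hf1 : ∫⁻ x, ENNReal.ofReal (f x) ∂μ ≤ 1) (hg1 : ∫⁻ x, ENNReal.ofReal (g x) ∂ν ≤ 1)
    {L : F → E} (hL : Measurable L) :
    ∫⁻ p, ENNReal.ofReal (g p.1 * f (p.2 - L p.1)) ∂(ν.prod μ) ≤ 1 := by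
  rw [← Measure.prod_swap, lintegral_map (by fun_prop) measurable_swap]
  exact lintegral_mul_shift_le_one hf hg hg0 hf1 hg1 hL

end Shear

variable {n M : ℕ}

theorem lintegral_cnvDensity {v : ℝ} (hv : 0 < v) :
    ∫⁻ y : Fin n → ℂ, ENNReal.ofReal (cnvDensity n v y) = 1 := by
  rw [← setLIntegral_univ, ← withDensity_apply _ MeasurableSet.univ, ← CNv_eq_withDensity hv,
    measure_univ]

theorem lintegral_mixDensity [NeZero M] (a : Fin M → Fin n → ℂ) {v : ℝ} (hv : 0 < v) :
    ∫⁻ y : Fin n → ℂ, ENNReal.ofReal (mixDensity a v y) = 1 := by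
  rw [← setLIntegral_univ, ← withDensity_apply _ MeasurableSet.univ, ← mixLaw_eq_withDensity a hv,
    measure_univ]

theorem CNv_prod_mixLaw_eq_withDensity [NeZero M] (a : Fin M → Fin n → ℂ) {b v : ℝ} (hb : 0 < b)
    (hv : 0 < v) : (CNv n b).prod (mixLaw a v) = (volume.prod volume).withDensity
      fun p => ENNReal.ofReal (cnvDensity n b p.1 * mixDensity a v p.2) := by
  have h1 := CNv_eq_withDensity (n := n) hb
  have h2 := mixLaw_eq_withDensity a hv
  have : SFinite (volume.withDensity fun y => ENNReal.ofReal (cnvDensity n b y)) := by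
    rw [← h1]; infer_instance
  have : SFinite (volume.withDensity fun y => ENNReal.ofReal (mixDensity a v y)) := by
    rw [← h2]; infer_instance
  rw [h1, h2, prod_withDensity_ofReal (by fun_prop) (by fun_prop)
    fun y => (cnvDensity_pos hb y).le]

/-! ### Entropies of mixtures and second moments -/

section Moments

variable {n M K : ℕ} [NeZero M] [NeZero K]

theorem integral_log_cnvDensity_CNv {v : ℝ} (hv : 0 < v) :
    ∫ y, Real.log (cnvDensity n v y) ∂(CNv n v) = -(n * (Real.log (Real.pi * v) + 1)) := by
  simp_rw [log_cnvDensity hv]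
  have h := integral_nsq_add_CNv (n := n) hv.le 0 1
  have hi : Integrable (nsq : (Fin n → ℂ) → ℝ) (CNv n v) :=
    quadGrowth_nsq.integrable (integrable_sq_CNv v)
  simp only [zero_add, one_smul, norm_one, one_pow, one_mul] at h
  rw [integral_sub (integrable_const _) (hi.div_const v), integral_div, h]
  simp [nsq]
  field_simp
  ring

/-- Multiplication by h on ℂⁿ scales volume by |h|²ⁿ. -/
theorem mixEntropy_smul (a : Fin M → Fin n → ℂ) {v : ℝ} (hv : 0 < v) {h : ℂ} (hh : h ≠ 0) :
    mixEntropy (fun m => h • a m) (‖h‖ ^ 2 * v) = mixEntropy a v + n * Real.log (‖h‖ ^ 2) := by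
  have hH : 0 < ‖h‖ ^ 2 := by positivity
  have e1 (z : ℂ) : cnDensity (‖h‖ ^ 2 * v) (h * z) = (‖h‖ ^ 2)⁻¹ * cnDensity v z := by
    have : ‖h‖ ^ 2 * ‖z‖ ^ 2 / (‖h‖ ^ 2 * v) = ‖z‖ ^ 2 / v := by field_simp
    rw [cnDensity, cnDensity, norm_mul, mul_pow, this]
    field_simp
  have e2 (y : Fin n → ℂ) : cnvDensity n (‖h‖ ^ 2 * v) (h • y) =
      ((‖h‖ ^ 2)⁻¹) ^ n * cnvDensity n v y := by
    simp_rw [cnvDensity, Pi.smul_apply, smul_eq_mul, e1]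
    rw [Finset.prod_mul_distrib]
    simp
  have e3 (y : Fin n → ℂ) : mixDensity (fun m => h • a m) (‖h‖ ^ 2 * v) (h • y) =
      ((‖h‖ ^ 2)⁻¹) ^ n * mixDensity a v y := by
    simp_rw [mixDensity, ← smul_sub, e2, Finset.mul_sum]
    refine Finset.sum_congr rfl fun m _ => by ring
  have e4 (y : Fin n → ℂ) : Real.log (mixDensity (fun m => h • a m) (‖h‖ ^ 2 * v) (h • y)) =
      -(n * Real.log (‖h‖ ^ 2)) + Real.log (mixDensity a v y) := by
    rw [e3, Real.log_mul (by positivity) (mixDensity_pos a hv y).ne', Real.log_pow, Real.log_inv]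
    ring
  rw [mixEntropy, ← mixLaw_map_smul a hv.le, integral_map (by fun_prop)
    (Measurable.aestronglyMeasurable (by fun_prop))]
  simp_rw [e4]
  rw [integral_add (integrable_const _) (integrable_mixLaw a (quadGrowth_log_mixDensity a hv)),
    mixEntropy]
  simp

theorem mixEntropy_zero {v : ℝ} (hv : 0 < v) :
    mixEntropy (fun _ : Fin M => (0 : Fin n → ℂ)) v = n * (Real.log (Real.pi * v) + 1) := by
  have hM : (M : ℝ) ≠ 0 := NeZero.ne _
  have h : mixDensity (fun _ : Fin M => (0 : Fin n → ℂ)) v = cnvDensity n v := by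
    ext y; simp [mixDensity]
    field_simp
  rw [mixEntropy, h, integral_mixLaw _ (quadGrowth_log_cnvDensity hv)]
  simp [integral_log_cnvDensity_CNv hv]
  field_simp

/-- The cross terms average to the Hermitian product of the two mean codewords, so it is enough that
one of the two codebooks is centred. -/
theorem avg_nsq_add (x : Fin M → Fin n → ℂ) (a : Fin K → Fin n → ℂ)
    (h : ip (∑ m, x m) (∑ i, a i) = 0) :
    (∑ m, (∑ i, nsq (x m + a i)) / K) / M = (∑ m, nsq (x m)) / M + (∑ i, nsq (a i)) / K := by
  have hM : (M : ℝ) ≠ 0 := NeZero.ne _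
  have hK : (K : ℝ) ≠ 0 := NeZero.ne _
  have e (p q : Fin n → ℂ) : nsq (p + q) = nsq p + nsq q + 2 * (ip p q).re := by
    have : ((nsq (p + q) : ℝ) : ℂ) = (nsq p + nsq q + 2 * (ip p q).re : ℝ) := by
      rw [← ip_self, ip_add_left, ip_add_right, ip_add_right, ip_self, ip_self,
        ← ip_conj_symm p q]
      push_cast
      have := Complex.add_conj (ip p q)
      push_cast at this
      linear_combination this
    exact_mod_cast this
  have hs : ∑ m, ∑ i, ip (x m) (a i) = 0 := by
    rw [← h]
    simp only [ip, Finset.sum_apply, map_sum, Finset.sum_mul_sum]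
    rw [Finset.sum_comm' (s := Finset.univ) (t := fun _ => Finset.univ) (t' := Finset.univ)
      (s' := fun _ => Finset.univ) (by simp)]
    simp_rw [Finset.sum_comm (s := (Finset.univ : Finset (Fin n)))]
    rw [Finset.sum_comm]
  have hs' : ∑ m, ∑ i, (ip (x m) (a i)).re = 0 := by
    simp_rw [← Complex.re_sum]
    rw [hs, Complex.zero_re]
  simp_rw [e]
  simp only [Finset.sum_add_distrib, ← Finset.mul_sum, Finset.sum_const, Finset.card_univ,
    Fintype.card_fin, nsmul_eq_mul, ← Finset.sum_div, hs']
  field_simp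
  ring

theorem integral_nsq_prod {b v : ℝ} (hb : 0 ≤ b) (hv : 0 ≤ v) (a : Fin M → Fin n → ℂ)
    (p : Fin n → ℂ) (β γ : ℂ) :
    ∫ y, nsq (p + (β • y.1 + γ • y.2)) ∂((CNv n b).prod (mixLaw a v)) =
      (∑ m, nsq (p + γ • a m)) / M + n * (‖β‖ ^ 2 * b + ‖γ‖ ^ 2 * v) := by
  have h := integral_nsq_add_mixLaw (fun m => γ • a m)
    (v := ‖β‖ ^ 2 * b + ‖γ‖ ^ 2 * v) (by positivity) p 1
  rw [← mixLaw_conv a hb hv, integral_map (by fun_prop)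
    (Measurable.aestronglyMeasurable (by fun_prop))] at h
  simpa using h

theorem integral_nsq_prod_prod {b v w : ℝ} (hb : 0 ≤ b) (hv : 0 ≤ v) (hw : 0 ≤ w)
    (a : Fin M → Fin n → ℂ) (p : Fin n → ℂ) (β γ δ : ℂ) :
    ∫ y, nsq (p + (β • y.1 + (γ • y.2.1 + δ • y.2.2)))
        ∂((CNv n b).prod ((mixLaw a v).prod (CNv n w))) =
      (∑ m, nsq (p + γ • a m)) / M + n * (‖β‖ ^ 2 * b + ‖γ‖ ^ 2 * v + ‖δ‖ ^ 2 * w) := by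
  have hM : (M : ℝ) ≠ 0 := NeZero.ne _
  have hq : QuadGrowth (fun y : (Fin n → ℂ) × ((Fin n → ℂ) × (Fin n → ℂ)) =>
      nsq (p + (β • y.1 + (γ • y.2.1 + δ • y.2.2)))) :=
    quadGrowth_nsq.comp ((LinGrowth.const p).add ((LinGrowth.id.fst.smul β).add
      ((LinGrowth.id.snd.fst.smul γ).add (LinGrowth.id.snd.snd.smul δ))))
  rw [integral_prod _ (hq.integrable (integrable_sq_prod (integrable_sq_CNv b)
    (integrable_sq_prod (integrable_sq_mixLaw a v) (integrable_sq_CNv w))))]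
  have h (x : Fin n → ℂ) : ∫ y, nsq (p + (β • x + (γ • y.1 + δ • y.2)))
        ∂((mixLaw a v).prod (CNv n w)) =
      (∑ m, nsq ((p + γ • a m) + β • x)) / M + n * (‖γ‖ ^ 2 * v + ‖δ‖ ^ 2 * w) := by
    rw [← Measure.prod_swap, integral_map (by fun_prop)
      (Measurable.aestronglyMeasurable (by fun_prop))]
    have := integral_nsq_prod hw hv a (p + β • x) δ γ
    simp only [Prod.fst_swap, Prod.snd_swap]
    simp_rw [add_comm (γ • _) (δ • _), ← add_assoc] at this ⊢
    rw [this]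
    simp_rw [add_right_comm p (β • x), add_comm (‖δ‖ ^ 2 * w)]
  simp_rw [h]
  have hi (m : Fin M) : Integrable (fun x => nsq ((p + γ • a m) + β • x)) (CNv n b) :=
    (quadGrowth_nsq.comp ((LinGrowth.const _).add (LinGrowth.id.smul β))).integrable
      (integrable_sq_CNv b)
  rw [integral_add ((integrable_finsetSum _ fun m _ => hi m).div_const _) (integrable_const _),
    integral_div, integral_finsetSum _ fun m _ => hi m]
  simp_rw [integral_nsq_add_CNv hb]
  rw [Finset.sum_add_distrib]
  simp
  field_simp
  ring

/-- Gaussian noise is the worst noise: the increase of the entropy of a power-constrained mixture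
caused by additional Gaussian noise is at least that of a Gaussian. -/
theorem mixEntropy_sub_le (a : Fin M → Fin n → ℂ) {S v v' : ℝ} (hS : 0 ≤ S) (hv : 0 < v)
    (hvv : v ≤ v') (ha : (∑ m, nsq (a m)) / M ≤ n * S) :
    mixEntropy a v - mixEntropy a v' ≤ n * (Real.log (S + v) - Real.log (S + v')) := by
  rcases hvv.eq_or_lt with rfl | hlt
  · simp
  set δ := v' - v with hδ
  have hδ0 : 0 < δ := by rw [hδ]; linarith
  have hv' : 0 < v' := hv.trans hlt
  -- The pair (G, C) is considered, where C = A + G, A has law `mixLaw a v` and G is the added noise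
  -- of variance δ. The test density is the true law of C times a Gaussian for G given C. Here α is
  -- the optimal linear coefficient for estimating G from C when A has variance S + v, and w is the
  -- resulting mean square error.
  set α : ℝ := δ / (S + v') with hα
  set w : ℝ := δ * (S + v) / (S + v') with hw
  have hw0 : 0 < w := by positivity
  have hμ2 := integrable_sq_prod (integrable_sq_CNv (n := n) δ) (integrable_sq_mixLaw a v)
  have hφL : LinGrowth fun p : (Fin n → ℂ) × (Fin n → ℂ) => (0 + p.1, p.1 + p.2) :=
    ((LinGrowth.const 0).add LinGrowth.id.fst).prodMk (LinGrowth.id.fst.add LinGrowth.id.snd)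
  have f1 := (quadGrowth_log_cnvDensity (n := n) hδ0).comp
    (LinGrowth.id (E := (Fin n → ℂ) × (Fin n → ℂ))).fst
  have f2 := (quadGrowth_log_mixDensity a hv).comp
    (LinGrowth.id (E := (Fin n → ℂ) × (Fin n → ℂ))).snd
  have g1 := (quadGrowth_log_mixDensity a hv').comp
    (LinGrowth.id (E := (Fin n → ℂ) × (Fin n → ℂ))).snd
  have g2 := (quadGrowth_log_cnvDensity (n := n) hw0).comp
    ((LinGrowth.id (E := (Fin n → ℂ) × (Fin n → ℂ))).fst.sub (LinGrowth.id.snd.smul (α : ℂ)))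
  have q1 := g1.comp hφL
  have q2 := g2.comp hφL
  have hq1 : ∫⁻ p : (Fin n → ℂ) × (Fin n → ℂ), ENNReal.ofReal
      (mixDensity a v' p.2 * cnvDensity n w (p.1 - (α : ℂ) • p.2)) ∂(volume.prod volume) ≤ 1 :=
    lintegral_mul_shift_le_one (f := cnvDensity n w) (g := mixDensity a v')
      (L := fun y => (α : ℂ) • y) (by fun_prop) (by fun_prop) (fun y => (mixDensity_pos a hv' y).le)
      (lintegral_cnvDensity hw0).le (lintegral_mixDensity a hv').le (by fun_prop)
  have hφ : MeasurePreserving (fun p : (Fin n → ℂ) × (Fin n → ℂ) => (0 + p.1, p.1 + p.2))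
      (volume.prod volume) (volume.prod volume) :=
    measurePreserving_shear volume volume (0 : Fin n → ℂ) measurable_id
  have hf0 (p : (Fin n → ℂ) × (Fin n → ℂ)) : 0 < cnvDensity n δ p.1 * mixDensity a v p.2 :=
    mul_pos (cnvDensity_pos hδ0 _) (mixDensity_pos a hv _)
  have hq0 (p : (Fin n → ℂ) × (Fin n → ℂ)) :
      0 < mixDensity a v' p.2 * cnvDensity n w (p.1 - (α : ℂ) • p.2) :=
    mul_pos (mixDensity_pos a hv' _) (cnvDensity_pos hw0 _)
  have hfm : Measurable fun p : (Fin n → ℂ) × (Fin n → ℂ) =>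
    cnvDensity n δ p.1 * mixDensity a v p.2 := by fun_prop
  have hqm : Measurable fun p : (Fin n → ℂ) × (Fin n → ℂ) =>
    mixDensity a v' p.2 * cnvDensity n w (p.1 - (α : ℂ) • p.2) := by fun_prop
  have h := gibbs_quadGrowth hμ2 hfm hf0 (CNv_prod_mixLaw_eq_withDensity a hδ0 hv) hqm hq0 hq1 hφ
    hφL (fun p => Real.log_mul (cnvDensity_pos hδ0 _).ne' (mixDensity_pos a hv _).ne')
    (fun p => Real.log_mul (mixDensity_pos a hv' _).ne' (cnvDensity_pos hw0 _).ne')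
    (f1.add f2) (g1.add g2)
  rw [integral_add (q1.integrable hμ2) (q2.integrable hμ2),
    integral_add (f1.integrable hμ2) (f2.integrable hμ2),
    integral_fun_fst (fun y => Real.log (cnvDensity n δ y)),
    integral_fun_snd (fun y => Real.log (mixDensity a v y)),
    integral_log_cnvDensity_CNv hδ0] at h
  have t1 : ∫ p, Real.log (mixDensity a v' (p.1 + p.2)) ∂((CNv n δ).prod (mixLaw a v)) =
      -mixEntropy a v' := by
    have h3 := mixLaw_conv a hδ0.le hv.le 1 1
    simp only [one_smul, norm_one, one_pow, one_mul] at h3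
    rw [mixEntropy, neg_neg, show v' = δ + v by rw [hδ]; ring, ← h3,
      integral_map (by fun_prop) (Measurable.aestronglyMeasurable (by fun_prop))]
  have t2 : -(n * (Real.log (Real.pi * w) + 1)) ≤
      ∫ p, Real.log (cnvDensity n w (0 + p.1 - (α : ℂ) • (p.1 + p.2)))
        ∂((CNv n δ).prod (mixLaw a v)) := by
    have e (p : (Fin n → ℂ) × (Fin n → ℂ)) : 0 + p.1 - (α : ℂ) • (p.1 + p.2) =
        0 + (((1 - α : ℝ) : ℂ) • p.1 + ((-α : ℝ) : ℂ) • p.2) := by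
      push_cast; module
    have hi : Integrable (fun p : (Fin n → ℂ) × (Fin n → ℂ) =>
        nsq (0 + (((1 - α : ℝ) : ℂ) • p.1 + ((-α : ℝ) : ℂ) • p.2)))
        ((CNv n δ).prod (mixLaw a v)) :=
      (quadGrowth_nsq.comp ((LinGrowth.const 0).add ((LinGrowth.id.fst.smul _).add
        (LinGrowth.id.snd.smul _)))).integrable hμ2
    simp_rw [log_cnvDensity hw0, e]
    rw [integral_sub (integrable_const _) (hi.div_const _), integral_div,
      integral_nsq_prod hδ0.le hv.le]
    simp only [zero_add, nsq_smul, Complex.norm_real, Real.norm_eq_abs, sq_abs, integral_const,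
      probReal_univ, one_smul, ← Finset.mul_sum, mul_div_assoc]
    -- Only this second moment of the estimation error sees the code; it equals nw when the power is
    -- exactly nS.
    have : ((-α) ^ 2 * ((∑ m, nsq (a m)) / M) + n * ((1 - α) ^ 2 * δ + (-α) ^ 2 * v)) ≤ n * w := by
      calc _ ≤ (-α) ^ 2 * (n * S) + n * ((1 - α) ^ 2 * δ + (-α) ^ 2 * v) := by gcongr
        _ = n * w := by
          rw [hw, hα, hδ]
          have : S + v' ≠ 0 := by positivity
          field_simp
          ring
    have h2 := div_le_div_of_nonneg_right this hw0.le
    rw [mul_div_cancel_right₀ _ hw0.ne'] at h2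
    linarith
  simp only [probReal_univ, one_smul] at h
  rw [t1] at h
  have hlogw : Real.log (Real.pi * w) = Real.log (Real.pi * δ) + Real.log (S + v)
      - Real.log (S + v') := by
    rw [hw, mul_div_assoc', ← mul_assoc, Real.log_div (by positivity) (by positivity),
      Real.log_mul (by positivity) (by positivity)]
  have h4 : ∫ y, Real.log (mixDensity a v y) ∂(mixLaw a v) = -mixEntropy a v := by
    rw [mixEntropy, neg_neg]
  rw [h4] at h
  rw [hlogw] at t2
  nlinarith [h, t2]

end Moments

/-! ### Multi-letter rate bounds -/

section Rates

variable {n M K : ℕ}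

theorem measurableSet_error {dec : (Fin n → ℂ) → Fin M} (hdec : Measurable dec) (m : Fin M)
    (x : Fin n → ℂ) : MeasurableSet {y | dec (x + y) ≠ m} :=
  (hdec.comp (measurable_const_add x)) (measurableSet_singleton m).compl

theorem integral_log_mixDensity (a : Fin M → Fin n → ℂ) (v : ℝ) :
    ∫ y, Real.log (mixDensity a v y) ∂(mixLaw a v) = -mixEntropy a v := by
  rw [mixEntropy, neg_neg]

variable [NeZero M] [NeZero K]

theorem integral_log_cnvDensity_comp {E : Type*} [MeasurableSpace E] {μ : Measure E}
    [IsProbabilityMeasure μ] {w : ℝ} (hw : 0 < w) {r : E → Fin n → ℂ}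
    (hr : Integrable (fun e => nsq (r e)) μ) :
    ∫ e, Real.log (cnvDensity n w (r e)) ∂μ =
      -(n * Real.log (Real.pi * w)) - (∫ e, nsq (r e) ∂μ) / w := by
  simp_rw [log_cnvDensity hw]
  rw [integral_sub (integrable_const _) (hr.div_const _), integral_div]
  simp

theorem avg_integral_log_mixDensity (a : Fin M → Fin n → ℂ) {v : ℝ} (hv : 0 < v) :
    (∑ m, ∫ z, Real.log (mixDensity a v (a m + z)) ∂(CNv n v)) / M = -mixEntropy a v := by
  rw [← integral_mixLaw a (quadGrowth_log_mixDensity a hv), integral_log_mixDensity]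

/-- The rate bound obtained by treating the interference as noise, with a Gaussian output law. -/
theorem rate_le_of_output (x : Fin M → Fin n → ℂ) (a : Fin K → Fin n → ℂ) {P S : ℝ} (hP : 0 < P)
    (hS : 0 ≤ S) (hx : (∑ m, nsq (x m)) / M ≤ n * P) (ha : (∑ m, nsq (a m)) / K ≤ n * S)
    (hc : ∑ m, x m = 0) {dec : (Fin n → ℂ) → Fin M} (hdec : Measurable dec) :
    Real.log M * (1 - (∑ m, (mixLaw a 1).real {y | dec (x m + y) ≠ m}) / M) - Real.log 2 ≤
      -mixEntropy a 1 + n * (Real.log (Real.pi * (S + P + 1)) + 1) := by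
  have hM : (M : ℝ) ≠ 0 := NeZero.ne _
  have hw : 0 < S + P + 1 := by positivity
  have hi (m : Fin M) : Integrable (fun y => nsq (x m + y)) (mixLaw a 1) :=
    integrable_mixLaw a (quadGrowth_nsq.comp ((LinGrowth.const (x m)).add LinGrowth.id))
  have h := fano_quadGrowth (μ := mixLaw a 1) (ν := volume) (integrable_sq_mixLaw a 1)
    (measurable_mixDensity a 1) (mixDensity_pos a one_pos) (mixLaw_eq_withDensity a one_pos)
    (measurable_cnvDensity (S + P + 1)) (cnvDensity_pos hw) (lintegral_cnvDensity hw).le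
    (φ := fun m y => x m + y) (fun m => measurePreserving_add_left volume (x m))
    (fun m => (LinGrowth.const (x m)).add LinGrowth.id) (fun _ => rfl) (fun _ => rfl)
    (quadGrowth_log_mixDensity a one_pos) (quadGrowth_log_cnvDensity hw) hdec
  refine h.trans ?_
  rw [integral_log_mixDensity]
  simp_rw [integral_log_cnvDensity_comp hw (hi _)]
  rw [Finset.sum_sub_distrib, ← Finset.sum_div, sub_div, div_right_comm]
  have e (m : Fin M) : ∫ y, nsq (x m + y) ∂(mixLaw a 1) =
      (∑ i, nsq (x m + a i)) / K + n := by
    simpa using integral_nsq_add_mixLaw a zero_le_one (x m) 1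
  have e2 : (∑ m, ∫ y, nsq (x m + y) ∂(mixLaw a 1)) / M ≤ n * (S + P + 1) := by
    simp_rw [e]
    rw [Finset.sum_add_distrib, add_div, avg_nsq_add x a (by rw [hc]; simp [ip])]
    simp only [Finset.sum_const, Finset.card_univ, Fintype.card_fin, nsmul_eq_mul]
    rw [mul_div_cancel_left₀ _ hM]
    linarith
  have e3 := div_le_div_of_nonneg_right e2 hw.le
  rw [mul_div_cancel_right₀ _ hw.ne'] at e3
  simp only [Finset.sum_const, Finset.card_univ, Fintype.card_fin, nsmul_eq_mul]
  rw [mul_div_cancel_left₀ _ hM]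
  linarith

/-- The rate bound with the genie signal `S = h x + D`, whose noise `D` is correlated with the
channel noise `γ D + V`. -/
theorem rate_le_of_noisy_input (x : Fin M → Fin n → ℂ) (b : Fin K → Fin n → ℂ) (h γ η : ℂ)
    {P Q s v : ℝ} (hs : 0 < s) (hv : 0 < v) (hP : 0 < P) (hQ : 0 ≤ Q)
    (hx : (∑ m, nsq (x m)) / M ≤ n * P) (hb : (∑ m, nsq (b m)) / K ≤ n * Q)
    (hc : ∑ m, b m = 0) (h1 : ‖γ‖ ^ 2 * s + v = 1) {dec : (Fin n → ℂ) → Fin M}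
    (hdec : Measurable dec) :
    Real.log M * (1 - (∑ m, (mixLaw b 1).real {y | dec (x m + y) ≠ m}) / M) - Real.log 2 ≤
      -(n * (Real.log (Real.pi * s) + 1)) - mixEntropy b v + mixEntropy (fun m => h • x m) s
      + n * (Real.log (Real.pi * (‖1 - η * h‖ ^ 2 * P + Q + ‖γ - η‖ ^ 2 * s + v)) + 1) := by
  have hM : (M : ℝ) ≠ 0 := NeZero.ne _
  set w := ‖1 - η * h‖ ^ 2 * P + Q + ‖γ - η‖ ^ 2 * s + v with hw
  have hw0 : 0 < w := by positivity
  set a : Fin M → Fin n → ℂ := fun m => h • x m with ha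
  have hμ2 := integrable_sq_prod (integrable_sq_CNv (n := n) s) (integrable_sq_mixLaw b v)
  -- Here p.1 is the genie noise D and p.2 is the interference plus innovation; the image is the
  -- pair (S, Y) of genie signal and channel output, of which the decoder reads only Y.
  let φ : Fin M → (Fin n → ℂ) × (Fin n → ℂ) → (Fin n → ℂ) × (Fin n → ℂ) :=
    fun m p => (a m + p.1, (x m + γ • p.1) + p.2)
  have hφL (m : Fin M) : LinGrowth (φ m) :=
    ((LinGrowth.const (a m)).add LinGrowth.id.fst).prodMk
      (((LinGrowth.const (x m)).add (LinGrowth.id.fst.smul γ)).add LinGrowth.id.snd)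
  have hφ (m : Fin M) : MeasurePreserving (φ m) (volume.prod volume) (volume.prod volume) :=
    measurePreserving_shear volume volume (a m) (L := fun z => x m + γ • z) (by fun_prop)
  have f1 := (quadGrowth_log_cnvDensity (n := n) hs).comp
    (LinGrowth.id (E := (Fin n → ℂ) × (Fin n → ℂ))).fst
  have f2 := (quadGrowth_log_mixDensity b hv).comp
    (LinGrowth.id (E := (Fin n → ℂ) × (Fin n → ℂ))).snd
  have g1 := (quadGrowth_log_mixDensity a hs).comp
    (LinGrowth.id (E := (Fin n → ℂ) × (Fin n → ℂ))).fst
  have g2 := (quadGrowth_log_cnvDensity (n := n) hw0).comp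
    ((LinGrowth.id (E := (Fin n → ℂ) × (Fin n → ℂ))).snd.sub (LinGrowth.id.fst.smul η))
  -- The test density is the true law of S times a Gaussian for Y centred at ηS. Any η gives a valid
  -- bound; the regression coefficient makes w the conditional variance.
  have hq1 : ∫⁻ p : (Fin n → ℂ) × (Fin n → ℂ), ENNReal.ofReal
      (mixDensity a s p.1 * cnvDensity n w (p.2 - η • p.1)) ∂(volume.prod volume) ≤ 1 :=
    lintegral_mul_shift_le_one' (f := cnvDensity n w) (g := mixDensity a s)
      (L := fun y => η • y) (by fun_prop) (by fun_prop) (fun y => (mixDensity_pos a hs y).le)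
      (lintegral_cnvDensity hw0).le (lintegral_mixDensity a hs).le (by fun_prop)
  have hf0 (p : (Fin n → ℂ) × (Fin n → ℂ)) : 0 < cnvDensity n s p.1 * mixDensity b v p.2 :=
    mul_pos (cnvDensity_pos hs _) (mixDensity_pos b hv _)
  have hq0 (p : (Fin n → ℂ) × (Fin n → ℂ)) :
      0 < mixDensity a s p.1 * cnvDensity n w (p.2 - η • p.1) :=
    mul_pos (mixDensity_pos a hs _) (cnvDensity_pos hw0 _)
  have hfm : Measurable fun p : (Fin n → ℂ) × (Fin n → ℂ) =>
    cnvDensity n s p.1 * mixDensity b v p.2 := by fun_prop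
  have hqm : Measurable fun p : (Fin n → ℂ) × (Fin n → ℂ) =>
    mixDensity a s p.1 * cnvDensity n w (p.2 - η • p.1) := by fun_prop
  have H := fano_quadGrowth hμ2 hfm hf0 (CNv_prod_mixLaw_eq_withDensity b hs hv) hqm hq0 hq1 hφ
    hφL (fun p => Real.log_mul (cnvDensity_pos hs _).ne' (mixDensity_pos b hv _).ne')
    (fun p => Real.log_mul (mixDensity_pos a hs _).ne' (cnvDensity_pos hw0 _).ne')
    (f1.add f2) (g1.add g2) (dec := fun p => dec p.2) (hdec.comp measurable_snd)
  -- The condition ‖γ‖²s + v = 1 makes γD plus innovation unit-variance noise, so the decoder faces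
  -- the original channel.
  have herr (m : Fin M) : ((CNv n s).prod (mixLaw b v)).real {p | dec (φ m p).2 ≠ m} =
      (mixLaw b 1).real {y | dec (x m + y) ≠ m} := by
    have hl := mixLaw_conv b hs.le hv.le γ 1
    simp only [one_smul, norm_one, one_pow, one_mul, h1] at hl
    rw [← hl, map_measureReal_apply (by fun_prop) (measurableSet_error hdec m (x m))]
    simp only [φ, add_assoc]
    rfl
  simp_rw [herr] at H
  refine H.trans ?_
  rw [integral_add (f1.integrable hμ2) (f2.integrable hμ2),
    integral_fun_fst (fun y => Real.log (cnvDensity n s y)),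
    integral_fun_snd (fun y => Real.log (mixDensity b v y)),
    integral_log_cnvDensity_CNv hs, integral_log_mixDensity]
  have t (m : Fin M) : ∫ e, (Real.log (mixDensity a s (φ m e).1)
      + Real.log (cnvDensity n w ((φ m e).2 - η • (φ m e).1))) ∂((CNv n s).prod (mixLaw b v)) =
      ∫ z, Real.log (mixDensity a s (a m + z)) ∂(CNv n s) - n * Real.log (Real.pi * w)
        - ((∑ i, nsq ((1 - η * h) • x m + b i)) / K + n * (‖γ - η‖ ^ 2 * s + v)) / w := by
    have er (p : (Fin n → ℂ) × (Fin n → ℂ)) : (φ m p).2 - η • (φ m p).1 =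
        (1 - η * h) • x m + ((γ - η) • p.1 + (1 : ℂ) • p.2) := by
      simp only [φ, ha]; module
    have q1 := (g1.comp (hφL m)).integrable hμ2
    have q2 := (g2.comp (hφL m)).integrable hμ2
    have hi : Integrable (fun p => nsq ((φ m p).2 - η • (φ m p).1))
        ((CNv n s).prod (mixLaw b v)) :=
      (quadGrowth_nsq.comp ((hφL m).snd.sub ((hφL m).fst.smul η))).integrable hμ2
    rw [integral_add q1 q2, integral_fun_fst (fun y => Real.log (mixDensity a s (a m + y))),
      integral_log_cnvDensity_comp hw0 hi]
    simp_rw [er]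
    rw [integral_nsq_prod hs.le hv.le]
    simp
    ring
  simp_rw [t]
  rw [Finset.sum_sub_distrib, Finset.sum_sub_distrib, sub_div, sub_div,
    avg_integral_log_mixDensity a hs, ← Finset.sum_div, div_right_comm, Finset.sum_add_distrib,
    add_div, avg_nsq_add (fun m => (1 - η * h) • x m) b (by rw [hc]; simp [ip])]
  simp only [Finset.sum_const, Finset.card_univ, Fintype.card_fin, nsmul_eq_mul, nsq_smul,
    ← Finset.mul_sum, mul_div_assoc (‖1 - η * h‖ ^ 2)]
  rw [mul_div_cancel_left₀ _ hM, mul_div_cancel_left₀ _ hM]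
  have e2 : ‖1 - η * h‖ ^ 2 * ((∑ m, nsq (x m)) / M) + (∑ i, nsq (b i)) / K
      + n * (‖γ - η‖ ^ 2 * s + v) ≤ n * w := by
    have : ‖1 - η * h‖ ^ 2 * ((∑ m, nsq (x m)) / M) ≤ ‖1 - η * h‖ ^ 2 * (n * P) := by gcongr
    rw [hw]
    linarith
  have e3 := div_le_div_of_nonneg_right e2 hw0.le
  rw [mul_div_cancel_right₀ _ hw0.ne'] at e3
  simp only [probReal_univ, one_smul]
  linarith

end Rates

/-! ### Rate of user 2 with the genie signal U -/

section GenieRates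

variable {n M K : ℕ} [NeZero K]

/-- Receiver 2 with the genie signal `U = β D + Y`: the error event in terms of the pair of
independent vectors `(D, Y)`. -/
theorem real_genie_error (a : Fin K → Fin n → ℂ) {β : ℂ} {d e : ℝ} (hd : 0 ≤ d) (he : 0 ≤ e)
    (h1 : ‖1 + β‖ ^ 2 * d + e = 1) {dec : (Fin n → ℂ) → Fin M} (hdec : Measurable dec) (m : Fin M)
    (x : Fin n → ℂ) :
    ((CNv n d).prod (mixLaw a e)).real {p | dec ((x + p.1) + (β • p.1 + p.2)) ≠ m} =
      (mixLaw a 1).real {y | dec (x + y) ≠ m} := by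
  have hl := mixLaw_conv a hd he (1 + β) 1
  simp only [one_smul, norm_one, one_pow, one_mul, h1] at hl
  rw [← hl, map_measureReal_apply (by fun_prop) (measurableSet_error hdec m x)]
  congr 1
  ext p
  simp only [Set.mem_ofPred_eq, Set.mem_preimage]
  rw [show x + p.1 + (β • p.1 + p.2) = x + ((1 + β) • p.1 + p.2) by module]

theorem integral_log_mixDensity_genie (a : Fin K → Fin n → ℂ) {β : ℂ} {d e s : ℝ} (hd : 0 ≤ d)
    (he : 0 ≤ e) (hs : ‖β‖ ^ 2 * d + e = s) :
    ∫ p, Real.log (mixDensity a s (β • p.1 + p.2)) ∂((CNv n d).prod (mixLaw a e)) =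
      -mixEntropy a s := by
  have hl := mixLaw_conv a hd he β 1
  simp only [one_smul, norm_one, one_pow, one_mul, hs] at hl
  rw [← integral_log_mixDensity, ← hl, integral_map (by fun_prop)
    (Measurable.aestronglyMeasurable (by fun_prop))]

variable [NeZero M]

/-- Bounding the rate of user 2 with the genie signal `U`, the law of `(T, U) = (x + D, β D + Y)`
being compared with the product of the marginals. -/
theorem rate_le_of_genie_marginals (x : Fin M → Fin n → ℂ) (a : Fin K → Fin n → ℂ) (β : ℂ)
    {d e s : ℝ} (hd : 0 < d) (he : 0 < e) (h1 : ‖1 + β‖ ^ 2 * d + e = 1)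
    (hs : ‖β‖ ^ 2 * d + e = s) {dec : (Fin n → ℂ) → Fin M} (hdec : Measurable dec) :
    Real.log M * (1 - (∑ m, (mixLaw a 1).real {y | dec (x m + y) ≠ m}) / M) - Real.log 2 ≤
      -(n * (Real.log (Real.pi * d) + 1)) - mixEntropy a e + mixEntropy a s + mixEntropy x d := by
  have hM : (M : ℝ) ≠ 0 := NeZero.ne _
  have hs0 : 0 < s := by rw [← hs]; positivity
  have hμ2 := integrable_sq_prod (integrable_sq_CNv (n := n) d) (integrable_sq_mixLaw a e)
  -- The image is the pair (T, U); the channel output is recovered as T + U.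
  let φ : Fin M → (Fin n → ℂ) × (Fin n → ℂ) → (Fin n → ℂ) × (Fin n → ℂ) :=
    fun m p => (x m + p.1, β • p.1 + p.2)
  have hφL (m : Fin M) : LinGrowth (φ m) :=
    ((LinGrowth.const (x m)).add LinGrowth.id.fst).prodMk
      ((LinGrowth.id.fst.smul β).add LinGrowth.id.snd)
  have hφ (m : Fin M) : MeasurePreserving (φ m) (volume.prod volume) (volume.prod volume) :=
    measurePreserving_shear volume volume (x m) (L := fun z => β • z) (by fun_prop)
  have f1 := (quadGrowth_log_cnvDensity (n := n) hd).comp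
    (LinGrowth.id (E := (Fin n → ℂ) × (Fin n → ℂ))).fst
  have f2 := (quadGrowth_log_mixDensity a he).comp
    (LinGrowth.id (E := (Fin n → ℂ) × (Fin n → ℂ))).snd
  have g1 := (quadGrowth_log_mixDensity a hs0).comp
    (LinGrowth.id (E := (Fin n → ℂ) × (Fin n → ℂ))).snd
  have g2 := (quadGrowth_log_mixDensity x hd).comp
    (LinGrowth.id (E := (Fin n → ℂ) × (Fin n → ℂ))).fst
  have hq1 : ∫⁻ p : (Fin n → ℂ) × (Fin n → ℂ), ENNReal.ofReal
      (mixDensity a s p.2 * mixDensity x d p.1) ∂(volume.prod volume) ≤ 1 := by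
    simpa using lintegral_mul_shift_le_one (μ := volume) (ν := volume) (f := mixDensity x d)
      (g := mixDensity a s) (L := fun _ => 0) (by fun_prop) (by fun_prop)
      (fun y => (mixDensity_pos a hs0 y).le) (lintegral_mixDensity x hd).le
      (lintegral_mixDensity a hs0).le (by fun_prop)
  have hf0 (p : (Fin n → ℂ) × (Fin n → ℂ)) : 0 < cnvDensity n d p.1 * mixDensity a e p.2 :=
    mul_pos (cnvDensity_pos hd _) (mixDensity_pos a he _)
  have hq0 (p : (Fin n → ℂ) × (Fin n → ℂ)) : 0 < mixDensity a s p.2 * mixDensity x d p.1 :=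
    mul_pos (mixDensity_pos a hs0 _) (mixDensity_pos x hd _)
  have hfm : Measurable fun p : (Fin n → ℂ) × (Fin n → ℂ) =>
    cnvDensity n d p.1 * mixDensity a e p.2 := by fun_prop
  have hqm : Measurable fun p : (Fin n → ℂ) × (Fin n → ℂ) =>
    mixDensity a s p.2 * mixDensity x d p.1 := by fun_prop
  have H := fano_quadGrowth hμ2 hfm hf0 (CNv_prod_mixLaw_eq_withDensity a hd he) hqm hq0 hq1 hφ
    hφL (fun p => Real.log_mul (cnvDensity_pos hd _).ne' (mixDensity_pos a he _).ne')
    (fun p => Real.log_mul (mixDensity_pos a hs0 _).ne' (mixDensity_pos x hd _).ne')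
    (f1.add f2) (g1.add g2) (dec := fun p => dec (p.1 + p.2))
    (hdec.comp (measurable_fst.add measurable_snd))
  have herr (m : Fin M) := real_genie_error a hd.le he.le h1 hdec m (x m)
  simp only [φ] at H
  simp_rw [herr] at H
  refine H.trans ?_
  rw [integral_add (f1.integrable hμ2) (f2.integrable hμ2),
    integral_fun_fst (fun y => Real.log (cnvDensity n d y)),
    integral_fun_snd (fun y => Real.log (mixDensity a e y)),
    integral_log_cnvDensity_CNv hd, integral_log_mixDensity]
  have t (m : Fin M) : ∫ p, (Real.log (mixDensity a s (β • p.1 + p.2))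
      + Real.log (mixDensity x d (x m + p.1))) ∂((CNv n d).prod (mixLaw a e)) =
      -mixEntropy a s + ∫ z, Real.log (mixDensity x d (x m + z)) ∂(CNv n d) := by
    have q1 := (g1.comp (hφL m)).integrable hμ2
    have q2 := (g2.comp (hφL m)).integrable hμ2
    rw [integral_add q1 q2, integral_log_mixDensity_genie a hd.le he.le hs,
      integral_fun_fst (fun y => Real.log (mixDensity x d (x m + y)))]
    simp
  simp_rw [t]
  rw [Finset.sum_add_distrib, add_div, avg_integral_log_mixDensity x hd]
  simp only [Finset.sum_const, Finset.card_univ, Fintype.card_fin, nsmul_eq_mul]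
  rw [mul_div_cancel_left₀ _ hM]
  simp only [probReal_univ, one_smul]
  linarith

/-- Bounding the rate of user 2 with the genie signal `U`, the conditional law of `T` given `U`
being compared with a Gaussian one. -/
theorem rate_le_of_genie_gaussian (x : Fin M → Fin n → ℂ) (a : Fin K → Fin n → ℂ) (β τ : ℂ)
    {d e s P S : ℝ} (hd : 0 < d) (he : 0 < e) (hP : 0 < P) (hS : 0 ≤ S)
    (hx : (∑ m, nsq (x m)) / M ≤ n * P) (ha : (∑ m, nsq (a m)) / K ≤ n * S) (hc : ∑ m, x m = 0)
    (h1 : ‖1 + β‖ ^ 2 * d + e = 1) (hs : ‖β‖ ^ 2 * d + e = s) {dec : (Fin n → ℂ) → Fin M}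
    (hdec : Measurable dec) :
    Real.log M * (1 - (∑ m, (mixLaw a 1).real {y | dec (x m + y) ≠ m}) / M) - Real.log 2 ≤
      -(n * (Real.log (Real.pi * d) + 1)) - mixEntropy a e + mixEntropy a s
      + n * (Real.log (Real.pi * (‖τ‖ ^ 2 * S + P + ‖1 - τ * β‖ ^ 2 * d + ‖τ‖ ^ 2 * e)) + 1) := by
  have hM : (M : ℝ) ≠ 0 := NeZero.ne _
  have hs0 : 0 < s := by rw [← hs]; positivity
  set w := ‖τ‖ ^ 2 * S + P + ‖1 - τ * β‖ ^ 2 * d + ‖τ‖ ^ 2 * e with hw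
  have hw0 : 0 < w := by positivity
  have hμ2 := integrable_sq_prod (integrable_sq_CNv (n := n) d) (integrable_sq_mixLaw a e)
  let φ : Fin M → (Fin n → ℂ) × (Fin n → ℂ) → (Fin n → ℂ) × (Fin n → ℂ) :=
    fun m p => (x m + p.1, β • p.1 + p.2)
  have hφL (m : Fin M) : LinGrowth (φ m) :=
    ((LinGrowth.const (x m)).add LinGrowth.id.fst).prodMk
      ((LinGrowth.id.fst.smul β).add LinGrowth.id.snd)
  have hφ (m : Fin M) : MeasurePreserving (φ m) (volume.prod volume) (volume.prod volume) :=
    measurePreserving_shear volume volume (x m) (L := fun z => β • z) (by fun_prop)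
  have f1 := (quadGrowth_log_cnvDensity (n := n) hd).comp
    (LinGrowth.id (E := (Fin n → ℂ) × (Fin n → ℂ))).fst
  have f2 := (quadGrowth_log_mixDensity a he).comp
    (LinGrowth.id (E := (Fin n → ℂ) × (Fin n → ℂ))).snd
  have g1 := (quadGrowth_log_mixDensity a hs0).comp
    (LinGrowth.id (E := (Fin n → ℂ) × (Fin n → ℂ))).snd
  have g2 := (quadGrowth_log_cnvDensity (n := n) hw0).comp
    ((LinGrowth.id (E := (Fin n → ℂ) × (Fin n → ℂ))).fst.sub (LinGrowth.id.snd.smul τ))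
  -- The test density is the true law of U times a Gaussian for T centred at τU, for an arbitrary
  -- coefficient τ.
  have hq1 : ∫⁻ p : (Fin n → ℂ) × (Fin n → ℂ), ENNReal.ofReal
      (mixDensity a s p.2 * cnvDensity n w (p.1 - τ • p.2)) ∂(volume.prod volume) ≤ 1 :=
    lintegral_mul_shift_le_one (f := cnvDensity n w) (g := mixDensity a s)
      (L := fun y => τ • y) (by fun_prop) (by fun_prop) (fun y => (mixDensity_pos a hs0 y).le)
      (lintegral_cnvDensity hw0).le (lintegral_mixDensity a hs0).le (by fun_prop)
  have hf0 (p : (Fin n → ℂ) × (Fin n → ℂ)) : 0 < cnvDensity n d p.1 * mixDensity a e p.2 :=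
    mul_pos (cnvDensity_pos hd _) (mixDensity_pos a he _)
  have hq0 (p : (Fin n → ℂ) × (Fin n → ℂ)) :
      0 < mixDensity a s p.2 * cnvDensity n w (p.1 - τ • p.2) :=
    mul_pos (mixDensity_pos a hs0 _) (cnvDensity_pos hw0 _)
  have hfm : Measurable fun p : (Fin n → ℂ) × (Fin n → ℂ) =>
    cnvDensity n d p.1 * mixDensity a e p.2 := by fun_prop
  have hqm : Measurable fun p : (Fin n → ℂ) × (Fin n → ℂ) =>
    mixDensity a s p.2 * cnvDensity n w (p.1 - τ • p.2) := by fun_prop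
  have H := fano_quadGrowth hμ2 hfm hf0 (CNv_prod_mixLaw_eq_withDensity a hd he) hqm hq0 hq1 hφ
    hφL (fun p => Real.log_mul (cnvDensity_pos hd _).ne' (mixDensity_pos a he _).ne')
    (fun p => Real.log_mul (mixDensity_pos a hs0 _).ne' (cnvDensity_pos hw0 _).ne')
    (f1.add f2) (g1.add g2) (dec := fun p => dec (p.1 + p.2))
    (hdec.comp (measurable_fst.add measurable_snd))
  have herr (m : Fin M) := real_genie_error a hd.le he.le h1 hdec m (x m)
  simp only [φ] at H
  simp_rw [herr] at H
  refine H.trans ?_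
  rw [integral_add (f1.integrable hμ2) (f2.integrable hμ2),
    integral_fun_fst (fun y => Real.log (cnvDensity n d y)),
    integral_fun_snd (fun y => Real.log (mixDensity a e y)),
    integral_log_cnvDensity_CNv hd, integral_log_mixDensity]
  have t (m : Fin M) : ∫ p, (Real.log (mixDensity a s (β • p.1 + p.2))
      + Real.log (cnvDensity n w (x m + p.1 - τ • (β • p.1 + p.2))))
        ∂((CNv n d).prod (mixLaw a e)) =
      -mixEntropy a s - n * Real.log (Real.pi * w)
        - ((∑ i, nsq (x m + (-τ) • a i)) / K + n * (‖1 - τ * β‖ ^ 2 * d + ‖τ‖ ^ 2 * e)) / w := by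
    have er (p : (Fin n → ℂ) × (Fin n → ℂ)) : x m + p.1 - τ • (β • p.1 + p.2) =
        x m + ((1 - τ * β) • p.1 + (-τ) • p.2) := by
      module
    have q1 := (g1.comp (hφL m)).integrable hμ2
    have q2 := (g2.comp (hφL m)).integrable hμ2
    have hi : Integrable (fun p => nsq ((φ m p).1 - τ • (φ m p).2))
        ((CNv n d).prod (mixLaw a e)) :=
      (quadGrowth_nsq.comp ((hφL m).fst.sub ((hφL m).snd.smul τ))).integrable hμ2
    simp only [φ] at hi
    rw [integral_add q1 q2, integral_log_mixDensity_genie a hd.le he.le hs,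
      integral_log_cnvDensity_comp hw0 hi]
    simp_rw [er]
    rw [integral_nsq_prod hd.le he.le, norm_neg]
    ring
  simp_rw [t]
  rw [Finset.sum_sub_distrib, sub_div, ← Finset.sum_div, div_right_comm, Finset.sum_add_distrib,
    add_div, avg_nsq_add x (fun i => (-τ) • a i) (by rw [hc]; simp [ip])]
  simp only [Finset.sum_const, Finset.card_univ, Fintype.card_fin, nsmul_eq_mul, nsq_smul,
    ← Finset.mul_sum, norm_neg]
  rw [mul_div_assoc (‖τ‖ ^ 2), mul_div_cancel_left₀ _ hM, mul_div_cancel_left₀ _ hM]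
  have e2 : (∑ m, nsq (x m)) / M + ‖τ‖ ^ 2 * ((∑ i, nsq (a i)) / K)
      + n * (‖1 - τ * β‖ ^ 2 * d + ‖τ‖ ^ 2 * e) ≤ n * w := by
    have : ‖τ‖ ^ 2 * ((∑ m, nsq (a m)) / K) ≤ ‖τ‖ ^ 2 * (n * S) := by gcongr
    rw [hw]
    linarith
  have e3 := div_le_div_of_nonneg_right e2 hw0.le
  rw [mul_div_cancel_right₀ _ hw0.ne'] at e3
  simp only [probReal_univ, one_smul]
  linarith

end GenieRates

/-! ### Rate of user 2 compared with a noisier copy of its signal -/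

section DegradedRates

variable {n M K : ℕ} [NeZero M] [NeZero K]

theorem CNv_prod_mixLaw_prod_CNv_eq_withDensity (a : Fin K → Fin n → ℂ) {d e v : ℝ} (hd : 0 < d)
    (he : 0 < e) (hv : 0 < v) :
    (CNv n d).prod ((mixLaw a e).prod (CNv n v)) =
      (volume.prod (volume.prod volume)).withDensity fun p => ENNReal.ofReal
        (cnvDensity n d p.1 * (mixDensity a e p.2.1 * cnvDensity n v p.2.2)) := by
  have h1 := CNv_eq_withDensity (n := n) hd
  have h2 := mixLaw_eq_withDensity a he
  have h3 := CNv_eq_withDensity (n := n) hv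
  have : SFinite (volume.withDensity fun y => ENNReal.ofReal (cnvDensity n d y)) := by
    rw [← h1]; infer_instance
  have : SFinite (volume.withDensity fun y => ENNReal.ofReal (mixDensity a e y)) := by
    rw [← h2]; infer_instance
  have : SFinite (volume.withDensity fun y => ENNReal.ofReal (cnvDensity n v y)) := by
    rw [← h3]; infer_instance
  have h4 : (mixLaw a e).prod (CNv n v) = (volume.prod volume).withDensity fun p => ENNReal.ofReal
      (mixDensity a e p.1 * cnvDensity n v p.2) := by
    rw [h2, h3, prod_withDensity_ofReal (by fun_prop) (by fun_prop)
      fun y => (mixDensity_pos a he y).le]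
  have : SFinite ((volume.prod volume).withDensity fun p : (Fin n → ℂ) × (Fin n → ℂ) =>
      ENNReal.ofReal (mixDensity a e p.1 * cnvDensity n v p.2)) := by
    rw [← h4]; infer_instance
  rw [h4, h1, prod_withDensity_ofReal (f := cnvDensity n d)
    (g := fun p : (Fin n → ℂ) × (Fin n → ℂ) => mixDensity a e p.1 * cnvDensity n v p.2)
    (by fun_prop) (by fun_prop) fun y => (cnvDensity_pos hd y).le]

set_option maxHeartbeats 600000 in
/-- Bounding the rate of user 2 with the genie signal `U`, the joint law of `T`, `U` and of the
degraded signal `C = T + G` being compared with the product of the marginals of `U` and `C` and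
a Gaussian conditional law of `T`. -/
theorem rate_le_of_genie_degraded (x : Fin M → Fin n → ℂ) (a : Fin K → Fin n → ℂ) (β τ : ℂ)
    {d e s P S v r : ℝ} (hd : 0 < d) (he : 0 < e) (hP : 0 < P) (hS : 0 ≤ S) (hv : 0 < v)
    (hx : (∑ m, nsq (x m)) / M ≤ n * P) (ha : (∑ m, nsq (a m)) / K ≤ n * S) (hc : ∑ m, x m = 0)
    (h1 : ‖1 + β‖ ^ 2 * d + e = 1) (hs : ‖β‖ ^ 2 * d + e = s)
    (hr : r = ‖τ‖ ^ 2 * S + P + ‖1 - τ * β‖ ^ 2 * d + ‖τ‖ ^ 2 * e)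
    {dec : (Fin n → ℂ) → Fin M} (hdec : Measurable dec) :
    Real.log M * (1 - (∑ m, (mixLaw a 1).real {y | dec (x m + y) ≠ m}) / M) - Real.log 2 ≤
      -(n * (Real.log (Real.pi * d) + 1)) - mixEntropy a e + mixEntropy a s + mixEntropy x (d + v)
      + n * (Real.log r - Real.log (r + v)) := by
  have hM : (M : ℝ) ≠ 0 := NeZero.ne _
  have hs0 : 0 < s := by rw [← hs]; positivity
  have hr0 : 0 < r := by rw [hr]; positivity
  have hdv : 0 < d + v := by positivity
  -- The residual T - τU has variance r in the Gaussian model. Observing C = T + G as well, the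
  -- estimate of T becomes τU + α(C - τU) = αC + τ'U, with mean square error w = rv/(r + v).
  set α : ℝ := r / (r + v) with hα
  set w : ℝ := r * v / (r + v) with hw
  have hw0 : 0 < w := by positivity
  set τ' : ℂ := ((1 - α : ℝ) : ℂ) * τ with hτ'
  have hμ2 := integrable_sq_prod (integrable_sq_CNv (n := n) d)
    (integrable_sq_prod (integrable_sq_mixLaw a e) (integrable_sq_CNv (n := n) v))
  have hmp1 : MeasurePreserving (Prod.map id Prod.fst)
      ((CNv n d).prod ((mixLaw a e).prod (CNv n v))) ((CNv n d).prod (mixLaw a e)) :=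
    (MeasurePreserving.id _).prod measurePreserving_fst
  have hmp2 : MeasurePreserving (Prod.map id Prod.snd)
      ((CNv n d).prod ((mixLaw a e).prod (CNv n v))) ((CNv n d).prod (CNv n v)) :=
    (MeasurePreserving.id _).prod measurePreserving_snd
  -- The independent vectors p = (D, a + E, G) are carried to (T, (U, C)).
  let φ : Fin M → (Fin n → ℂ) × ((Fin n → ℂ) × (Fin n → ℂ)) →
      (Fin n → ℂ) × ((Fin n → ℂ) × (Fin n → ℂ)) :=
    fun m p => (x m + p.1, (β • p.1, x m + p.1) + p.2)
  have hφL (m : Fin M) : LinGrowth (φ m) :=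
    ((LinGrowth.const (x m)).add LinGrowth.id.fst).prodMk
      (((LinGrowth.id.fst.smul β).prodMk ((LinGrowth.const (x m)).add LinGrowth.id.fst)).add
        LinGrowth.id.snd)
  have : ((volume : Measure (Fin n → ℂ)).prod (volume : Measure (Fin n → ℂ))).IsAddLeftInvariant :=
    Measure.prod.instIsAddLeftInvariant
  have hφ (m : Fin M) : MeasurePreserving (φ m) (volume.prod (volume.prod volume))
      (volume.prod (volume.prod volume)) :=
    measurePreserving_shear volume (volume.prod volume) (x m)
      (L := fun z => (β • z, x m + z)) (by fun_prop)
  have hid := LinGrowth.id (E := (Fin n → ℂ) × ((Fin n → ℂ) × (Fin n → ℂ)))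
  have f1 := (quadGrowth_log_cnvDensity (n := n) hd).comp hid.fst
  have f2 := (quadGrowth_log_mixDensity a he).comp hid.snd.fst
  have f3 := (quadGrowth_log_cnvDensity (n := n) hv).comp hid.snd.snd
  have g1 := (quadGrowth_log_mixDensity a hs0).comp hid.snd.fst
  have g2 := (quadGrowth_log_mixDensity x hdv).comp hid.snd.snd
  have hrL := hid.fst.sub ((hid.snd.snd.smul (α : ℂ)).add (hid.snd.fst.smul τ'))
  have g3 := (quadGrowth_log_cnvDensity (n := n) hw0).comp hrL
  have hq1 : ∫⁻ p : (Fin n → ℂ) × ((Fin n → ℂ) × (Fin n → ℂ)), ENNReal.ofReal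
      ((mixDensity a s p.2.1 * mixDensity x (d + v) p.2.2) *
        cnvDensity n w (p.1 - ((α : ℂ) • p.2.2 + τ' • p.2.1))) ∂(volume.prod (volume.prod volume))
      ≤ 1 := by
    have h0 : ∫⁻ p : (Fin n → ℂ) × (Fin n → ℂ), ENNReal.ofReal
        (mixDensity a s p.1 * mixDensity x (d + v) p.2) ∂(volume.prod volume) ≤ 1 := by
      simpa using lintegral_mul_shift_le_one' (μ := volume) (ν := volume)
        (f := mixDensity x (d + v)) (g := mixDensity a s) (L := fun _ => 0) (by fun_prop)
        (by fun_prop) (fun y => (mixDensity_pos a hs0 y).le) (lintegral_mixDensity x hdv).le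
        (lintegral_mixDensity a hs0).le (by fun_prop)
    exact lintegral_mul_shift_le_one (f := cnvDensity n w)
      (g := fun p : (Fin n → ℂ) × (Fin n → ℂ) => mixDensity a s p.1 * mixDensity x (d + v) p.2)
      (L := fun p : (Fin n → ℂ) × (Fin n → ℂ) => (α : ℂ) • p.2 + τ' • p.1)
      (by fun_prop) (by fun_prop)
      (fun y => (mul_pos (mixDensity_pos a hs0 _) (mixDensity_pos x hdv _)).le)
      (lintegral_cnvDensity hw0).le h0 (by fun_prop)
  have hf0 (p : (Fin n → ℂ) × ((Fin n → ℂ) × (Fin n → ℂ))) :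
      0 < cnvDensity n d p.1 * (mixDensity a e p.2.1 * cnvDensity n v p.2.2) :=
    mul_pos (cnvDensity_pos hd _) (mul_pos (mixDensity_pos a he _) (cnvDensity_pos hv _))
  have hq0' (p : (Fin n → ℂ) × ((Fin n → ℂ) × (Fin n → ℂ))) :
      0 < mixDensity a s p.2.1 * mixDensity x (d + v) p.2.2 :=
    mul_pos (mixDensity_pos a hs0 _) (mixDensity_pos x hdv _)
  have hq0 (p : (Fin n → ℂ) × ((Fin n → ℂ) × (Fin n → ℂ))) :
      0 < (mixDensity a s p.2.1 * mixDensity x (d + v) p.2.2) *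
        cnvDensity n w (p.1 - ((α : ℂ) • p.2.2 + τ' • p.2.1)) :=
    mul_pos (hq0' p) (cnvDensity_pos hw0 _)
  have hfm : Measurable fun p : (Fin n → ℂ) × ((Fin n → ℂ) × (Fin n → ℂ)) =>
    cnvDensity n d p.1 * (mixDensity a e p.2.1 * cnvDensity n v p.2.2) := by fun_prop
  have hqm : Measurable fun p : (Fin n → ℂ) × ((Fin n → ℂ) × (Fin n → ℂ)) =>
    (mixDensity a s p.2.1 * mixDensity x (d + v) p.2.2) *
      cnvDensity n w (p.1 - ((α : ℂ) • p.2.2 + τ' • p.2.1)) := by fun_prop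
  have hlf (p : (Fin n → ℂ) × ((Fin n → ℂ) × (Fin n → ℂ))) :
      Real.log (cnvDensity n d p.1 * (mixDensity a e p.2.1 * cnvDensity n v p.2.2)) =
      Real.log (cnvDensity n d p.1) + (Real.log (mixDensity a e p.2.1)
        + Real.log (cnvDensity n v p.2.2)) := by
    rw [Real.log_mul (cnvDensity_pos hd _).ne' (mul_pos (mixDensity_pos a he _)
      (cnvDensity_pos hv _)).ne', Real.log_mul (mixDensity_pos a he _).ne'
      (cnvDensity_pos hv _).ne']
  have hlq (p : (Fin n → ℂ) × ((Fin n → ℂ) × (Fin n → ℂ))) :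
      Real.log ((mixDensity a s p.2.1 * mixDensity x (d + v) p.2.2) *
        cnvDensity n w (p.1 - ((α : ℂ) • p.2.2 + τ' • p.2.1))) =
      (Real.log (mixDensity a s p.2.1) + Real.log (mixDensity x (d + v) p.2.2)) +
        Real.log (cnvDensity n w (p.1 - ((α : ℂ) • p.2.2 + τ' • p.2.1))) := by
    rw [Real.log_mul (hq0' p).ne' (cnvDensity_pos hw0 _).ne',
      Real.log_mul (mixDensity_pos a hs0 _).ne' (mixDensity_pos x hdv _).ne']
  have H := fano_quadGrowth hμ2 hfm hf0 (CNv_prod_mixLaw_prod_CNv_eq_withDensity a hd he hv) hqm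
    hq0 hq1 hφ hφL hlf hlq (f1.add (f2.add f3)) ((g1.add g2).add g3)
    (dec := fun p => dec (p.1 + p.2.1)) (hdec.comp (measurable_fst.add measurable_snd.fst))
  have herr (m : Fin M) : ((CNv n d).prod ((mixLaw a e).prod (CNv n v))).real
      {p | dec ((φ m p).1 + (φ m p).2.1) ≠ m} = (mixLaw a 1).real {y | dec (x m + y) ≠ m} := by
    have hset : MeasurableSet {p : (Fin n → ℂ) × (Fin n → ℂ) |
        dec ((x m + p.1) + (β • p.1 + p.2)) ≠ m} := by
      have : Measurable fun p : (Fin n → ℂ) × (Fin n → ℂ) =>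
        (x m + p.1) + (β • p.1 + p.2) := by fun_prop
      exact (hdec.comp this) (measurableSet_singleton m).compl
    rw [← real_genie_error a hd.le he.le h1 hdec m (x m),
      ← hmp1.map_eq, map_measureReal_apply hmp1.measurable hset]
    rfl
  simp_rw [herr] at H
  refine H.trans ?_
  have F : ∫ p, (Real.log (cnvDensity n d p.1) + (Real.log (mixDensity a e p.2.1)
      + Real.log (cnvDensity n v p.2.2))) ∂((CNv n d).prod ((mixLaw a e).prod (CNv n v))) =
      -(n * (Real.log (Real.pi * d) + 1)) - mixEntropy a e
        - n * (Real.log (Real.pi * v) + 1) := by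
    rw [integral_add (f1.integrable hμ2) ((f2.add f3).integrable hμ2),
      integral_add (f2.integrable hμ2) (f3.integrable hμ2),
      integral_fun_fst (fun y => Real.log (cnvDensity n d y)),
      integral_fun_snd (fun p : (Fin n → ℂ) × (Fin n → ℂ) => Real.log (mixDensity a e p.1)),
      integral_fun_snd (fun p : (Fin n → ℂ) × (Fin n → ℂ) => Real.log (cnvDensity n v p.2)),
      integral_fun_fst (fun y => Real.log (mixDensity a e y)),
      integral_fun_snd (fun y => Real.log (cnvDensity n v y)),
      integral_log_cnvDensity_CNv hd, integral_log_cnvDensity_CNv hv, integral_log_mixDensity]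
    simp only [probReal_univ, one_smul]
    ring
  rw [F]
  have t (m : Fin M) : ∫ p, ((Real.log (mixDensity a s (φ m p).2.1)
      + Real.log (mixDensity x (d + v) (φ m p).2.2))
      + Real.log (cnvDensity n w ((φ m p).1 - ((α : ℂ) • (φ m p).2.2 + τ' • (φ m p).2.1))))
        ∂((CNv n d).prod ((mixLaw a e).prod (CNv n v))) =
      -mixEntropy a s + ∫ z, Real.log (mixDensity x (d + v) (x m + z)) ∂(CNv n (d + v))
        - n * Real.log (Real.pi * w)
        - ((1 - α) ^ 2 * ((∑ i, nsq (x m + (-τ) • a i)) / K +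
          n * (‖1 - τ * β‖ ^ 2 * d + ‖τ‖ ^ 2 * e)) + n * (α ^ 2 * v)) / w := by
    have er (p : (Fin n → ℂ) × ((Fin n → ℂ) × (Fin n → ℂ))) :
        (φ m p).1 - ((α : ℂ) • (φ m p).2.2 + τ' • (φ m p).2.1) =
        ((1 - α : ℝ) : ℂ) • x m + ((((1 - α : ℝ) : ℂ) * (1 - τ * β)) • p.1 +
          ((((1 - α : ℝ) : ℂ) * (-τ)) • p.2.1 + (-α : ℂ) • p.2.2)) := by
      simp only [φ, hτ', Prod.fst_add, Prod.snd_add]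
      push_cast
      module
    have q1 := (g1.comp (hφL m)).integrable hμ2
    have q2 := (g2.comp (hφL m)).integrable hμ2
    have q3 := (g3.comp (hφL m)).integrable hμ2
    have q12 : Integrable (fun p => Real.log (mixDensity a s (φ m p).2.1)
        + Real.log (mixDensity x (d + v) (φ m p).2.2))
        ((CNv n d).prod ((mixLaw a e).prod (CNv n v))) := q1.add q2
    have hi : Integrable (fun p => nsq ((φ m p).1 - ((α : ℂ) • (φ m p).2.2 + τ' • (φ m p).2.1)))
        ((CNv n d).prod ((mixLaw a e).prod (CNv n v))) :=
      (quadGrowth_nsq.comp (hrL.comp (hφL m))).integrable hμ2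
    have t1 : ∫ p, Real.log (mixDensity a s (φ m p).2.1)
        ∂((CNv n d).prod ((mixLaw a e).prod (CNv n v))) = -mixEntropy a s := by
      rw [← integral_log_mixDensity_genie a hd.le he.le hs, ← hmp1.map_eq,
        integral_map hmp1.measurable.aemeasurable
          (Measurable.aestronglyMeasurable (by fun_prop))]
      rfl
    have t2 : ∫ p, Real.log (mixDensity x (d + v) (φ m p).2.2)
        ∂((CNv n d).prod ((mixLaw a e).prod (CNv n v))) =
        ∫ z, Real.log (mixDensity x (d + v) (x m + z)) ∂(CNv n (d + v)) := by
      have hl := CNv_prod_map_add (n := n) hd.le hv.le 1 1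
      simp only [one_smul, norm_one, one_pow, one_mul] at hl
      rw [← hl, integral_map (by fun_prop) (Measurable.aestronglyMeasurable (by fun_prop)),
        ← hmp2.map_eq, integral_map hmp2.measurable.aemeasurable
          (Measurable.aestronglyMeasurable (by fun_prop))]
      simp only [φ, Prod.snd_add, Prod.map_fst, Prod.map_snd, id, add_assoc]
    have es (i : Fin K) : nsq (((1 - α : ℝ) : ℂ) • x m + (((1 - α : ℝ) : ℂ) * (-τ)) • a i) =
        (1 - α) ^ 2 * nsq (x m + (-τ) • a i) := by
      rw [mul_smul, ← smul_add, nsq_smul]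
      simp only [Complex.norm_real, Real.norm_eq_abs, sq_abs]
    rw [integral_add q12 q3, integral_add q1 q2, t1, t2,
      integral_log_cnvDensity_comp hw0 hi]
    simp_rw [er]
    rw [integral_nsq_prod_prod hd.le he.le hv.le]
    simp_rw [es]
    simp only [norm_mul, mul_pow, norm_neg, Complex.norm_real, Real.norm_eq_abs, sq_abs,
      ← Finset.mul_sum]
    ring
  simp_rw [t]
  rw [Finset.sum_sub_distrib, sub_div, ← Finset.sum_div, div_right_comm (∑ i, _) w,
    Finset.sum_add_distrib, add_div, ← Finset.mul_sum, mul_div_assoc, Finset.sum_add_distrib,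
    add_div (∑ i, (∑ j, nsq (x i + (-τ) • a j)) / (K : ℝ)),
    avg_nsq_add x (fun i => (-τ) • a i) (by rw [hc]; simp [ip]), Finset.sum_sub_distrib, sub_div,
    Finset.sum_add_distrib, add_div, avg_integral_log_mixDensity x hdv]
  simp only [Finset.sum_const, Finset.card_univ, Fintype.card_fin, nsmul_eq_mul, nsq_smul,
    ← Finset.mul_sum, norm_neg]
  rw [mul_div_cancel_left₀ _ hM, mul_div_cancel_left₀ _ hM, mul_div_cancel_left₀ _ hM,
    mul_div_cancel_left₀ _ hM, mul_div_assoc (‖τ‖ ^ 2)]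
  have e2 : (1 - α) ^ 2 * ((∑ m, nsq (x m)) / M + ‖τ‖ ^ 2 * ((∑ i, nsq (a i)) / K)
      + n * (‖1 - τ * β‖ ^ 2 * d + ‖τ‖ ^ 2 * e)) + n * (α ^ 2 * v) ≤ n * w := by
    have h2 : ‖τ‖ ^ 2 * ((∑ m, nsq (a m)) / K) ≤ ‖τ‖ ^ 2 * (n * S) := by gcongr
    have h3 : (∑ m, nsq (x m)) / M + ‖τ‖ ^ 2 * ((∑ i, nsq (a i)) / K)
      + n * (‖1 - τ * β‖ ^ 2 * d + ‖τ‖ ^ 2 * e) ≤ n * r := by rw [hr]; linarith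
    calc _ ≤ (1 - α) ^ 2 * (n * r) + n * (α ^ 2 * v) := by gcongr
      _ = n * w := by
        rw [hw, hα]
        have : r + v ≠ 0 := by positivity
        field_simp
        ring
  have e3 := div_le_div_of_nonneg_right e2 hw0.le
  rw [mul_div_cancel_right₀ _ hw0.ne'] at e3
  -- The summand log(πv) cancels the entropy of the auxiliary noise G, leaving log r - log(r + v).
  have hlogw : Real.log (Real.pi * w) = Real.log (Real.pi * v) + Real.log r
      - Real.log (r + v) := by
    rw [hw, mul_comm r v, mul_div_assoc', ← mul_assoc, Real.log_div (by positivity)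
      (by positivity), Real.log_mul (by positivity) (by positivity)]
  have e4 : n * Real.log (Real.pi * w) = n * Real.log (Real.pi * v) +
      n * (Real.log r - Real.log (r + v)) := by rw [hlogw]; ring
  linarith

end DegradedRates

theorem nsq_smul_avg_le {n M : ℕ} (x : Fin M → Fin n → ℂ) (h : ℂ) {P : ℝ}
    (hx : (∑ m, nsq (x m)) / M ≤ n * P) :
    (∑ m, nsq (h • x m)) / M ≤ n * (‖h‖ ^ 2 * P) := by
  simp_rw [nsq_smul]
  rw [← Finset.mul_sum, mul_div_assoc, mul_left_comm]
  gcongr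

section GenieRates

variable {n M K : ℕ} [NeZero M] [NeZero K]

/-- The three bounds on the rate of user 2 with the genie signal, in a common form which compares
with the interference `h x` seen by user 1 in noise of variance `v`. -/
theorem rate_le_of_genie (x : Fin M → Fin n → ℂ) (a : Fin K → Fin n → ℂ) (β τ h : ℂ)
    {d e s P S v r : ℝ} (hd : 0 < d) (he : 0 < e) (hP : 0 < P) (hS : 0 ≤ S) (hv : 0 < v)
    (hdv : ‖h‖ ^ 2 * d ≤ v)
    (hx : (∑ m, nsq (x m)) / M ≤ n * P) (ha : (∑ m, nsq (a m)) / K ≤ n * S) (hc : ∑ m, x m = 0)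
    (h1 : ‖1 + β‖ ^ 2 * d + e = 1) (hs : ‖β‖ ^ 2 * d + e = s)
    (hr : r = ‖τ‖ ^ 2 * S + P + ‖1 - τ * β‖ ^ 2 * d + ‖τ‖ ^ 2 * e)
    {dec : (Fin n → ℂ) → Fin M} (hdec : Measurable dec) :
    Real.log M * (1 - (∑ m, (mixLaw a 1).real {y | dec (x m + y) ≠ m}) / M) - Real.log 2 ≤
      -(n * (Real.log (Real.pi * d) + 1)) - mixEntropy a e + mixEntropy a s
      + mixEntropy (fun m => h • x m) v
      + n * (Real.log r - Real.log (‖h‖ ^ 2 * r + (v - ‖h‖ ^ 2 * d))) := by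
  have hr0 : 0 < r := by rw [hr]; positivity
  -- If h = 0, the interference term is a pure noise entropy and the Gaussian comparison suffices.
  -- If ‖h‖²d = v, then hT already has the law of the interference in noise, and dropping the
  -- conditioning on U suffices. Otherwise genuine extra noise is needed.
  rcases eq_or_ne h 0 with rfl | hh
  · refine (rate_le_of_genie_gaussian x a β τ hd he hP hS hx ha hc h1 hs hdec).trans ?_
    rw [← hr]
    simp only [zero_smul, norm_zero]
    rw [mixEntropy_zero hv, Real.log_mul Real.pi_ne_zero hr0.ne',
      Real.log_mul Real.pi_ne_zero hv.ne']
    norm_num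
    linarith
  · have hH : 0 < ‖h‖ ^ 2 := by positivity
    rcases hdv.eq_or_lt with rfl | hlt
    · refine (rate_le_of_genie_marginals x a β hd he h1 hs hdec).trans ?_
      rw [mixEntropy_smul x hd hh, sub_self, add_zero, Real.log_mul hH.ne' hr0.ne']
      linarith
    · obtain ⟨u, hu, rfl⟩ : ∃ u, 0 < u ∧ v = ‖h‖ ^ 2 * (d + u) :=
        ⟨v / ‖h‖ ^ 2 - d, by rw [sub_pos, lt_div_iff₀ hH]; linarith, by field_simp; ring⟩
      refine (rate_le_of_genie_degraded x a β τ hd he hP hS hu hx ha hc h1 hs hr hdec).trans ?_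
      rw [mixEntropy_smul x (by positivity) hh,
        show ‖h‖ ^ 2 * r + (‖h‖ ^ 2 * (d + u) - ‖h‖ ^ 2 * d) = ‖h‖ ^ 2 * (r + u) by ring,
        Real.log_mul hH.ne' (by positivity)]
      linarith

/-- The smaller of u and w is paired with e and the larger with 1; each pair is an instance of
`mixEntropy_sub_le`. -/
theorem mixEntropy_sub_add_sub_le (a : Fin M → Fin n → ℂ) {S u w e : ℝ} (hS : 0 ≤ S) (hu : 0 < u)
    (hw : 0 < w) (hu1 : u ≤ 1) (hw1 : w ≤ 1) (he : min u w ≤ e)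
    (ha : (∑ m, nsq (a m)) / M ≤ n * S) :
    mixEntropy a u - mixEntropy a e + mixEntropy a w - mixEntropy a 1 ≤
      n * (Real.log (S + u) - Real.log (S + e) + Real.log (S + w) - Real.log (S + 1)) := by
  rcases le_total u w with h | h
  · rw [min_eq_left h] at he
    linarith [mixEntropy_sub_le a hS hu he ha, mixEntropy_sub_le a hS hw hw1 ha]
  · rw [min_eq_right h] at he
    linarith [mixEntropy_sub_le a hS hw he ha, mixEntropy_sub_le a hS hu hu1 ha]

/-- The multi-letter bound for centred codewords of user 2. -/
theorem log_add_log_le_boundNat (x₁ : Fin M → Fin n → ℂ) (x₂ : Fin K → Fin n → ℂ)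
    (h g β γ τ η : ℂ) {P₁ P₂ sN sW d e vN : ℝ} (hP₁ : 0 < P₁) (hP₂ : 0 < P₂)
    (hx₁ : (∑ m, nsq (x₁ m)) / M ≤ n * P₁) (hx₂ : (∑ m, nsq (x₂ m)) / K ≤ n * P₂)
    (hc : ∑ m, x₂ m = 0) (hd : 0 < d) (he : 0 < e) (hvN : 0 < vN) (hsN : 0 < sN) (hsW : 0 < sW)
    (hsN1 : sN ≤ 1) (hsW1 : sW ≤ 1) (h1 : ‖1 + β‖ ^ 2 * d + e = 1) (h2 : ‖β‖ ^ 2 * d + e = sW)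
    (h3 : ‖γ‖ ^ 2 * sN + vN = 1) (hmin : min sN sW ≤ e) (hdv : ‖h‖ ^ 2 * d ≤ vN)
    {dec₁ : (Fin n → ℂ) → Fin M} {dec₂ : (Fin n → ℂ) → Fin K} (hdec₁ : Measurable dec₁)
    (hdec₂ : Measurable dec₂) :
    Real.log M * (1 - (∑ m, (mixLaw (fun m => h • x₂ m) 1).real
        {y | dec₁ (x₁ m + y) ≠ m}) / M) +
      2 * (Real.log K * (1 - (∑ m, (mixLaw (fun m => g • x₁ m) 1).real
        {y | dec₂ (x₂ m + y) ≠ m}) / K)) - 3 * Real.log 2 ≤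
      n * boundNat (‖h‖ ^ 2) (‖g‖ ^ 2 * P₁) P₂ sN sW e
        (‖τ * g‖ ^ 2 * P₁ + P₂ + ‖1 - τ * β‖ ^ 2 * d + ‖τ‖ ^ 2 * e)
        (‖1 - η * g‖ ^ 2 * P₁ + ‖h‖ ^ 2 * P₂ + ‖γ - η‖ ^ 2 * sN + vN) d vN := by
  have ha := nsq_smul_avg_le x₁ g hx₁
  have hb := nsq_smul_avg_le x₂ h hx₂
  have hS : 0 ≤ ‖g‖ ^ 2 * P₁ := by positivity
  -- The entropy of the interference h·x₂ in noise of variance vN enters `i1` and `i3` with opposite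
  -- signs and cancels; the four entropies of g·x₁ left over are those of `i4`. Each use of Fano's
  -- inequality costs one log 2.
  have i1 := rate_le_of_noisy_input x₁ (fun m => h • x₂ m) g γ η hsN hvN hP₁
    (by positivity) hx₁ hb (by rw [← Finset.smul_sum, hc, smul_zero]) h3 hdec₁
  have i2 := rate_le_of_output x₂ (fun m => g • x₁ m) hP₂ hS hx₂ ha hc hdec₂
  have hr : ‖τ * g‖ ^ 2 * P₁ + P₂ + ‖1 - τ * β‖ ^ 2 * d + ‖τ‖ ^ 2 * e =
      ‖τ‖ ^ 2 * (‖g‖ ^ 2 * P₁) + P₂ + ‖1 - τ * β‖ ^ 2 * d + ‖τ‖ ^ 2 * e := by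
    rw [norm_mul]; ring
  have i3 := rate_le_of_genie x₂ (fun m => g • x₁ m) β τ h hd he hP₂ hS hvN hdv hx₂ ha hc h1 h2
    hr hdec₂
  have i4 := mixEntropy_sub_add_sub_le (fun m => g • x₁ m) hS hsN hsW hsN1 hsW1 hmin ha
  rw [Real.log_mul Real.pi_ne_zero (by positivity)] at i1 i2 i3
  rw [Real.log_mul Real.pi_ne_zero (by positivity)] at i1
  rw [boundNat]
  linarith

end GenieRates

/-! ### From codes to the multi-letter bound -/

section Codes

variable {n M K : ℕ} [NeZero M] [NeZero K]

theorem real_mixLaw (a : Fin M → Fin n → ℂ) (v : ℝ) {A : Set (Fin n → ℂ)} (hA : MeasurableSet A) :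
    (mixLaw a v).real A = (∑ m, (CNv n v).real {z | a m + z ∈ A}) / M := by
  have h : mixLaw a v A = ∑ m, (M : ENNReal)⁻¹ * CNv n v {z | a m + z ∈ A} := by
    rw [mixLaw, Measure.finsetSum_apply]
    refine Finset.sum_congr rfl fun m _ => ?_
    rw [Measure.smul_apply, Measure.map_apply (by fun_prop) hA, smul_eq_mul]
    rfl
  rw [measureReal_def, h, ENNReal.toReal_sum fun m _ => ENNReal.mul_ne_top
    (by simp [NeZero.ne M]) (measure_ne_top _ _), Finset.sum_div]
  refine Finset.sum_congr rfl fun m _ => ?_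
  rw [ENNReal.toReal_mul, ENNReal.toReal_inv, ENNReal.toReal_natCast, measureReal_def]
  ring

/-- The codewords of user 2 may be centred. -/
theorem nsq_sub_avg_le (x : Fin M → Fin n → ℂ) :
    ∑ m, nsq (x m - (M : ℂ)⁻¹ • ∑ i, x i) ≤ ∑ m, nsq (x m) := by
  have hM : (M : ℂ) ≠ 0 := NeZero.ne _
  set μ := (M : ℂ)⁻¹ • ∑ i, x i with hμ
  have h0 : ∑ m, (x m - μ) = 0 := by
    simp [hμ, Finset.sum_sub_distrib, ← Nat.cast_smul_eq_nsmul ℂ, smul_smul, hM]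
  have h (m : Fin M) : nsq (x m) = nsq (x m - μ) + (2 * (ip (x m - μ) μ).re + nsq μ) := by
    have : nsq (x m) = (ip ((x m - μ) + μ) ((x m - μ) + μ)).re := by
      rw [sub_add_cancel, ip_self, Complex.ofReal_re]
    rw [this, ip_add_left, ip_add_right, ip_add_right, ip_self, ip_self, ← ip_conj_symm μ]
    simp
    ring
  have h' : ∑ m, (ip (x m - μ) μ).re = 0 := by
    have : ip (∑ m, (x m - μ)) μ = ∑ m, ip (x m - μ) μ := by
      simp only [ip, Finset.sum_apply, Finset.sum_mul]
      rw [Finset.sum_comm]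
    rw [← Complex.re_sum, ← this, h0]
    simp [ip]
  rw [Finset.sum_congr rfl fun m _ => h m, Finset.sum_add_distrib, Finset.sum_add_distrib,
    ← Finset.mul_sum, h']
  have : 0 ≤ ∑ m : Fin M, nsq μ := Finset.sum_nonneg fun _ _ => nsq_nonneg _
  linarith

/-- Subtracting the mean codeword of user 2 shifts both outputs by known vectors. The decoders undo
the shift, so the error probabilities are unchanged, and the average power does not increase. Only
average power is used from here on, hence it does not matter that individual centred codewords may
violate the power constraint. -/
theorem Code.log_le_boundNat {c : Channel} (C : Code c n M K)
    (β γ τ η : ℂ) {sN sW d e vN : ℝ} (hd : 0 < d) (he : 0 < e) (hvN : 0 < vN) (hsN : 0 < sN)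
    (hsW : 0 < sW) (hsN1 : sN ≤ 1) (hsW1 : sW ≤ 1) (h1 : ‖1 + β‖ ^ 2 * d + e = 1)
    (h2 : ‖β‖ ^ 2 * d + e = sW) (h3 : ‖γ‖ ^ 2 * sN + vN = 1) (hmin : min sN sW ≤ e)
    (hdv : ‖c.h12‖ ^ 2 * d ≤ vN) :
    Real.log M * (1 - C.err1) + 2 * (Real.log K * (1 - C.err2)) - 3 * Real.log 2 ≤
      n * boundNat (‖c.h12‖ ^ 2) (‖c.h21‖ ^ 2 * c.P1) c.P2 sN sW e
        (‖τ * c.h21‖ ^ 2 * c.P1 + c.P2 + ‖1 - τ * β‖ ^ 2 * d + ‖τ‖ ^ 2 * e)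
        (‖1 - η * c.h21‖ ^ 2 * c.P1 + ‖c.h12‖ ^ 2 * c.P2 + ‖γ - η‖ ^ 2 * sN + vN) d vN := by
  have hM : (0 : ℝ) < M := Nat.cast_pos.2 (NeZero.pos M)
  have hK : (0 : ℝ) < K := Nat.cast_pos.2 (NeZero.pos K)
  have hKC : (K : ℂ) ≠ 0 := NeZero.ne _
  set μ := (K : ℂ)⁻¹ • ∑ i, C.enc2 i with hμ
  have hx₁ : (∑ m, nsq (C.enc1 m)) / M ≤ n * c.P1 := by
    rw [div_le_iff₀ hM]
    calc _ ≤ ∑ m : Fin M, n * c.P1 := Finset.sum_le_sum fun m _ => C.power1 m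
      _ = _ := by simp [mul_comm]
  have hx₂ : (∑ m, nsq (C.enc2 m - μ)) / K ≤ n * c.P2 := by
    rw [div_le_iff₀ hK]
    calc _ ≤ ∑ m, nsq (C.enc2 m) := nsq_sub_avg_le _
      _ ≤ ∑ m : Fin K, n * c.P2 := Finset.sum_le_sum fun m _ => C.power2 m
      _ = _ := by simp [mul_comm]
  have hc : ∑ m, (C.enc2 m - μ) = 0 := by
    simp [hμ, Finset.sum_sub_distrib, ← Nat.cast_smul_eq_nsmul ℂ, smul_smul, hKC]
  have hdec₁ : Measurable fun y => C.dec1 (y + c.h12 • μ) :=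
    C.measurable_dec1.comp (measurable_id.add_const _)
  have hdec₂ : Measurable fun y => C.dec2 (y + μ) :=
    C.measurable_dec2.comp (measurable_id.add_const _)
  have H := log_add_log_le_boundNat C.enc1 (fun m => C.enc2 m - μ) c.h12 c.h21 β γ τ η c.P1_pos
    c.P2_pos hx₁ hx₂ hc hd he hvN hsN hsW hsN1 hsW1 h1 h2 h3 hmin hdv hdec₁ hdec₂
  have e1 : (∑ m, (mixLaw (fun m => c.h12 • (C.enc2 m - μ)) 1).real
      {y | C.dec1 (C.enc1 m + y + c.h12 • μ) ≠ m}) / M = C.err1 := by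
    rw [Code.err1, mul_comm (M : ℝ), ← div_div, iidCN_eq_CNv]
    congr 1
    rw [Finset.sum_div]
    refine Finset.sum_congr rfl fun m _ => ?_
    have hA : MeasurableSet {y | C.dec1 (C.enc1 m + y + c.h12 • μ) ≠ m} :=
      (hdec₁.comp (measurable_id.const_add (C.enc1 m))) (measurableSet_singleton m).compl
    rw [real_mixLaw _ _ hA]
    congr 1
    refine Finset.sum_congr rfl fun m' _ => ?_
    congr 1
    ext z
    have : C.enc1 m + (c.h12 • (C.enc2 m' - μ) + z) + c.h12 • μ =
        fun t => C.enc1 m t + c.h12 * C.enc2 m' t + z t := by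
      ext t
      simp
      ring
    simp only [Set.mem_ofPred_eq, this]
  have e2 : (∑ m, (mixLaw (fun m => c.h21 • C.enc1 m) 1).real
      {y | C.dec2 (C.enc2 m - μ + y + μ) ≠ m}) / K = C.err2 := by
    rw [Code.err2, Finset.sum_comm, ← div_div, iidCN_eq_CNv]
    congr 1
    rw [Finset.sum_div]
    refine Finset.sum_congr rfl fun m _ => ?_
    have hA : MeasurableSet {y | C.dec2 (C.enc2 m - μ + y + μ) ≠ m} :=
      (hdec₂.comp (measurable_id.const_add (C.enc2 m - μ))) (measurableSet_singleton m).compl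
    rw [real_mixLaw _ _ hA]
    congr 1
    refine Finset.sum_congr rfl fun m' _ => ?_
    congr 1
    ext z
    have : C.enc2 m - μ + (c.h21 • C.enc1 m' + z) + μ =
        fun t => c.h21 * C.enc1 m' t + C.enc2 m t + z t := by
      ext t
      simp
      ring
    simp only [Set.mem_ofPred_eq, this]
  rw [e1, e2] at H
  exact H

end Codes

/-! ### Large block length, degenerate genie and closure -/

theorem numMsg_pos (n : ℕ) (R : ℝ) : 0 < numMsg n R := Nat.ceil_pos.2 (by positivity)

theorem mul_log_two_le_log_numMsg (n : ℕ) (R : ℝ) :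
    n * (R * Real.log 2) ≤ Real.log (numMsg n R) := by
  calc n * (R * Real.log 2) = Real.log ((2 : ℝ) ^ ((n : ℝ) * R)) := by
        rw [Real.log_rpow two_pos]; ring
    _ ≤ _ := Real.log_le_log (by positivity) (Nat.le_ceil _)

theorem Channel.Achievable.le_boundNat {c : Channel} {R : ℝ × ℝ} (hR : c.Achievable R)
    (β γ τ η : ℂ) {sN sW d e vN : ℝ} (hd : 0 < d) (he : 0 < e) (hvN : 0 < vN) (hsN : 0 < sN)
    (hsW : 0 < sW) (hsN1 : sN ≤ 1) (hsW1 : sW ≤ 1) (h1 : ‖1 + β‖ ^ 2 * d + e = 1)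
    (h2 : ‖β‖ ^ 2 * d + e = sW) (h3 : ‖γ‖ ^ 2 * sN + vN = 1) (hmin : min sN sW ≤ e)
    (hdv : ‖c.h12‖ ^ 2 * d ≤ vN) :
    (R.1 + 2 * R.2) * Real.log 2 ≤
      boundNat (‖c.h12‖ ^ 2) (‖c.h21‖ ^ 2 * c.P1) c.P2 sN sW e
        (‖τ * c.h21‖ ^ 2 * c.P1 + c.P2 + ‖1 - τ * β‖ ^ 2 * d + ‖τ‖ ^ 2 * e)
        (‖1 - η * c.h21‖ ^ 2 * c.P1 + ‖c.h12‖ ^ 2 * c.P2 + ‖γ - η‖ ^ 2 * sN + vN) d vN := by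
  obtain ⟨-, -, C, hC1, hC2⟩ := hR
  set B := boundNat (‖c.h12‖ ^ 2) (‖c.h21‖ ^ 2 * c.P1) c.P2 sN sW e
    (‖τ * c.h21‖ ^ 2 * c.P1 + c.P2 + ‖1 - τ * β‖ ^ 2 * d + ‖τ‖ ^ 2 * e)
    (‖1 - η * c.h21‖ ^ 2 * c.P1 + ‖c.h12‖ ^ 2 * c.P2 + ‖γ - η‖ ^ 2 * sN + vN) d vN
  have hlim : Tendsto (fun n : ℕ => R.1 * Real.log 2 * (1 - (C n).err1) +
      2 * (R.2 * Real.log 2 * (1 - (C n).err2)) - 3 * Real.log 2 / n) atTop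
      (𝓝 (R.1 * Real.log 2 * (1 - 0) + 2 * (R.2 * Real.log 2 * (1 - 0)) - 0)) :=
    (((hC1.const_sub 1).const_mul _).add (((hC2.const_sub 1).const_mul _).const_mul 2)).sub
      (tendsto_const_div_atTop_nhds_zero_nat _)
  have hle : R.1 * Real.log 2 * (1 - 0) + 2 * (R.2 * Real.log 2 * (1 - 0)) - 0 ≤ B := by
    refine le_of_tendsto hlim ?_
    -- Error probabilities at most 1 make the factors 1 - err nonnegative, so the lower bounds on
    -- the logarithms of the message numbers may be multiplied by them.
    filter_upwards [hC1.eventually_le_const one_pos, hC2.eventually_le_const one_pos,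
      eventually_gt_atTop 0] with n hn1 hn2 hn
    have : NeZero (numMsg n R.1) := ⟨(numMsg_pos n R.1).ne'⟩
    have : NeZero (numMsg n R.2) := ⟨(numMsg_pos n R.2).ne'⟩
    have H := (C n).log_le_boundNat β γ τ η hd he hvN hsN hsW hsN1 hsW1 h1 h2 h3 hmin hdv
    have k1 := mul_le_mul_of_nonneg_right (mul_log_two_le_log_numMsg n R.1) (sub_nonneg.2 hn1)
    have k2 := mul_le_mul_of_nonneg_right (mul_log_two_le_log_numMsg n R.2) (sub_nonneg.2 hn2)
    have hn' : (0 : ℝ) < n := Nat.cast_pos.2 hn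
    refine le_of_mul_le_mul_left ?_ hn'
    rw [mul_sub, mul_div_cancel₀ _ hn'.ne']
    linarith
  linarith

theorem Channel.Achievable.le_bound {c : Channel} {R : ℝ × ℝ} (hR : c.Achievable R) {κ : Params}
    (hr : κ.InRange) (ha : Admissible c κ) (hn : Nondegenerate c κ) :
    R.1 + 2 * R.2 ≤ bound c κ := by
  obtain ⟨β, γ, τ, η, d, e, vN, hd, he, hvN, h1, h2, h3, hmin, hdv, hB⟩ :=
    exists_bound_eq c κ hr ha hn
  obtain ⟨⟨hN0, hN1⟩, -, -, ⟨hW0, hW1⟩, -⟩ := hr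
  have hP2 := c.P2_pos
  have hsN : 0 < κ.σN1 ^ 2 := by have := hn.1; positivity
  have hsN1 : κ.σN1 ^ 2 ≤ 1 := pow_le_one₀ hN0 hN1
  rw [mul_comm d] at h1
  rw [hB, le_div_iff₀ (Real.log_pos one_lt_two)]
  -- If W₂ = 0 then E = 0 and the law of a + E has no density. The genie noise is then approximated
  -- by a component of Z₂ of variance t > 0, independent of the rest of Z₂: β = 0, d = 1 - t, e = t.
  -- Nondegeneracy gives h₂₁ ≠ 0, which keeps every logarithm continuous as t → 0.
  rcases eq_or_ne κ.σW2 0 with hW | hW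
  · have hh : c.h21 ≠ 0 := fun h => hn.2.2.1 h hW
    have hS : 0 < ‖c.h21‖ ^ 2 * c.P1 := by have := c.P1_pos; positivity
    rw [hW] at h2 ⊢
    have he0 : e = 0 := by
      have : 0 ≤ ‖β‖ ^ 2 * d := by positivity
      nlinarith
    have hβ : β = 0 := by
      rw [he0] at h2
      have : ‖β‖ ^ 2 = 0 := by
        rcases mul_eq_zero.1 (show ‖β‖ ^ 2 * d = 0 by linarith) with h | h
        · exact h
        · exact absurd h hd.ne'
      simpa using this
    obtain rfl : d = 1 := by simpa [he0, hβ] using h1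
    subst he0 hβ
    set s : ℝ → ℝ := fun t => ‖τ * c.h21‖ ^ 2 * c.P1 + c.P2 + ‖1 - τ * 0‖ ^ 2 * (1 - t)
      + ‖τ‖ ^ 2 * t with hs
    set s₁ := ‖1 - η * c.h21‖ ^ 2 * c.P1 + ‖c.h12‖ ^ 2 * c.P2 + ‖γ - η‖ ^ 2 * κ.σN1 ^ 2 + vN
    have hs0 : 0 < s 0 := by have := c.P1_pos; simp only [hs]; norm_num; positivity
    have hHs : 0 < ‖c.h12‖ ^ 2 * s 0 + (vN - ‖c.h12‖ ^ 2 * (1 - 0)) := by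
      rcases (sq_nonneg ‖c.h12‖).eq_or_lt with h | h
      · rw [← h]; linarith
      · have := mul_pos h hs0
        linarith
    have hcs : ContinuousAt s 0 := by fun_prop
    have hcont : ContinuousAt (fun t => boundNat (‖c.h12‖ ^ 2) (‖c.h21‖ ^ 2 * c.P1) c.P2
        (κ.σN1 ^ 2) t t (s t) s₁ (1 - t) vN) 0 := by
      have c1 : ContinuousAt (fun t => Real.log (‖c.h21‖ ^ 2 * c.P1 + t)) 0 :=
        ContinuousAt.log (by fun_prop) (by simpa using hS.ne')
      have c2 : ContinuousAt (fun t => Real.log (s t)) 0 := hcs.log hs0.ne'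
      have c3 : ContinuousAt (fun t => Real.log (‖c.h12‖ ^ 2 * s t
          + (vN - ‖c.h12‖ ^ 2 * (1 - t)))) 0 :=
        ContinuousAt.log (by fun_prop) hHs.ne'
      have c4 : ContinuousAt (fun t : ℝ => Real.log (1 - t)) 0 :=
        ContinuousAt.log (by fun_prop) (by norm_num)
      unfold boundNat
      fun_prop
    have hev : ∀ᶠ t in 𝓝[>] (0 : ℝ), (R.1 + 2 * R.2) * Real.log 2 ≤
        boundNat (‖c.h12‖ ^ 2) (‖c.h21‖ ^ 2 * c.P1) c.P2 (κ.σN1 ^ 2) t t (s t) s₁ (1 - t) vN := by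
      -- Admissibility survives the perturbation: e equals the new variance of W₂, and d only
      -- decreases from 1.
      filter_upwards [Ioo_mem_nhdsGT one_pos] with t ht
      refine hR.le_boundNat 0 γ τ η (sub_pos.2 ht.2) ht.1 hvN hsN ht.1 hsN1 ht.2.le (by norm_num)
        (by norm_num) h3 (min_le_right _ _) (le_trans ?_ hdv)
      gcongr
      linarith [ht.1]
    simpa [hs] using ge_of_tendsto (hcont.tendsto.mono_left nhdsWithin_le_nhds) hev
  · have hsW : 0 < κ.σW2 ^ 2 := by positivity
    -- Here the first admissibility condition forces e > 0.
    exact hR.le_boundNat β γ τ η hd ((lt_min hsN hsW).trans_le hmin) hvN hsN hsW hsN1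
      (pow_le_one₀ hW0 hW1) h1 h2 h3 hmin hdv

/-- The bound on achievable pairs cuts out a closed half-plane, so it passes to the closure. -/
theorem capacityRegion_subset_bound (c : Channel) (κ : Params) (hr : κ.InRange)
    (ha : Admissible c κ) (hn : Nondegenerate c κ) :
    c.capacityRegion ⊆ {R : ℝ × ℝ | R.1 + 2 * R.2 ≤ bound c κ} :=
  closure_minimal (fun _ hR => hR.le_bound hr ha hn)
    (isClosed_le (by fun_prop) continuous_const)

/-! ### Interchange of the users -/

/-- The code with the users interchanged. -/
def Code.swap {c : Channel} {n M K : ℕ} (C : Code c n M K) : Code c.swap n K M :=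
  ⟨C.enc2, C.enc1, C.dec2, C.dec1, C.power2, C.power1, C.measurable_dec2, C.measurable_dec1⟩

theorem Code.err1_swap {c : Channel} {n M K : ℕ} (C : Code c n M K) : C.swap.err1 = C.err2 := by
  rw [Code.err1, Code.err2, Finset.sum_comm, mul_comm (K : ℝ)]
  simp only [Code.swap, Channel.swap, add_comm (C.enc2 _ _)]

theorem Code.err2_swap {c : Channel} {n M K : ℕ} (C : Code c n M K) : C.swap.err2 = C.err1 := by
  rw [Code.err1, Code.err2, Finset.sum_comm, mul_comm (K : ℝ)]
  simp only [Code.swap, Channel.swap, add_comm (C.enc1 _ _)]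

theorem Channel.Achievable.swap {c : Channel} {R : ℝ × ℝ} (hR : c.Achievable R) :
    c.swap.Achievable R.swap := by
  obtain ⟨h1, h2, C, hC1, hC2⟩ := hR
  exact ⟨h2, h1, fun n => (C n).swap, by simpa only [Code.err1_swap] using hC2,
    by simpa only [Code.err2_swap] using hC1⟩

theorem Params.InRange.swap {κ : Params} (h : κ.InRange) : κ.swap.InRange :=
  ⟨h.2.1, h.1, h.2.2.2.1, h.2.2.1, h.2.2.2.2.2.1, h.2.2.2.2.1, h.2.2.2.2.2.2.2,
    h.2.2.2.2.2.2.1⟩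

theorem capacityRegion_subset_bound_swap (c : Channel) (κ : Params) (hr : κ.InRange)
    (ha : Admissible c.swap κ.swap) (hn : Nondegenerate c.swap κ.swap) :
    c.capacityRegion ⊆ {R : ℝ × ℝ | 2 * R.1 + R.2 ≤ bound c.swap κ.swap} :=
  closure_minimal (fun R hR => by
      have := hR.swap.le_bound hr.swap ha hn
      rw [Prod.fst_swap, Prod.snd_swap] at this
      change 2 * R.1 + R.2 ≤ bound c.swap κ.swap
      linarith)
    (isClosed_le (by fun_prop) continuous_const)

end GaussIC

theorem mainTheorem11 (c : GaussIC.Channel) (hweak : c.WeakInterference) :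
    (∀ κ : GaussIC.Params, κ.InRange → GaussIC.Admissible c κ → GaussIC.Nondegenerate c κ →
      c.capacityRegion ⊆ {R : ℝ × ℝ | R.1 + 2 * R.2 ≤ GaussIC.bound c κ}) ∧
    (∀ κ : GaussIC.Params, κ.InRange → GaussIC.Admissible c.swap κ.swap →
      GaussIC.Nondegenerate c.swap κ.swap →
      c.capacityRegion ⊆ {R : ℝ × ℝ | 2 * R.1 + R.2 ≤ GaussIC.bound c.swap κ.swap}) := by
  exact ⟨fun κ hr ha hn => GaussIC.capacityRegion_subset_bound c κ hr ha hn,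
    fun κ hr ha hn => GaussIC.capacityRegion_subset_bound_swap c κ hr ha hn⟩
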